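/- Let $\mu,\nu$ be probability laws on $\mathbb N=\{0,1,\dots\}$ with $\mu(1)<1$ and $\nu(0)>0$, and let $f(s)=\sum_n s^n\mu(n)$, $g(s)=\sum_n s^n\nu(n)$. Assume (SL): there are constants $c,d>0$, $\alpha\in(0,1]$ and functions $\ell,k:(0,1)\to(0,\infty)$, slowly varying at zero, with $\ell(u)/k(u)\to1$ as $u\downarrow0$, such that $$f(s)=s+c(1-s)^{1+\alpha}\ell(1-s),\qquad g(s)=1-d(1-s)^{\alpha}k(1-s),\qquad s\in(0,1),$$ and assume $\delta:=d/(\alpha c)\in(0,1)$. Let $(b_n)$ be a scaling sequence, i.e. $b_n\to\infty$ and $b_n^\alpha\sim n\,\ell(1/b_n)$ as $n\to\infty$. Let $Z_1$ be the Bienaymé–Galton–Watson process with immigration started at $0$ with offspring law $\mu$ and immigration law $\nu$; that is, $Z_1$ has the law of the solution of $Z_1(m)=X_1\big(\sum_{0\le j<m}Z_1(j)\big)+Y_1(m)$, $m\in\mathbb N$, where $X_1$ and $Y_1$ are independent random walks started at $0$ whose jump laws are $\tilde\mu(i)=\mu(i+1)$, $i\ge-1$, and $\nu$, respectively. For each $n$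 let $Z_n=(Z_n(s))_{s\ge0}$ be a càdlàg process with the law of $(Z_1(\lfloor ns\rfloor)/b_n)_{s\ge 0}$, and put $d_{u}(Z_n)=\inf\{s>u: Z_n(s)=0\}$ (with $\inf\emptyset=\infty$). Let $t>0$ and let $t_n\ge0$ satisfy $t_n\to t$. Then there is exactly one probability measure $\nu^t$ on $[0,\infty)$ (the Linnik law) with Laplace transform $\lambda\mapsto(1+\alpha c t\lambda^\alpha)^{-1}$, $\lambda\ge0$, and, as $n\to\infty$, the conditional law of $Z_n(t_n)$, given that $Z_n$ is positive on $[1/n,t_n]$, converges weakly to $\nu^t$. Moreover $$\lim_{n\to\infty}\mathbb E\big[e^{-\lambda Z_n(t_n)}\,\big|\,d_{1/n}(Z_n)>t_n\big]=(1+\alpha c t\lambda^\alpha)^{-1}\qquad\text{for all }\lambda\ge0 .$$ In particular the limit law depends on neither $d$ nor $\delta$. -/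

import Mathlib

open MeasureTheory ProbabilityTheory Filter Topology Set
open scoped NNReal ENNReal BoundedContinuousFunction

noncomputable section

namespace BGWI

/-- The probability generating function `s ↦ ∑ sⁿ μ(n)` of a law on `ℕ`. -/
def genFun (μ : PMF ℕ) (s : ℝ) : ℝ := ∑' n : ℕ, s ^ n * (μ n).toReal

/-- `ℓ : (0,1) → (0,∞)` is (measurable and) slowly varying at zero. Only the values of `ℓ` on
`(0,1)` matter. -/
structure SlowlyVaryingAtZero (ℓ : ℝ → ℝ) : Prop where
  pos : ∀ u ∈ Ioo (0 : ℝ) 1, 0 < ℓ u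
  measurable : Measurable fun u : Ioo (0 : ℝ) 1 => ℓ u
  tendsto : ∀ a : ℝ, 0 < a → Tendsto (fun u => ℓ (a * u) / ℓ u) (𝓝[>] 0) (𝓝 1)

/-- The assumption (SL) on the offspring law `μ` and the immigration law `ν`. -/
structure SL (μ ν : PMF ℕ) (α c d : ℝ) (ℓ k : ℝ → ℝ) : Prop where
  alpha_pos : 0 < α
  alpha_le_one : α ≤ 1
  c_pos : 0 < c
  d_pos : 0 < d
  slow_l : SlowlyVaryingAtZero ℓ
  slow_k : SlowlyVaryingAtZero k
  ratio : Tendsto (fun u => ℓ u / k u) (𝓝[>] 0) (𝓝 1)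
  offspring : ∀ s ∈ Ioo (0 : ℝ) 1, genFun μ s = s + c * (1 - s) ^ (1 + α) * ℓ (1 - s)
  immigration : ∀ s ∈ Ioo (0 : ℝ) 1, genFun ν s = 1 - d * (1 - s) ^ α * k (1 - s)

/-- `b` is a scaling sequence: an asymptotic inverse (along the integers) of
`x ↦ x ^ α / ℓ (1 / x)` at infinity, i.e. `b n → ∞` and `b n ^ α ∼ n ℓ (1 / b n)`. -/
structure IsScalingSequence (α : ℝ) (ℓ : ℝ → ℝ) (b : ℕ → ℝ) : Prop where
  tendsto_atTop : Tendsto b atTop atTop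
  equiv : Tendsto (fun n : ℕ => b n ^ α / (n * ℓ (1 / b n))) atTop (𝓝 1)

/-- The walk `X₁` with jumps `χ i - 1`, where `χ i` are the offspring numbers. -/
def offspringWalk (χ : ℕ → ℕ) (m : ℕ) : ℤ := ∑ i ∈ Finset.range m, ((χ i : ℤ) - 1)

/-- The walk `Y₁` with jumps the immigration numbers `η i`. -/
def immigrationWalk (η : ℕ → ℕ) (m : ℕ) : ℤ := ∑ i ∈ Finset.range m, (η i : ℤ)

/-- The cumulative population `C₁(m) = ∑_{j < m} Z₁(j)` of the solution of the discrete Lamperti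
recursion `Z₁ = X₁ ∘ C₁ + Y₁`. -/
def cumPop (χ η : ℕ → ℕ) : ℕ → ℕ
  | 0 => 0
  | m + 1 => cumPop χ η m + (offspringWalk χ (cumPop χ η m) + immigrationWalk η m).toNat

/-- The solution `Z₁` of the discrete Lamperti recursion `Z₁ = X₁ ∘ C₁ + Y₁`; the next theorem
shows that `Int.toNat` truncates nothing. -/
def path (χ η : ℕ → ℕ) (m : ℕ) : ℕ :=
  (offspringWalk χ (cumPop χ η m) + immigrationWalk η m).toNat

theorem cumPop_eq (χ η : ℕ → ℕ) (m : ℕ) :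
    cumPop χ η m = ∑ j ∈ Finset.range m, path χ η j := by
  induction m with
  | zero => rfl
  | succ m ih => rw [Finset.sum_range_succ, ← ih]; rfl

theorem neg_le_offspringWalk_add (χ : ℕ → ℕ) (a z : ℕ) :
    offspringWalk χ a - z ≤ offspringWalk χ (a + z) := by
  induction z with
  | zero => simp
  | succ z ih =>
    have h : offspringWalk χ (a + (z + 1)) = offspringWalk χ (a + z) + ((χ (a + z) : ℤ) - 1) := by
      rw [← add_assoc, offspringWalk, Finset.sum_range_succ]; rfl
    rw [h]; push_cast; omega

theorem path_eq (χ η : ℕ → ℕ) (m : ℕ) :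
    (path χ η m : ℤ) = offspringWalk χ (cumPop χ η m) + immigrationWalk η m := by
  induction m with
  | zero => simp [path, cumPop, offspringWalk, immigrationWalk]
  | succ m ih =>
    have h1 := neg_le_offspringWalk_add χ (cumPop χ η m) (path χ η m)
    have h2 : cumPop χ η (m + 1) = cumPop χ η m + path χ η m := rfl
    have h3 : immigrationWalk η (m + 1) = immigrationWalk η m + η m := by
      rw [immigrationWalk, Finset.sum_range_succ]; rfl
    rw [path, Int.toNat_of_nonneg]
    rw [h2, h3]; omega

theorem measurable_walks (m : ℕ) :
    Measurable (fun χ : ℕ → ℕ => offspringWalk χ m) ∧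
      Measurable (fun η : ℕ → ℕ => immigrationWalk η m) := by
  constructor
  · unfold offspringWalk
    refine Finset.measurable_sum _ fun i _ => ?_
    exact (measurable_of_countable (fun x : ℕ => (x : ℤ) - 1)).comp (measurable_pi_apply i)
  · unfold immigrationWalk
    refine Finset.measurable_sum _ fun i _ => ?_
    exact (measurable_of_countable (fun x : ℕ => (x : ℤ))).comp (measurable_pi_apply i)

theorem measurable_step {f : (ℕ → ℕ) × (ℕ → ℕ) → ℕ} (hf : Measurable f) (m : ℕ) :
    Measurable fun p : (ℕ → ℕ) × (ℕ → ℕ) =>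
      (offspringWalk p.1 (f p) + immigrationWalk p.2 m).toNat := by
  have h1 : Measurable fun q : (ℕ → ℕ) × ℕ => offspringWalk q.1 q.2 :=
    measurable_from_prod_countable_left fun a => (measurable_walks a).1
  have h2 : Measurable fun p : (ℕ → ℕ) × (ℕ → ℕ) => offspringWalk p.1 (f p) :=
    h1.comp (measurable_fst.prodMk hf)
  exact (measurable_of_countable Int.toNat).comp
    (h2.add ((measurable_walks m).2.comp measurable_snd))

theorem measurable_path :
    Measurable fun p : (ℕ → ℕ) × (ℕ → ℕ) => path p.1 p.2 := by
  have hC : ∀ m, Measurable fun p : (ℕ → ℕ) × (ℕ → ℕ) => cumPop p.1 p.2 m := by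
    intro m
    induction m with
    | zero => exact measurable_const
    | succ m ih => exact ih.add (measurable_step ih m)
  exact measurable_pi_lambda _ fun m => measurable_step (hC m) m

/-- The law on `ℕ → ℕ` of the BGWI process `Z₁` started at `0` with offspring law `μ` and
immigration law `ν`: the walks `X₁` and `Y₁` are independent, with i.i.d. jumps. -/
def law (μ ν : PMF ℕ) : Measure (ℕ → ℕ) :=
  ((Measure.infinitePi fun _ : ℕ => μ.toMeasure).prod
    (Measure.infinitePi fun _ : ℕ => ν.toMeasure)).map fun p => path p.1 p.2

/-- Right-continuous with left limits. -/
def IsCadlag (z : ℝ≥0 → ℝ) : Prop :=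
  ∀ s, ContinuousWithinAt z (Ici s) s ∧ ∃ y, Tendsto z (𝓝[<] s) (𝓝 y)

/-- The càdlàg process `Z` has the same law as the scaled BGWI process `Z₁(⌊n ·⌋) / b`. -/
structure IsScaledBGWI {Ω : Type*} [MeasurableSpace Ω] (μ ν : PMF ℕ) (n : ℕ) (b : ℝ)
    (Z : ℝ≥0 → Ω → ℝ) (P : Measure Ω) : Prop where
  measurable : ∀ s, Measurable (Z s)
  cadlag : ∀ ω, IsCadlag fun s => Z s ω
  law_eq : P.map (fun ω s => Z s ω) =
    (law μ ν).map fun (z : ℕ → ℕ) (s : ℝ≥0) => (z ⌊(n : ℝ≥0) * s⌋₊ : ℝ) / b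

/-- `d_t(z) = inf {s > t : z s = 0}`, with `inf ∅ = ∞`. -/
def hitZeroAfter (t : ℝ≥0) (z : ℝ≥0 → ℝ) : ℝ≥0∞ :=
  ⨅ (s : ℝ≥0) (_ : t < s ∧ z s = 0), (s : ℝ≥0∞)

/-- `L` is the (positive) Linnik law on `[0,∞)` with Laplace transform `(1 + θ λ^α)⁻¹`. -/
structure IsLinnikLaw (α θ : ℝ) (L : Measure ℝ) : Prop where
  isProbabilityMeasure : IsProbabilityMeasure L
  nonneg : ∀ᵐ x ∂L, 0 ≤ x
  laplace : ∀ r : ℝ, 0 ≤ r → ∫ x, Real.exp (-r * x) ∂L = (1 + θ * r ^ α)⁻¹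

/-- Weak convergence of measures on `ℝ`, tested on bounded continuous functions. -/
def ConvergesWeakly (ρ : ℕ → Measure ℝ) (L : Measure ℝ) : Prop :=
  ∀ φ : ℝ →ᵇ ℝ, Tendsto (fun n => ∫ x, φ x ∂(ρ n)) atTop (𝓝 (∫ x, φ x ∂L))

end BGWI

end

/-!
Write `f`, `g` for the generating functions of `μ`, `ν`, write `f_j` for the `j`-th iterate of `f`,
and let `T` be the first return time of `Z₁` to zero. The generating functions are studied in the
variable `q = 1 - s`: `rate μ q = β(q)` is `(f(1 - q) - (1 - q)) / q = c q ^ α ℓ(q)`, and `step μ` is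
the map `q ↦ 1 - f(1 - q)`, so that `step μ q = q (1 - β(q))`.

*Branching.* By the branching property, `v_m(q) = E[(1 - q) ^ Z₁(m); T > m]` (`killed`) satisfies
`v_{m+1}(q) = g(1 - q) v_m(step μ q) - P(T = m + 1)` (`killed_succ`). Without the last term this is
the recursion of the unrestricted generating functions `h_m = ∏_{j < m} g ∘ f_j` (`genProd`).
Summation by parts gives, with `F_m = P(T > m)`,
`v_m = F_m - ∑_{k < m} F_k (h_{m-1-k} - h_{m-k})` (`killed_eq`), which at `q = 1` is the renewal
identity `∑_{k ≤ m} F_k u_{m-k} = 1` for `u_j = P(Z₁(j) = 0) = h_j(s = 0)` (`renewal_identity`).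

*Iterates.* Since `q β(q)` is convex and regularly varying, its secant slopes show that `1 / β`
grows by `α + o(1)` at each application of `step μ` (`tendsto_inv_rate_step`). Hence, near zero,
`1 / β(f_j) ≈ 1 / β + α j`, and since `1 - g(1 - q) ~ (d / c) β(q)` the product `h_j` is
asymptotically `(1 + α j β(q)) ^ (-δ)` (`exists_log_genProd`). Likewise
`j (1 - u_{j+1} / u_j) → δ`, so that the Laplace transform of `u`, and then by the renewal identity
that of `F`, is regularly varying (`tendsto_one_sub_exp_mul_seqLaplace`,
`tendsto_seqLaplace_tail`).

*Tauberian step.* By the continuity theorem for Laplace transforms, the rescaled weights `F_k`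
converge to a gamma law; as `F` is nonincreasing, `∑_{k < m} F_k ψ(k / m) / (m F_m)` converges to
`∫ ψ(y) y ^ (δ - 1) dy` over `(0, 1)` (`tendsto_sum_div_mul`).

*Limit.* If `N β(q_N) → θ` and `A = α θ`, the formula for `v_N` yields
`v_N(q_N) / F_N → 1 - ∫ δ A (1 + A (1 - y)) ^ (-δ - 1) y ^ (δ - 1) dy = 1 / (1 + A)`
(`integral_linnik_kernel`, `tendsto_killed_ratio`), in which `δ` has disappeared. In the scaling of
the theorem `A = α c t λ ^ α`. Both conditioning events of the theorem agree, up to null sets, with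
`T > ⌊n t_n⌋`, because almost surely `Z_n` is a step function (`ae_eq_step`). Existence of the Linnik
law is obtained from tightness: it is a limit point of the conditional laws
(`exists_law_of_tendsto_laplace`); uniqueness and weak convergence come from the continuity theorem.
-/

/-! ### Laplace transforms of laws on the half-line -/

namespace BGWI

/-- The function `x ↦ exp (-r x)` on `ℝ≥0`, as a bounded continuous function. -/
noncomputable def expBCF (r : ℝ≥0) : ℝ≥0 →ᵇ ℝ :=
  BoundedContinuousFunction.mkOfBound ⟨fun x => Real.exp (-r * x), by fun_prop⟩ 1 (by
    intro x y
    simp only [ContinuousMap.coe_mk]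
    have h : ∀ z : ℝ≥0, Real.exp (-r * z) ∈ Icc (0 : ℝ) 1 := fun z =>
      ⟨(Real.exp_pos _).le, Real.exp_le_one_iff.2 (by
        have := mul_nonneg r.coe_nonneg z.coe_nonneg; linarith)⟩
    have hx := h x
    have hy := h y
    rw [Real.dist_eq, abs_le]
    exact ⟨by linarith [hx.1, hy.2], by linarith [hx.2, hy.1]⟩)

@[simp] theorem expBCF_apply (r x : ℝ≥0) : expBCF r x = Real.exp (-r * x) := rfl

theorem expBCF_mul (r s : ℝ≥0) : expBCF r * expBCF s = expBCF (r + s) := by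
  ext x
  simp only [BoundedContinuousFunction.coe_mul, Pi.mul_apply, expBCF_apply, ← Real.exp_add]
  push_cast; ring_nf

theorem expBCF_zero : expBCF 0 = 1 := by
  ext x; simp

/-- The linear combinations of the functions `x ↦ exp (-r x)`, `r ≥ 0`, as a subalgebra of the
bounded continuous functions on `ℝ≥0`. -/
noncomputable def expAlgebra : StarSubalgebra ℝ (ℝ≥0 →ᵇ ℝ) where
  carrier := Submodule.span ℝ (range expBCF)
  mul_mem' := by
    intro a b ha hb
    have hab := Submodule.mul_mem_mul ha hb
    rw [Submodule.span_mul_span] at hab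
    refine Submodule.span_mono ?_ hab
    rintro _ ⟨_, ⟨r, rfl⟩, _, ⟨s, rfl⟩, rfl⟩
    exact ⟨r + s, (expBCF_mul r s).symm⟩
  add_mem' := fun ha hb => Submodule.add_mem _ ha hb
  algebraMap_mem' := by
    intro c
    rw [Algebra.algebraMap_eq_smul_one, ← expBCF_zero]
    exact Submodule.smul_mem _ _ (Submodule.subset_span ⟨0, rfl⟩)
  star_mem' := by
    intro a ha
    have h : star a = a := by ext x; simp
    rwa [h]

theorem mem_expAlgebra {φ : ℝ≥0 →ᵇ ℝ} : φ ∈ expAlgebra ↔ φ ∈ Submodule.span ℝ (range expBCF) :=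
  Iff.rfl

theorem separatesPoints_expAlgebra :
    (expAlgebra.map (BoundedContinuousFunction.toContinuousMapStarₐ ℝ)).SeparatesPoints := by
  intro x y hxy
  refine ⟨_, ⟨_, ⟨expBCF 1, Submodule.subset_span ⟨1, rfl⟩, rfl⟩, rfl⟩, ?_⟩
  change expBCF 1 x ≠ expBCF 1 y
  simp only [expBCF_apply]
  intro h
  apply hxy
  have := Real.exp_injective h
  simp at this
  exact_mod_cast this

theorem tendsto_integral_expAlgebra {ρ : ℕ → ProbabilityMeasure ℝ≥0} {L : ProbabilityMeasure ℝ≥0}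
    (h : ∀ r : ℝ≥0, Tendsto (fun n => ∫ x, expBCF r x ∂(ρ n : Measure ℝ≥0)) atTop
      (𝓝 (∫ x, expBCF r x ∂(L : Measure ℝ≥0))))
    {φ : ℝ≥0 →ᵇ ℝ} (hφ : φ ∈ expAlgebra) :
    Tendsto (fun n => ∫ x, φ x ∂(ρ n : Measure ℝ≥0)) atTop
      (𝓝 (∫ x, φ x ∂(L : Measure ℝ≥0))) := by
  rw [mem_expAlgebra] at hφ
  induction hφ using Submodule.span_induction with
  | mem φ hφ => obtain ⟨r, rfl⟩ := hφ; exact h r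
  | zero => simp
  | add φ χ _ _ h1 h2 =>
    have e : ∀ P : ProbabilityMeasure ℝ≥0, ∫ x, (φ + χ) x ∂(P : Measure ℝ≥0) =
        ∫ x, φ x ∂(P : Measure ℝ≥0) + ∫ x, χ x ∂(P : Measure ℝ≥0) := fun P =>
      integral_add (φ.integrable _) (χ.integrable _)
    simp only [e]
    exact h1.add h2
  | smul c φ _ h1 =>
    have e : ∀ P : ProbabilityMeasure ℝ≥0, ∫ x, (c • φ) x ∂(P : Measure ℝ≥0) =
        c * ∫ x, φ x ∂(P : Measure ℝ≥0) := fun P => integral_const_mul c _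
    simp only [e]
    exact h1.const_mul c

/-- Markov's inequality for `1 - exp (-r X)`. -/
theorem measure_gt_le_laplace (ρ : Measure ℝ≥0) [IsProbabilityMeasure ρ] {R : ℝ≥0} (hR : 0 < R) :
    ρ {x | R < x} ≤ ENNReal.ofReal (2 * (1 - ∫ x, expBCF R⁻¹ x ∂ρ)) := by
  have hint : Integrable (fun x => 1 - expBCF R⁻¹ x) ρ :=
    (integrable_const _).sub ((expBCF R⁻¹).integrable _)
  have hnn : ∀ x, 0 ≤ 1 - expBCF R⁻¹ x := fun x => by
    rw [expBCF_apply, sub_nonneg, Real.exp_le_one_iff]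
    have := mul_nonneg (R⁻¹).coe_nonneg x.coe_nonneg
    linarith
  have h1 := mul_meas_ge_le_integral_of_nonneg (ae_of_all _ hnn) hint (1 / 2)
  have h2 : ∫ x, (1 - expBCF R⁻¹ x) ∂ρ = 1 - ∫ x, expBCF R⁻¹ x ∂ρ := by
    rw [integral_sub (integrable_const _) ((expBCF R⁻¹).integrable _)]; simp
  rw [h2] at h1
  have h3 : ρ {x | R < x} ≤ ρ {x | 1 / 2 ≤ 1 - expBCF R⁻¹ x} := by
    refine measure_mono fun x hx => ?_
    simp only [mem_ofPred_eq, expBCF_apply] at hx ⊢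
    have hx1 : (1 : ℝ) ≤ (R⁻¹ : ℝ≥0) * x := by
      have : 1 ≤ R⁻¹ * x := by
        rw [inv_mul_eq_div, one_le_div hR]; exact hx.le
      exact_mod_cast this
    have : Real.exp (-(R⁻¹ : ℝ≥0) * x) ≤ Real.exp (-1) := Real.exp_le_exp.2 (by linarith)
    have h4 : Real.exp (-1) < 1 / 2 := by
      have := Real.exp_neg_one_lt_d9
      linarith
    linarith
  rw [measureReal_def] at h1
  refine h3.trans ?_
  rw [← ENNReal.ofReal_toReal (measure_ne_top ρ {x | 1 / 2 ≤ 1 - expBCF R⁻¹ x})]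
  exact ENNReal.ofReal_le_ofReal (by linarith)

/-- Laplace transforms that converge to a function continuous at zero belong to a tight
sequence. -/
theorem isTight_of_tendsto_laplace {ρ : ℕ → ProbabilityMeasure ℝ≥0} {G : ℝ≥0 → ℝ}
    (h : ∀ r : ℝ≥0, Tendsto (fun n => ∫ x, expBCF r x ∂(ρ n : Measure ℝ≥0)) atTop (𝓝 (G r)))
    (hG : Tendsto G (𝓝[>] 0) (𝓝 1)) :
    IsTightMeasureSet {((ρ n : ProbabilityMeasure ℝ≥0) : Measure ℝ≥0) | n} := by
  have hs : {((ρ n : ProbabilityMeasure ℝ≥0) : Measure ℝ≥0) | n} =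
      range fun n => (ρ n : Measure ℝ≥0) := rfl
  rw [hs, isTightMeasureSet_iff_tendsto_measure_compl_closedBall (0 : ℝ≥0)]
  simp_rw [iSup_range]
  refine Nat.tendsto_iSup_of_tendsto_limsup (fun n => ?_) ?_ (fun n u w huw => by gcongr)
  · have h_tight : IsTightMeasureSet {(ρ n : Measure ℝ≥0)} := isTightMeasureSet_singleton
    rw [isTightMeasureSet_iff_tendsto_measure_compl_closedBall (0 : ℝ≥0)] at h_tight
    simpa using h_tight
  have h0 : Tendsto (fun R : ℝ => ENNReal.ofReal (2 * (1 - G (Real.toNNReal R)⁻¹))) atTop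
      (𝓝 0) := by
    have h1 : Tendsto (fun R : ℝ => (Real.toNNReal R)⁻¹) atTop (𝓝[>] 0) :=
      tendsto_inv_atTop_nhdsGT_zero.comp tendsto_real_toNNReal_atTop
    have h2 := ((tendsto_const_nhds (x := (1 : ℝ))).sub (hG.comp h1)).const_mul 2
    have h3 := ENNReal.tendsto_ofReal h2
    simpa using h3
  refine tendsto_of_tendsto_of_tendsto_of_le_of_le' tendsto_const_nhds h0
    (Eventually.of_forall fun _ => zero_le) ?_
  filter_upwards [eventually_gt_atTop 0] with R hR
  have hR' : 0 < Real.toNNReal R := Real.toNNReal_pos.2 hR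
  have hlim : Tendsto (fun n => ENNReal.ofReal
      (2 * (1 - ∫ x, expBCF (Real.toNNReal R)⁻¹ x ∂(ρ n : Measure ℝ≥0)))) atTop
      (𝓝 (ENNReal.ofReal (2 * (1 - G (Real.toNNReal R)⁻¹)))) :=
    ENNReal.tendsto_ofReal (((tendsto_const_nhds (x := (1 : ℝ))).sub (h _)).const_mul 2)
  rw [← hlim.limsup_eq]
  refine limsup_le_limsup (Eventually.of_forall fun n => ?_)
  refine le_trans (measure_mono ?_) (measure_gt_le_laplace (ρ n : Measure ℝ≥0) hR')
  intro x hx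
  simp only [mem_compl_iff, Metric.mem_closedBall, not_le, mem_ofPred_eq] at hx ⊢
  rw [NNReal.dist_eq] at hx
  simp only [NNReal.coe_zero, sub_zero, NNReal.abs_eq] at hx
  exact (Real.toNNReal_lt_iff_lt_coe hR.le).2 hx

theorem tendsto_of_tendsto_laplace {ρ : ℕ → ProbabilityMeasure ℝ≥0} {L : ProbabilityMeasure ℝ≥0}
    (h : ∀ r : ℝ≥0, Tendsto (fun n => ∫ x, expBCF r x ∂(ρ n : Measure ℝ≥0)) atTop
      (𝓝 (∫ x, expBCF r x ∂(L : Measure ℝ≥0)))) : Tendsto ρ atTop (𝓝 L) := by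
  refine ProbabilityMeasure.tendsto_of_tight_of_separatesPoints ℝ
    (isTight_of_tendsto_laplace h ?_) separatesPoints_expAlgebra
    fun φ hφ => tendsto_integral_expAlgebra h hφ
  have hc : Continuous fun r : ℝ≥0 => ∫ x, expBCF r x ∂(L : Measure ℝ≥0) := by
    refine continuous_of_dominated (bound := fun _ => 1)
      (fun r => (expBCF r).continuous.aestronglyMeasurable) (fun r => ae_of_all _ fun x => ?_)
      (integrable_const _) (ae_of_all _ fun x => ?_)
    · rw [expBCF_apply, Real.norm_eq_abs, Real.abs_exp, Real.exp_le_one_iff]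
      have := mul_nonneg r.coe_nonneg x.coe_nonneg
      linarith
    · simp only [expBCF_apply]; fun_prop
  have := hc.tendsto 0
  simp only [expBCF_zero] at this
  simp only [BoundedContinuousFunction.coe_one, Pi.one_apply, integral_const, probReal_univ,
    smul_eq_mul, mul_one] at this
  exact this.mono_left nhdsWithin_le_nhds

theorem exists_of_tendsto_laplace {ρ : ℕ → ProbabilityMeasure ℝ≥0} {G : ℝ≥0 → ℝ}
    (h : ∀ r : ℝ≥0, Tendsto (fun n => ∫ x, expBCF r x ∂(ρ n : Measure ℝ≥0)) atTop (𝓝 (G r)))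
    (hG : Tendsto G (𝓝[>] 0) (𝓝 1)) :
    ∃ L : ProbabilityMeasure ℝ≥0, ∀ r, ∫ x, expBCF r x ∂(L : Measure ℝ≥0) = G r := by
  have ht := isTight_of_tendsto_laplace h hG
  have hc : IsCompact (closure (range ρ)) := by
    refine isCompact_closure_of_isTightMeasureSet ?_
    convert ht using 1
    ext; simp
  obtain ⟨L, -, hL⟩ := hc.exists_mapClusterPt (f := atTop) (u := ρ)
    (Filter.le_principal_iff.2 (mem_map.2 (univ_mem' fun n => subset_closure (mem_range_self n))))
  refine ⟨L, fun r => ?_⟩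
  have hcont : ContinuousAt (fun P : ProbabilityMeasure ℝ≥0 =>
      ∫ x, expBCF r x ∂(P : Measure ℝ≥0)) L :=
    ((ProbabilityMeasure.tendsto_iff_forall_integral_tendsto.1 tendsto_id) (expBCF r))
  have h1 := hL.continuousAt_comp hcont
  have : (𝓝 (∫ x, expBCF r x ∂(L : Measure ℝ≥0)) ⊓ 𝓝 (G r)).NeBot :=
    NeBot.mono h1 (inf_le_inf_left _ (h r))
  exact eq_of_nhds_neBot this

/-- A law on the half-line `[0, ∞) ⊆ ℝ`, seen as a law on `ℝ≥0`. -/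
noncomputable def toNNRealLaw (ρ : Measure ℝ) [IsProbabilityMeasure ρ] : ProbabilityMeasure ℝ≥0 :=
  ⟨ρ.map Real.toNNReal, Measure.isProbabilityMeasure_map measurable_real_toNNReal.aemeasurable⟩

theorem integral_toNNRealLaw (ρ : Measure ℝ) [IsProbabilityMeasure ρ] (hρ : ∀ᵐ x ∂ρ, 0 ≤ x)
    {φ : ℝ → ℝ} (hφ : Continuous φ) :
    ∫ x : ℝ≥0, φ x ∂(toNNRealLaw ρ : Measure ℝ≥0) = ∫ x, φ x ∂ρ := by
  change ∫ x : ℝ≥0, φ x ∂(ρ.map Real.toNNReal) = ∫ x, φ x ∂ρ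
  rw [integral_map measurable_real_toNNReal.aemeasurable (f := fun x : ℝ≥0 => φ x)
    (hφ.comp NNReal.continuous_coe).aestronglyMeasurable]
  refine integral_congr_ae ?_
  filter_upwards [hρ] with x hx
  rw [Real.coe_toNNReal x hx]

theorem integral_expBCF_toNNRealLaw (ρ : Measure ℝ) [IsProbabilityMeasure ρ]
    (hρ : ∀ᵐ x ∂ρ, 0 ≤ x) (r : ℝ≥0) :
    ∫ x, expBCF r x ∂(toNNRealLaw ρ : Measure ℝ≥0) = ∫ x, Real.exp (-r * x) ∂ρ :=
  integral_toNNRealLaw ρ hρ (φ := fun x => Real.exp (-r * x)) (by fun_prop)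

/-- The continuity theorem for Laplace transforms of laws on `[0, ∞)`. -/
theorem tendsto_integral_of_tendsto_laplace {ρ : ℕ → Measure ℝ} [∀ n, IsProbabilityMeasure (ρ n)]
    {L : Measure ℝ} [IsProbabilityMeasure L] (hρ : ∀ n, ∀ᵐ x ∂ρ n, 0 ≤ x) (hL : ∀ᵐ x ∂L, 0 ≤ x)
    (h : ∀ r : ℝ, 0 ≤ r → Tendsto (fun n => ∫ x, Real.exp (-r * x) ∂ρ n) atTop
      (𝓝 (∫ x, Real.exp (-r * x) ∂L))) (φ : ℝ →ᵇ ℝ) :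
    Tendsto (fun n => ∫ x, φ x ∂ρ n) atTop (𝓝 (∫ x, φ x ∂L)) := by
  have h1 : Tendsto (fun n => toNNRealLaw (ρ n)) atTop (𝓝 (toNNRealLaw L)) := by
    refine tendsto_of_tendsto_laplace fun r => ?_
    simp only [integral_expBCF_toNNRealLaw _ hL, integral_expBCF_toNNRealLaw _ (hρ _)]
    exact h r r.coe_nonneg
  have h2 := ProbabilityMeasure.tendsto_iff_forall_integral_tendsto.1 h1
    (φ.compContinuous ⟨fun x : ℝ≥0 => (x : ℝ), NNReal.continuous_coe⟩)
  simp only [BoundedContinuousFunction.compContinuous_apply, ContinuousMap.coe_mk] at h2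
  simpa only [integral_toNNRealLaw _ hL φ.continuous,
    integral_toNNRealLaw _ (hρ _) φ.continuous] using h2

theorem eq_of_laplace_eq {L L' : Measure ℝ} [IsProbabilityMeasure L] [IsProbabilityMeasure L']
    (hL : ∀ᵐ x ∂L, 0 ≤ x) (hL' : ∀ᵐ x ∂L', 0 ≤ x)
    (h : ∀ r : ℝ, 0 ≤ r → ∫ x, Real.exp (-r * x) ∂L = ∫ x, Real.exp (-r * x) ∂L') : L = L' := by
  refine ext_of_forall_integral_eq_of_IsFiniteMeasure fun φ => ?_
  refine tendsto_nhds_unique (tendsto_const_nhds (f := (atTop : Filter ℕ))) ?_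
  refine tendsto_integral_of_tendsto_laplace (ρ := fun _ => L) (fun _ => hL) hL' (fun r hr => ?_) φ
  rw [h r hr]
  exact tendsto_const_nhds

theorem exists_law_of_tendsto_laplace {ρ : ℕ → Measure ℝ} [∀ n, IsProbabilityMeasure (ρ n)]
    (hρ : ∀ n, ∀ᵐ x ∂ρ n, 0 ≤ x) {G : ℝ → ℝ}
    (h : ∀ r : ℝ, 0 ≤ r → Tendsto (fun n => ∫ x, Real.exp (-r * x) ∂ρ n) atTop (𝓝 (G r)))
    (hG : Tendsto G (𝓝[>] 0) (𝓝 1)) :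
    ∃ L : Measure ℝ, IsProbabilityMeasure L ∧ (∀ᵐ x ∂L, 0 ≤ x) ∧
      ∀ r : ℝ, 0 ≤ r → ∫ x, Real.exp (-r * x) ∂L = G r := by
  obtain ⟨L, hL⟩ := exists_of_tendsto_laplace (ρ := fun n => toNNRealLaw (ρ n))
    (G := fun r : ℝ≥0 => G r) (fun r => by
      simp only [integral_expBCF_toNNRealLaw _ (hρ _)]; exact h r r.coe_nonneg)
    (hG.comp (tendsto_nhdsWithin_iff.2 ⟨(NNReal.continuous_coe.tendsto 0).mono_left
      nhdsWithin_le_nhds, eventually_nhdsWithin_of_forall fun r hr => NNReal.coe_pos.2 hr⟩))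
  have hm : Measurable ((↑) : ℝ≥0 → ℝ) := measurable_coe_nnreal_real
  refine ⟨(L : Measure ℝ≥0).map (↑), Measure.isProbabilityMeasure_map hm.aemeasurable, ?_, ?_⟩
  · rw [ae_map_iff hm.aemeasurable measurableSet_Ici]
    exact ae_of_all _ fun x => x.coe_nonneg
  · intro r hr
    rw [integral_map hm.aemeasurable (by fun_prop)]
    exact hL ⟨r, hr⟩

end BGWI

/-! ### A Tauberian theorem for monotone sequences -/

namespace BGWI

/-- Weak convergence implies convergence of integrals over `(-∞, a)` when the limit law has no
atom at `a`. -/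
theorem tendsto_setIntegral_Iio {ρ : ℕ → ProbabilityMeasure ℝ} {L : ProbabilityMeasure ℝ}
    (h : Tendsto ρ atTop (𝓝 L)) (φ : ℝ →ᵇ ℝ) (a : ℝ) (ha : (L : Measure ℝ) {a} = 0) :
    Tendsto (fun n => ∫ x in Iio a, φ x ∂(ρ n : Measure ℝ)) atTop
      (𝓝 (∫ x in Iio a, φ x ∂(L : Measure ℝ))) := by
  -- continuous cutoff functions, equal to `1` on `(-∞, a - η]` and to `0` on `[a, ∞)`
  let χ : ℝ → (ℝ →ᵇ ℝ) := fun η => BoundedContinuousFunction.mkOfBound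
    ⟨fun x => max 0 (min 1 ((a - x) / η)), by fun_prop⟩ 1 (by
      intro x y
      simp only [ContinuousMap.coe_mk]
      rw [Real.dist_eq, abs_le]
      have h1 := fun z => le_max_left (0 : ℝ) (min 1 ((a - z) / η))
      have h2 := fun z => max_le zero_le_one (min_le_left (1 : ℝ) ((a - z) / η))
      constructor <;> linarith [h1 x, h1 y, h2 x, h2 y])
  have hχ : ∀ η x, χ η x = max 0 (min 1 ((a - x) / η)) := fun _ _ => rfl
  have key : ∀ (P : ProbabilityMeasure ℝ) (η : ℝ), 0 < η →
      |∫ x in Iio a, φ x ∂(P : Measure ℝ) - ∫ x, (φ * χ η) x ∂(P : Measure ℝ)| ≤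
        ‖φ‖ * (P : Measure ℝ).real (Icc (a - η) a) := by
    intro P η hη
    rw [← integral_indicator measurableSet_Iio,
      ← integral_sub ((φ.integrable _).indicator measurableSet_Iio) ((φ * χ η).integrable _)]
    have hI : Integrable ((Icc (a - η) a).indicator fun _ => ‖φ‖) (P : Measure ℝ) :=
      (integrable_const _).indicator measurableSet_Icc
    have hval : ∫ x, (Icc (a - η) a).indicator (fun _ => ‖φ‖) x ∂(P : Measure ℝ) =
        ‖φ‖ * (P : Measure ℝ).real (Icc (a - η) a) := by
      rw [integral_indicator_const _ measurableSet_Icc, smul_eq_mul, mul_comm]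
    rw [← hval, ← Real.norm_eq_abs]
    refine norm_integral_le_of_norm_le hI (ae_of_all _ fun x => ?_)
    have hφx := φ.norm_coe_le_norm x
    simp only [BoundedContinuousFunction.coe_mul, Pi.mul_apply, hχ]
    rcases lt_or_ge x (a - η) with hx | hx
    · have h1 : 1 ≤ (a - x) / η := by rw [le_div_iff₀ hη]; linarith
      rw [indicator_of_mem (by simp only [mem_Iio]; linarith), min_eq_left h1,
        max_eq_right zero_le_one, mul_one, sub_self, norm_zero]
      exact indicator_nonneg (fun _ _ => norm_nonneg _) _
    · rcases lt_or_ge a x with hx' | hx'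
      · have h1 : (a - x) / η ≤ 0 := div_nonpos_of_nonpos_of_nonneg (by linarith) hη.le
        rw [indicator_of_notMem (by simp only [mem_Iio]; linarith),
          max_eq_left ((min_le_right _ _).trans h1), mul_zero, sub_self, norm_zero]
        exact indicator_nonneg (fun _ _ => norm_nonneg _) _
      · rw [indicator_of_mem (s := Icc (a - η) a) ⟨hx, hx'⟩]
        have h1 : (Iio a).indicator (fun x => φ x) x = φ x * (Iio a).indicator 1 x := by
          by_cases hxa : x ∈ Iio a <;> simp [hxa]
        rw [h1, ← mul_sub, norm_mul]
        have h2 : ‖(Iio a).indicator (1 : ℝ → ℝ) x - max 0 (min 1 ((a - x) / η))‖ ≤ 1 := by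
          have h3 := le_max_left (0 : ℝ) (min 1 ((a - x) / η))
          have h4 := max_le zero_le_one (min_le_left (1 : ℝ) ((a - x) / η))
          rw [Real.norm_eq_abs, abs_le]
          by_cases hxa : x ∈ Iio a
          · simp only [hxa, indicator_of_mem, Pi.one_apply]; constructor <;> linarith
          · simp only [hxa, not_false_eq_true, indicator_of_notMem]; constructor <;> linarith
        calc ‖φ x‖ * _ ≤ ‖φ‖ * 1 := mul_le_mul hφx h2 (norm_nonneg _) (norm_nonneg _)
          _ = ‖φ‖ := mul_one _
  rw [Metric.tendsto_atTop]
  intro ε hε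
  set C := ‖φ‖ + 1
  have hC : 0 < C := by positivity
  obtain ⟨η, hη, hLη⟩ : ∃ η : ℝ, 0 < η ∧ (L : Measure ℝ) (Icc (a - η) a) <
      ENNReal.ofReal (ε / (3 * C)) := by
    have h1 : Tendsto (fun η : ℝ => (L : Measure ℝ) (Icc (a - η) a)) (𝓝[>] 0)
        (𝓝 ((L : Measure ℝ) (⋂ η > (0 : ℝ), Icc (a - η) a))) := by
      refine tendsto_measure_biInter_gt (fun η _ => measurableSet_Icc.nullMeasurableSet)
        (fun i j _ hij => Icc_subset_Icc_left (by linarith)) ⟨1, one_pos, measure_ne_top _ _⟩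
    have h2 : (⋂ η > (0 : ℝ), Icc (a - η) a) = {a} := by
      ext x
      simp only [mem_iInter, mem_Icc, mem_singleton_iff]
      constructor
      · intro hx
        refine le_antisymm (hx 1 one_pos).2 (le_of_forall_pos_sub_le fun η hη => (hx η hη).1)
      · rintro rfl η hη
        exact ⟨by linarith [hη.lt], le_rfl⟩
    rw [h2, ha] at h1
    have h3 := h1.eventually_lt_const (ENNReal.ofReal_pos.2 (by positivity : 0 < ε / (3 * C)))
    obtain ⟨η, hη1, hη2⟩ := (h3.and self_mem_nhdsWithin).exists
    exact ⟨η, hη2, hη1⟩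
  have hev : ∀ᶠ n in atTop, (ρ n : Measure ℝ) (Icc (a - η) a) < ENNReal.ofReal (ε / (3 * C)) :=
    eventually_lt_of_limsup_lt
      ((ProbabilityMeasure.limsup_measure_closed_le_of_tendsto h isClosed_Icc).trans_lt hLη)
  have hconv := ProbabilityMeasure.tendsto_iff_forall_integral_tendsto.1 h (φ * χ η)
  rw [Metric.tendsto_atTop] at hconv
  obtain ⟨N1, hN1⟩ := hconv (ε / 3) (by positivity)
  obtain ⟨N2, hN2⟩ := eventually_atTop.1 hev
  have small : ∀ P : ProbabilityMeasure ℝ,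
      (P : Measure ℝ) (Icc (a - η) a) < ENNReal.ofReal (ε / (3 * C)) →
      |∫ x in Iio a, φ x ∂(P : Measure ℝ) - ∫ x, (φ * χ η) x ∂(P : Measure ℝ)| < ε / 3 := by
    intro P hP
    have h1 : (P : Measure ℝ).real (Icc (a - η) a) < ε / (3 * C) :=
      ENNReal.toReal_lt_of_lt_ofReal hP
    have h2 : ‖φ‖ * (P : Measure ℝ).real (Icc (a - η) a) ≤
        C * (P : Measure ℝ).real (Icc (a - η) a) :=
      mul_le_mul_of_nonneg_right (by simp [C]) measureReal_nonneg
    have h3 : C * (P : Measure ℝ).real (Icc (a - η) a) < C * (ε / (3 * C)) :=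
      mul_lt_mul_of_pos_left h1 hC
    have h4 : C * (ε / (3 * C)) = ε / 3 := by field_simp
    linarith [key P η hη]
  refine ⟨max N1 N2, fun n hn => ?_⟩
  have e1 := small (ρ n) (hN2 n ((le_max_right _ _).trans hn))
  have e2 := small L hLη
  have e3 := hN1 n ((le_max_left _ _).trans hn)
  rw [Real.dist_eq] at e3 ⊢
  rw [abs_lt] at e1 e2 e3 ⊢
  constructor <;> linarith [e1.1, e1.2, e2.1, e2.2, e3.1, e3.2]

/-- The Laplace transform `∑ F k e^{-yk}` of a sequence. -/
noncomputable def seqLaplace (F : ℕ → ℝ) (y : ℝ) : ℝ := ∑' k : ℕ, F k * Real.exp (-(y * k))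

theorem summable_seqLaplace {F : ℕ → ℝ} {C : ℝ} (hF : ∀ k, |F k| ≤ C) {y : ℝ} (hy : 0 < y) :
    Summable fun k : ℕ => F k * Real.exp (-(y * k)) := by
  have h1 : Summable fun k : ℕ => C * Real.exp (-y) ^ k :=
    (summable_geometric_of_lt_one (Real.exp_pos _).le (Real.exp_lt_one_iff.2 (by linarith))).mul_left C
  refine Summable.of_norm_bounded h1 fun k => ?_
  rw [norm_mul, Real.norm_eq_abs, Real.norm_eq_abs, Real.abs_exp, ← Real.exp_nat_mul]
  have : (k : ℝ) * -y = -(y * k) := by ring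
  rw [this]
  exact mul_le_mul_of_nonneg_right (hF k) (Real.exp_pos _).le

theorem seqLaplace_pos {F : ℕ → ℝ} {C : ℝ} (hF : ∀ k, |F k| ≤ C) (h0 : ∀ k, 0 ≤ F k)
    (hpos : 0 < F 0) {y : ℝ} (hy : 0 < y) : 0 < seqLaplace F y :=
  (summable_seqLaplace hF hy).tsum_pos (fun k => mul_nonneg (h0 k) (Real.exp_pos _).le) 0
    (mul_pos hpos (Real.exp_pos _))

/-- The exponentially tilted law with mass proportional to `F k e^{-yk}` at the point `y k`. -/
noncomputable def tiltedLaw (F : ℕ → ℝ) (y : ℝ) : Measure ℝ :=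
  Measure.sum fun k : ℕ =>
    ENNReal.ofReal (F k * Real.exp (-(y * k)) / seqLaplace F y) • Measure.dirac (y * k)

theorem isProbabilityMeasure_tiltedLaw {F : ℕ → ℝ} {C : ℝ} (hF : ∀ k, |F k| ≤ C)
    (h0 : ∀ k, 0 ≤ F k) (hpos : 0 < F 0) {y : ℝ} (hy : 0 < y) :
    IsProbabilityMeasure (tiltedLaw F y) := by
  constructor
  have hL := seqLaplace_pos hF h0 hpos hy
  rw [tiltedLaw, Measure.sum_apply _ MeasurableSet.univ]
  simp only [Measure.smul_apply, measure_univ, smul_eq_mul, mul_one]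
  rw [← ENNReal.ofReal_tsum_of_nonneg (fun k => div_nonneg
    (mul_nonneg (h0 k) (Real.exp_pos _).le) hL.le) ((summable_seqLaplace hF hy).div_const _),
    tsum_div_const]
  change ENNReal.ofReal (seqLaplace F y / seqLaplace F y) = 1
  rw [div_self hL.ne', ENNReal.ofReal_one]

theorem integral_tiltedLaw {F : ℕ → ℝ} {C : ℝ} (hF : ∀ k, |F k| ≤ C)
    (h0 : ∀ k, 0 ≤ F k) (hpos : 0 < F 0) {y : ℝ} (hy : 0 < y) {φ : ℝ → ℝ}
    (hφ : Integrable φ (tiltedLaw F y)) :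
    ∫ x, φ x ∂(tiltedLaw F y) =
      (∑' k : ℕ, F k * Real.exp (-(y * k)) * φ (y * k)) / seqLaplace F y := by
  have hL := seqLaplace_pos hF h0 hpos hy
  rw [tiltedLaw] at hφ ⊢
  rw [integral_sum_measure hφ, ← tsum_div_const]
  refine tsum_congr fun k => ?_
  rw [integral_smul_measure, integral_dirac, ENNReal.toReal_ofReal (div_nonneg
    (mul_nonneg (h0 k) (Real.exp_pos _).le) hL.le), smul_eq_mul]
  ring

theorem ae_nonneg_tiltedLaw (F : ℕ → ℝ) {y : ℝ} (hy : 0 < y) :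
    ∀ᵐ x ∂(tiltedLaw F y), 0 ≤ x := by
  rw [tiltedLaw, Measure.ae_sum_iff]
  intro k
  refine Measure.ae_smul_measure ?_ _
  rw [ae_dirac_iff measurableSet_Ici]
  positivity

theorem integral_gammaMeasure {δ : ℝ} (hδ : 0 < δ) (φ : ℝ → ℝ) :
    ∫ x, φ x ∂(gammaMeasure δ 1) =
      ∫ x in Ioi (0 : ℝ), φ x * (x ^ (δ - 1) * Real.exp (-x) / Real.Gamma δ) := by
  have h1 : gammaMeasure δ 1 = volume.withDensity fun x => ENNReal.ofReal (gammaPDFReal δ 1 x) :=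
    rfl
  rw [h1, integral_withDensity_eq_integral_toReal_smul (by fun_prop)
    (ae_of_all _ fun x => ENNReal.ofReal_lt_top), ← integral_Ici_eq_integral_Ioi,
    ← integral_indicator measurableSet_Ici]
  refine integral_congr_ae (ae_of_all _ fun x => ?_)
  beta_reduce
  rw [ENNReal.toReal_ofReal (gammaPDFReal_nonneg hδ one_pos x), smul_eq_mul, gammaPDFReal]
  by_cases hx : 0 ≤ x
  · rw [if_pos hx, indicator_of_mem (mem_Ici.2 hx), Real.one_rpow, one_mul]
    ring
  · rw [if_neg hx, indicator_of_notMem (by simpa using hx), zero_mul]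

theorem laplace_gammaMeasure {δ : ℝ} (hδ : 0 < δ) {r : ℝ} (hr : 0 ≤ r) :
    ∫ x, Real.exp (-r * x) ∂(gammaMeasure δ 1) = (1 + r) ^ (-δ) := by
  rw [integral_gammaMeasure hδ]
  have h := Real.integral_rpow_mul_exp_neg_mul_Ioi hδ (r := 1 + r) (by linarith)
  have hΓ := (Real.Gamma_pos_of_pos hδ).ne'
  have h2 : ∀ x : ℝ, Real.exp (-r * x) * (x ^ (δ - 1) * Real.exp (-x) / Real.Gamma δ) =
      (Real.Gamma δ)⁻¹ * (x ^ (δ - 1) * Real.exp (-((1 + r) * x))) := by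
    intro x
    have : Real.exp (-((1 + r) * x)) = Real.exp (-r * x) * Real.exp (-x) := by
      rw [← Real.exp_add]; ring_nf
    rw [this]; ring
  simp only [h2]
  rw [integral_const_mul, h, Real.rpow_neg (by linarith), one_div, Real.inv_rpow (by linarith)]
  field_simp

theorem ae_nonneg_gammaMeasure (δ r : ℝ) : ∀ᵐ x ∂(gammaMeasure δ r), 0 ≤ x := by
  rw [gammaMeasure, ae_withDensity_iff (by unfold gammaPDF; fun_prop)]
  refine ae_of_all _ fun x hx => ?_
  by_contra h
  exact hx (gammaPDF_of_neg (not_le.1 h))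

section Tauberian

variable {F : ℕ → ℝ} {δ : ℝ}

/-- Regular variation of the Laplace transform of `F` is the convergence of the Laplace transforms
of the tilted laws to that of the gamma law. -/
theorem tendsto_tiltedLaw (hanti : Antitone F) (h0 : ∀ k, 0 ≤ F k) (hpos : 0 < F 0) (hδ : 0 < δ)
    (hΦ : ∀ r : ℝ, 0 ≤ r → Tendsto (fun m : ℕ => seqLaplace F ((1 + r) * (1 / (m + 1 : ℕ))) /
      seqLaplace F (1 / (m + 1 : ℕ))) atTop (𝓝 ((1 + r) ^ (-δ)))) (φ : ℝ →ᵇ ℝ)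
    (a : ℝ) :
    Tendsto (fun m : ℕ => ∫ x in Iio a, φ x ∂(tiltedLaw F (1 / (m + 1 : ℕ)))) atTop
      (𝓝 (∫ x in Iio a, φ x ∂(gammaMeasure δ 1))) := by
  have hF : ∀ k, |F k| ≤ F 0 := fun k => by
    rw [abs_of_nonneg (h0 k)]; exact hanti (Nat.zero_le k)
  have hy : ∀ m : ℕ, (0 : ℝ) < 1 / (m + 1 : ℕ) := fun m => by positivity
  have hP : ∀ m : ℕ, IsProbabilityMeasure (tiltedLaw F (1 / (m + 1 : ℕ))) := fun m =>
    isProbabilityMeasure_tiltedLaw hF h0 hpos (hy m)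
  have hG := isProbabilityMeasure_gammaMeasure hδ one_pos
  have hw := tendsto_integral_of_tendsto_laplace (ρ := fun m : ℕ => tiltedLaw F (1 / (m + 1 : ℕ)))
    (L := gammaMeasure δ 1) (fun m => ae_nonneg_tiltedLaw F (hy m)) (ae_nonneg_gammaMeasure δ 1)
    (fun r hr => by
      rw [laplace_gammaMeasure hδ hr]
      refine (hΦ r hr).congr fun m => ?_
      rw [integral_tiltedLaw hF h0 hpos (hy m)]
      · rw [seqLaplace]
        congr 1
        refine tsum_congr fun k => ?_
        rw [mul_assoc (F k), ← Real.exp_add]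
        ring_nf
      · refine Integrable.of_bound (by fun_prop) 1 ?_
        filter_upwards [ae_nonneg_tiltedLaw F (hy m)] with x hx
        rw [Real.norm_eq_abs, Real.abs_exp, Real.exp_le_one_iff]
        have := mul_nonneg hr hx
        linarith)
  refine tendsto_setIntegral_Iio (ρ := fun m => ⟨_, hP m⟩) (L := ⟨_, hG⟩)
    (ProbabilityMeasure.tendsto_iff_forall_integral_tendsto.2 hw) φ a ?_
  change volume.withDensity _ {a} = 0
  exact withDensity_absolutelyContinuous _ _ (by simp)

/-- Karamata's Tauberian theorem, with a continuous weight: if the Laplace transform of a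
nonincreasing sequence `F` is regularly varying of index `-δ` at zero, then the measures with mass
`F k` at `k / m`, suitably normalized, converge to `x ^ (δ - 1) dx / Γ(δ)`. -/
theorem tendsto_sum_div_seqLaplace (hanti : Antitone F) (h0 : ∀ k, 0 ≤ F k) (hpos : 0 < F 0)
    (hδ : 0 < δ)
    (hΦ : ∀ r : ℝ, 0 ≤ r → Tendsto (fun m : ℕ => seqLaplace F ((1 + r) * (1 / (m + 1 : ℕ))) /
      seqLaplace F (1 / (m + 1 : ℕ))) atTop (𝓝 ((1 + r) ^ (-δ)))) {ψ : ℝ → ℝ}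
    (hψ : Continuous ψ) {a : ℝ} (ha : 0 < a) :
    Tendsto (fun m : ℕ => (∑ k ∈ Finset.range ⌈a * m⌉₊, F k * ψ (k / m)) / seqLaplace F (1 / m))
      atTop (𝓝 (∫ x in (0 : ℝ)..a, ψ x * x ^ (δ - 1) / Real.Gamma δ)) := by
  have hF : ∀ k, |F k| ≤ F 0 := fun k => by
    rw [abs_of_nonneg (h0 k)]; exact hanti (Nat.zero_le k)
  have hy : ∀ m : ℕ, (0 : ℝ) < 1 / (m + 1 : ℕ) := fun m => by positivity
  -- the weight `ψ x * exp x`, made bounded away from the relevant interval `[0, a]`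
  obtain ⟨C, hC⟩ := isCompact_Icc.exists_bound_of_continuousOn (s := Icc 0 a)
    (f := fun x => ψ x * Real.exp x) (by fun_prop)
  let φ : ℝ →ᵇ ℝ := BoundedContinuousFunction.ofNormedAddCommGroup
    (fun x => ψ (max 0 (min a x)) * Real.exp (max 0 (min a x))) (by fun_prop) C
    (fun x => hC _ ⟨le_max_left _ _, max_le ha.le (min_le_left _ _)⟩)
  have hφ : ∀ x, 0 ≤ x → x < a → φ x = ψ x * Real.exp x := fun x hx hxa => by
    change ψ (max 0 (min a x)) * Real.exp (max 0 (min a x)) = _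
    rw [min_eq_right hxa.le, max_eq_right hx]
  have hlim := tendsto_tiltedLaw hanti h0 hpos hδ hΦ φ a
  have hR : ∫ x in Iio a, φ x ∂(gammaMeasure δ 1) =
      ∫ x in (0 : ℝ)..a, ψ x * x ^ (δ - 1) / Real.Gamma δ := by
    rw [← integral_indicator measurableSet_Iio, integral_gammaMeasure hδ,
      intervalIntegral.integral_of_le ha.le, integral_Ioc_eq_integral_Ioo,
      ← integral_indicator measurableSet_Ioi, ← integral_indicator measurableSet_Ioo]
    refine integral_congr_ae (ae_of_all _ fun x => ?_)
    simp only [indicator_apply, mem_Ioi, mem_Iio, mem_Ioo]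
    by_cases hx0 : 0 < x
    · by_cases hxa : x < a
      · rw [if_pos hx0, if_pos hxa, if_pos ⟨hx0, hxa⟩, hφ x hx0.le hxa, Real.exp_neg]
        have := (Real.exp_pos x).ne'
        field_simp
      · rw [if_pos hx0, if_neg hxa, if_neg (fun h => hxa h.2), zero_mul]
    · rw [if_neg hx0, if_neg (fun h => hx0 h.1)]
  rw [hR] at hlim
  rw [← tendsto_add_atTop_iff_nat 1]
  refine hlim.congr fun m => ?_
  have hP := isProbabilityMeasure_tiltedLaw hF h0 hpos (hy m)
  rw [← integral_indicator measurableSet_Iio, integral_tiltedLaw hF h0 hpos (hy m)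
    ((φ.integrable _).indicator measurableSet_Iio)]
  congr 1
  have hm : (0 : ℝ) < ((m + 1 : ℕ) : ℝ) := by positivity
  have hmem : ∀ k : ℕ, 1 / ((m + 1 : ℕ) : ℝ) * k ∈ Iio a ↔
      k ∈ Finset.range ⌈a * ((m + 1 : ℕ) : ℝ)⌉₊ := fun k => by
    rw [mem_Iio, Finset.mem_range, Nat.lt_ceil, one_div_mul_eq_div, div_lt_iff₀ hm]
  rw [tsum_eq_sum (s := Finset.range ⌈a * ((m + 1 : ℕ) : ℝ)⌉₊) (fun k hk => by
    rw [indicator_of_notMem (fun h => hk ((hmem k).1 h)), mul_zero])]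
  refine Finset.sum_congr rfl fun k hk => ?_
  have hk' := (hmem k).2 hk
  rw [indicator_of_mem hk', hφ _ (by positivity) hk', Real.exp_neg, one_div_mul_eq_div]
  have := (Real.exp_pos ((k : ℝ) / ((m + 1 : ℕ) : ℝ))).ne'
  field_simp

/-- The monotone density part of the Tauberian theorem: by monotonicity `ε m F m` is squeezed
between the sums of `F` over `[(1 - ε) m, m)` and over `[m, (1 + ε) m)`, whose limits are known. -/
theorem tendsto_mul_div_seqLaplace (hanti : Antitone F) (h0 : ∀ k, 0 ≤ F k) (hpos : 0 < F 0)
    (hδ : 0 < δ)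
    (hΦ : ∀ r : ℝ, 0 ≤ r → Tendsto (fun m : ℕ => seqLaplace F ((1 + r) * (1 / (m + 1 : ℕ))) /
      seqLaplace F (1 / (m + 1 : ℕ))) atTop (𝓝 ((1 + r) ^ (-δ)))) :
    Tendsto (fun m : ℕ => m * F m / seqLaplace F (1 / m)) atTop (𝓝 (1 / Real.Gamma δ)) := by
  have hF : ∀ k, |F k| ≤ F 0 := fun k => by
    rw [abs_of_nonneg (h0 k)]; exact hanti (Nat.zero_le k)
  set S : ℝ → ℕ → ℝ := fun a m =>
    (∑ k ∈ Finset.range ⌈a * m⌉₊, F k) / seqLaplace F (1 / m) with hS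
  have hSlim : ∀ a, 0 < a → Tendsto (S a) atTop (𝓝 (a ^ δ / (δ * Real.Gamma δ))) := by
    intro a ha
    have h1 := tendsto_sum_div_seqLaplace hanti h0 hpos hδ hΦ (continuous_const (y := (1 : ℝ))) ha
    have h2 : ∫ x in (0 : ℝ)..a, 1 * x ^ (δ - 1) / Real.Gamma δ = a ^ δ / (δ * Real.Gamma δ) := by
      simp only [one_mul]
      rw [intervalIntegral.integral_div, integral_rpow (Or.inl (by linarith)), sub_add_cancel,
        Real.zero_rpow hδ.ne', sub_zero, div_div]
    rw [h2] at h1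
    simpa only [mul_one] using h1
  -- the summand `1 / m` in the denominator absorbs the rounding of `(1 + ε) m`
  have hquot : ∀ ε : ℝ, ε ≠ 0 → -1 < ε → Tendsto (fun m : ℕ => (S (1 + ε) m - S 1 m) / (ε + 1 / m))
      atTop (𝓝 (((1 + ε) ^ δ - 1) / ε / (δ * Real.Gamma δ))) := by
    intro ε hε hε1
    have h1 := (hSlim (1 + ε) (by linarith)).sub (hSlim 1 one_pos)
    have h2 : Tendsto (fun m : ℕ => ε + 1 / (m : ℝ)) atTop (𝓝 ε) := by
      simpa using tendsto_const_nhds.add (tendsto_one_div_atTop_nhds_zero_nat (𝕜 := ℝ))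
    have h3 : ((1 + ε) ^ δ - 1) / ε / (δ * Real.Gamma δ) =
        ((1 + ε) ^ δ / (δ * Real.Gamma δ) - 1 ^ δ / (δ * Real.Gamma δ)) / ε := by
      rw [Real.one_rpow]
      ring
    rw [h3]
    exact h1.div h2 hε
  have hder : Tendsto (fun ε : ℝ => ((1 + ε) ^ δ - 1) / ε / (δ * Real.Gamma δ)) (𝓝[≠] 0)
      (𝓝 (1 / Real.Gamma δ)) := by
    have h1 := (Real.hasDerivAt_rpow_const (x := 1) (p := δ) (Or.inl one_ne_zero)).tendsto_slope_zero
    simp only [Real.one_rpow, mul_one, smul_eq_mul] at h1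
    have h2 := h1.div_const (δ * Real.Gamma δ)
    have h3 : δ / (δ * Real.Gamma δ) = 1 / Real.Gamma δ := by
      rw [← div_div, div_self hδ.ne']
    rw [h3] at h2
    refine h2.congr fun ε => ?_
    rw [inv_mul_eq_div]
  rw [tendsto_order]
  constructor
  · intro b hb
    have hev := (hder.mono_left (nhdsWithin_mono (s := Ioi 0) 0 fun x hx => (mem_Ioi.1 hx).ne')).eventually
      (lt_mem_nhds hb)
    obtain ⟨ε, hε, hε0⟩ := (hev.and (self_mem_nhdsWithin (s := Ioi (0 : ℝ)))).exists
    filter_upwards [(hquot ε hε0.ne' (by linarith)).eventually (lt_mem_nhds hε),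
      eventually_gt_atTop 0] with m hm hm0
    have hm0' : (0 : ℝ) < m := by exact_mod_cast hm0
    refine hm.trans_le ?_
    have hL := seqLaplace_pos hF h0 hpos (y := 1 / (m : ℝ)) (by positivity)
    rw [div_le_iff₀ (by positivity), hS]
    simp only [one_mul, Nat.ceil_natCast]
    rw [← sub_div, div_mul_eq_mul_div, div_le_div_iff_of_pos_right hL]
    have hle : m ≤ ⌈(1 + ε) * m⌉₊ := by
      have : (m : ℝ) ≤ ⌈(1 + ε) * m⌉₊ := le_trans (by nlinarith) (Nat.le_ceil _)
      exact_mod_cast this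
    rw [← Finset.sum_Ico_eq_sub _ hle]
    have h1 : ∑ k ∈ Finset.Ico m ⌈(1 + ε) * m⌉₊, F k ≤ ∑ k ∈ Finset.Ico m ⌈(1 + ε) * m⌉₊, F m :=
      Finset.sum_le_sum fun k hk => hanti (Finset.mem_Ico.1 hk).1
    refine h1.trans ?_
    rw [Finset.sum_const, Nat.card_Ico, nsmul_eq_mul, Nat.cast_sub hle]
    have h2 := (Nat.ceil_lt_add_one (a := (1 + ε) * m) (by positivity)).le
    have h3 : m * F m * (ε + 1 / m) = (ε * m + 1) * F m := by field_simp
    rw [h3]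
    exact mul_le_mul_of_nonneg_right (by linarith) (h0 m)
  · intro b hb
    have hev := (hder.mono_left (nhdsWithin_mono (s := Iio 0) 0 fun x hx => (mem_Iio.1 hx).ne)).eventually
      (gt_mem_nhds hb)
    obtain ⟨ε, hε, hε0, hε1⟩ := (hev.and (Ioo_mem_nhdsLT (show (-1 : ℝ) < 0 by norm_num))).exists
    have hneg : ∀ᶠ m : ℕ in atTop, ε + 1 / (m : ℝ) < 0 := by
      have h2 : Tendsto (fun m : ℕ => ε + 1 / (m : ℝ)) atTop (𝓝 ε) := by
        simpa using tendsto_const_nhds.add (tendsto_one_div_atTop_nhds_zero_nat (𝕜 := ℝ))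
      exact h2.eventually_lt_const hε1
    filter_upwards [(hquot ε hε1.ne hε0).eventually (gt_mem_nhds hε),
      eventually_gt_atTop 0, hneg] with m hm hm0 hmneg
    have hm0' : (0 : ℝ) < m := by exact_mod_cast hm0
    refine lt_of_le_of_lt ?_ hm
    have hL := seqLaplace_pos hF h0 hpos (y := 1 / (m : ℝ)) (by positivity)
    rw [le_div_iff_of_neg hmneg, hS]
    simp only [one_mul, Nat.ceil_natCast]
    rw [← sub_div, div_mul_eq_mul_div, div_le_div_iff_of_pos_right hL]
    have hle : ⌈(1 + ε) * m⌉₊ ≤ m := by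
      rw [Nat.ceil_le]; nlinarith
    have h0' := Finset.sum_Ico_eq_sub F hle
    have h1 : ∑ k ∈ Finset.Ico ⌈(1 + ε) * m⌉₊ m, F m ≤ ∑ k ∈ Finset.Ico ⌈(1 + ε) * m⌉₊ m, F k :=
      Finset.sum_le_sum fun k hk => hanti (Finset.mem_Ico.1 hk).2.le
    rw [Finset.sum_const, Nat.card_Ico, nsmul_eq_mul, Nat.cast_sub hle] at h1
    have h2 := (Nat.ceil_lt_add_one (a := (1 + ε) * m)
      (mul_nonneg (by linarith) hm0'.le)).le
    have h3 : m * F m * (ε + 1 / m) = (ε * m + 1) * F m := by field_simp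
    rw [h3]
    have h4 : (-(ε * m) - 1) * F m ≤ ((m : ℝ) - ⌈(1 + ε) * m⌉₊) * F m :=
      mul_le_mul_of_nonneg_right (by linarith) (h0 m)
    linarith

/-- Sums of a regularly varying nonincreasing sequence against a continuous weight. -/
theorem tendsto_sum_div_mul (hanti : Antitone F) (h0 : ∀ k, 0 ≤ F k) (hpos : 0 < F 0)
    (hδ : 0 < δ)
    (hΦ : ∀ r : ℝ, 0 ≤ r → Tendsto (fun m : ℕ => seqLaplace F ((1 + r) * (1 / (m + 1 : ℕ))) /
      seqLaplace F (1 / (m + 1 : ℕ))) atTop (𝓝 ((1 + r) ^ (-δ)))) :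
    (∀ᶠ m in atTop, 0 < F m) ∧ ∀ ψ : ℝ → ℝ, Continuous ψ →
      Tendsto (fun m : ℕ => (∑ k ∈ Finset.range m, F k * ψ (k / m)) / (m * F m))
        atTop (𝓝 (∫ x in (0 : ℝ)..1, ψ x * x ^ (δ - 1))) := by
  have hF : ∀ k, |F k| ≤ F 0 := fun k => by
    rw [abs_of_nonneg (h0 k)]; exact hanti (Nat.zero_le k)
  have hΓ := Real.Gamma_pos_of_pos hδ
  have h1 := tendsto_mul_div_seqLaplace hanti h0 hpos hδ hΦ
  constructor
  · filter_upwards [h1.eventually (lt_mem_nhds (one_div_pos.2 hΓ))] with m hm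
    refine (h0 m).lt_of_ne fun h => ?_
    rw [← h, mul_zero, zero_div] at hm
    exact hm.false
  · intro ψ hψ
    have h2 := tendsto_sum_div_seqLaplace hanti h0 hpos hδ hΦ hψ one_pos
    have h3 := h2.div h1 (one_div_pos.2 hΓ).ne'
    have h4 : (∫ x in (0 : ℝ)..1, ψ x * x ^ (δ - 1) / Real.Gamma δ) / (1 / Real.Gamma δ) =
        ∫ x in (0 : ℝ)..1, ψ x * x ^ (δ - 1) := by
      rw [intervalIntegral.integral_div]; field_simp
    rw [h4] at h3
    refine h3.congr' ?_
    filter_upwards [eventually_gt_atTop 0] with m hm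
    have hL := seqLaplace_pos hF h0 hpos (y := 1 / (m : ℝ)) (by positivity)
    simp only [one_mul, Nat.ceil_natCast, Pi.div_apply]
    rw [div_div_div_cancel_right₀ hL.ne']

end Tauberian

end BGWI

/-! ### Generating functions -/

namespace BGWI

section GenFun

variable (μ : PMF ℕ)

theorem summable_toReal : Summable fun n => (μ n).toReal :=
  ENNReal.summable_toReal (by rw [μ.tsum_coe]; exact ENNReal.one_ne_top)

theorem tsum_toReal_eq_one : ∑' n, (μ n).toReal = 1 := by
  rw [← ENNReal.tsum_toReal_eq (fun n => μ.apply_ne_top n), μ.tsum_coe, ENNReal.toReal_one]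

theorem summable_genFun {s : ℝ} (h0 : 0 ≤ s) (h1 : s ≤ 1) :
    Summable fun n : ℕ => s ^ n * (μ n).toReal :=
  (summable_toReal μ).of_nonneg_of_le (fun n => by positivity)
    (fun n => mul_le_of_le_one_left ENNReal.toReal_nonneg (pow_le_one₀ h0 h1))

theorem genFun_one : genFun μ 1 = 1 := by
  simp [genFun, tsum_toReal_eq_one]

theorem genFun_zero : genFun μ 0 = (μ 0).toReal := by
  rw [genFun, tsum_eq_single 0 (fun n hn => by simp [hn])]
  simp

theorem genFun_nonneg {s : ℝ} (h0 : 0 ≤ s) : 0 ≤ genFun μ s :=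
  tsum_nonneg fun n => by positivity

theorem genFun_mono {s s' : ℝ} (h0 : 0 ≤ s) (h : s ≤ s') (h1 : s' ≤ 1) :
    genFun μ s ≤ genFun μ s' :=
  (summable_genFun μ h0 (h.trans h1)).tsum_le_tsum
    (fun n => mul_le_mul_of_nonneg_right (pow_le_pow_left₀ h0 h n) ENNReal.toReal_nonneg)
    (summable_genFun μ (h0.trans h) h1)

theorem genFun_le_one {s : ℝ} (h0 : 0 ≤ s) (h1 : s ≤ 1) : genFun μ s ≤ 1 :=
  (genFun_mono μ h0 h1 le_rfl).trans_eq (genFun_one μ)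

theorem convexOn_genFun : ConvexOn ℝ (Icc 0 1) (genFun μ) := by
  refine ⟨convex_Icc 0 1, fun x hx y hy a b ha hb hab => ?_⟩
  have hxy := (convex_Icc (0 : ℝ) 1) hx hy ha hb hab
  simp only [genFun, smul_eq_mul] at hxy ⊢
  rw [← tsum_mul_left, ← tsum_mul_left, ← Summable.tsum_add
    ((summable_genFun μ hx.1 hx.2).mul_left a) ((summable_genFun μ hy.1 hy.2).mul_left b)]
  refine (summable_genFun μ hxy.1 hxy.2).tsum_le_tsum (fun n => ?_)
    (((summable_genFun μ hx.1 hx.2).mul_left a).add ((summable_genFun μ hy.1 hy.2).mul_left b))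
  have h := (convexOn_pow (𝕜 := ℝ) n).2 (mem_Ici.2 hx.1) (mem_Ici.2 hy.1) ha hb hab
  simp only [smul_eq_mul] at h
  calc _ ≤ (a * x ^ n + b * y ^ n) * (μ n).toReal :=
        mul_le_mul_of_nonneg_right h ENNReal.toReal_nonneg
    _ = _ := by ring

/-- The excess `φ(q) = f(1 - q) - (1 - q)` of the generating function over the identity. -/
noncomputable def excess (q : ℝ) : ℝ := genFun μ (1 - q) - (1 - q)

/-- The relative one-step decrease `β(q)` of `q = 1 - s` under the generating function:
`1 - f(1 - q) = q (1 - β(q))`. -/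
noncomputable def rate (q : ℝ) : ℝ := excess μ q / q

/-- The map `q ↦ 1 - f(1 - q)`, which is the generating function in the variable `q = 1 - s`. -/
noncomputable def step (q : ℝ) : ℝ := 1 - genFun μ (1 - q)

theorem step_eq {q : ℝ} (hq : 0 < q) : step μ q = q * (1 - rate μ q) := by
  unfold step rate excess; field_simp; ring

theorem convexOn_excess : ConvexOn ℝ (Icc 0 1) (excess μ) := by
  refine ⟨convex_Icc 0 1, fun x hx y hy a b ha hb hab => ?_⟩
  have h := (convexOn_genFun μ).2 (x := 1 - x) ⟨by linarith [hx.2], by linarith [hx.1]⟩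
    (y := 1 - y) ⟨by linarith [hy.2], by linarith [hy.1]⟩ ha hb hab
  simp only [smul_eq_mul, excess] at h ⊢
  have e : a * (1 - x) + b * (1 - y) = 1 - (a * x + b * y) := by linear_combination hab
  rw [e] at h
  linear_combination h + hab

theorem excess_zero : excess μ 0 = 0 := by simp [excess, genFun_one]

theorem rate_mono {q q' : ℝ} (hq : 0 < q) (h : q ≤ q') (h1 : q' ≤ 1) : rate μ q ≤ rate μ q' := by
  have := (convexOn_excess μ).secant_mono (a := 0) (x := q) (y := q') ⟨le_rfl, zero_le_one⟩
    ⟨hq.le, h.trans h1⟩ ⟨hq.le.trans h, h1⟩ hq.ne' (hq.trans_le h).ne' h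
  simpa [excess_zero, rate] using this

end GenFun

section Rate

variable {μ ν : PMF ℕ} {α c d : ℝ} {ℓ k : ℝ → ℝ}

theorem excess_eq (hSL : SL μ ν α c d ℓ k) {q : ℝ} (hq : q ∈ Ioo (0 : ℝ) 1) :
    excess μ q = c * q ^ (1 + α) * ℓ q := by
  have := hSL.offspring (1 - q) ⟨by linarith [hq.2], by linarith [hq.1]⟩
  rw [excess, this]
  ring_nf

theorem rate_eq (hSL : SL μ ν α c d ℓ k) {q : ℝ} (hq : q ∈ Ioo (0 : ℝ) 1) :
    rate μ q = c * q ^ α * ℓ q := by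
  rw [rate, excess_eq hSL hq, Real.rpow_add hq.1, Real.rpow_one]
  have := hq.1.ne'
  field_simp

theorem rate_pos (hSL : SL μ ν α c d ℓ k) {q : ℝ} (hq : 0 < q) (h1 : q ≤ 1) : 0 < rate μ q := by
  have key : ∀ q : ℝ, q ∈ Ioo (0 : ℝ) 1 → 0 < rate μ q := fun q hq => by
    rw [rate_eq hSL hq]
    have h2 := hSL.slow_l.pos q hq
    have h3 := Real.rpow_pos_of_pos hq.1 α
    have h4 := hSL.c_pos
    positivity
  rcases h1.lt_or_eq with h | rfl
  · exact key q ⟨hq, h⟩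
  · exact (key (1 / 2) (by constructor <;> norm_num)).trans_le
      (rate_mono μ (by norm_num) (by norm_num) le_rfl)

theorem eventually_Ioo (a : ℝ) (ha : 0 < a) : ∀ᶠ q in 𝓝[>] (0 : ℝ), a * q ∈ Ioo (0 : ℝ) 1 := by
  have h : Ioo (0 : ℝ) (1 / a) ∈ 𝓝[>] (0 : ℝ) := Ioo_mem_nhdsGT (by positivity)
  filter_upwards [h] with q hq
  refine ⟨mul_pos ha hq.1, ?_⟩
  have := (lt_div_iff₀ ha).1 hq.2
  linarith

theorem tendsto_excess_ratio (hSL : SL μ ν α c d ℓ k) {a : ℝ} (ha : 0 < a) :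
    Tendsto (fun q => excess μ (a * q) / excess μ q) (𝓝[>] 0) (𝓝 (a ^ (1 + α))) := by
  have h1 := (hSL.slow_l.tendsto a ha).const_mul (a ^ (1 + α))
  rw [mul_one] at h1
  refine h1.congr' ?_
  filter_upwards [eventually_Ioo a ha, eventually_Ioo 1 one_pos] with q hq hq1
  rw [one_mul] at hq1
  rw [excess_eq hSL hq, excess_eq hSL hq1, Real.mul_rpow ha.le hq1.1.le]
  have h2 := (hSL.slow_l.pos q hq1).ne'
  have h3 := (Real.rpow_pos_of_pos hq1.1 (1 + α)).ne'
  have h4 := hSL.c_pos.ne'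
  field_simp

theorem tendsto_rate_ratio (hSL : SL μ ν α c d ℓ k) {a : ℝ} (ha : 0 < a) :
    Tendsto (fun q => rate μ (a * q) / rate μ q) (𝓝[>] 0) (𝓝 (a ^ α)) := by
  have h1 := (tendsto_excess_ratio hSL ha).div_const a
  have h2 : a ^ (1 + α) / a = a ^ α := by
    rw [Real.rpow_add ha, Real.rpow_one]; field_simp
  rw [h2] at h1
  refine h1.congr' ?_
  filter_upwards [self_mem_nhdsWithin] with q hq
  have : q ≠ 0 := (mem_Ioi.1 hq).ne'
  rw [rate, rate]
  field_simp

theorem tendsto_rate_zero (hSL : SL μ ν α c d ℓ k) : Tendsto (rate μ) (𝓝[>] 0) (𝓝[>] 0) := by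
  have hpos : ∀ᶠ q in 𝓝[>] (0 : ℝ), 0 < rate μ q := by
    filter_upwards [eventually_Ioo 1 one_pos] with q hq
    rw [one_mul] at hq
    exact rate_pos hSL hq.1 hq.2.le
  -- by monotonicity the limit exists, and regular variation of positive index makes it zero
  set L := sInf (rate μ '' Ioc 0 1)
  have hbdd : BddBelow (rate μ '' Ioc 0 1) :=
    ⟨0, by rintro _ ⟨q, hq, rfl⟩; exact (rate_pos hSL hq.1 hq.2).le⟩
  have hlim : Tendsto (rate μ) (𝓝[>] 0) (𝓝 L) := by
    have hne : (rate μ '' Ioc 0 1).Nonempty := ⟨_, 1, ⟨one_pos, le_rfl⟩, rfl⟩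
    rw [tendsto_order]
    constructor
    · intro b hb
      filter_upwards [eventually_Ioo 1 one_pos] with q hq
      rw [one_mul] at hq
      exact hb.trans_le (csInf_le hbdd ⟨q, ⟨hq.1, hq.2.le⟩, rfl⟩)
    · intro b hb
      obtain ⟨_, ⟨q0, hq0, rfl⟩, h⟩ := exists_lt_of_csInf_lt hne hb
      filter_upwards [Ioo_mem_nhdsGT hq0.1] with q hq
      exact (rate_mono μ hq.1 hq.2.le hq0.2).trans_lt h
  have hL0 : L = 0 := by
    by_contra hne
    have hhalf : Tendsto (fun q : ℝ => 1 / 2 * q) (𝓝[>] 0) (𝓝[>] 0) := by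
      refine tendsto_nhdsWithin_iff.2 ⟨?_, ?_⟩
      · have : Tendsto (fun q : ℝ => 1 / 2 * q) (𝓝 0) (𝓝 (1 / 2 * 0)) :=
          tendsto_id.const_mul _
        rw [mul_zero] at this
        exact this.mono_left nhdsWithin_le_nhds
      · filter_upwards [self_mem_nhdsWithin] with q hq
        exact mul_pos (by norm_num) (mem_Ioi.1 hq)
    have h1 : Tendsto (fun q => rate μ (1 / 2 * q) / rate μ q) (𝓝[>] 0) (𝓝 (L / L)) :=
      (hlim.comp hhalf).div hlim hne
    rw [div_self hne] at h1
    have h2 := tendsto_nhds_unique h1 (tendsto_rate_ratio hSL (a := 1 / 2) (by norm_num))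
    have h3 := Real.rpow_lt_one (x := 1 / 2) (by norm_num) (by norm_num) hSL.alpha_pos
    linarith
  rw [hL0] at hlim
  exact tendsto_nhdsWithin_iff.2 ⟨hlim, hpos⟩

theorem rate_lt_one (hSL : SL μ ν α c d ℓ k) {q : ℝ} (hq : 0 < q) (h1 : q ≤ 1) :
    rate μ q < 1 := by
  by_contra hge
  rw [not_lt] at hge
  have hone : genFun μ (1 - q) ≥ 1 := by
    have := (le_div_iff₀ hq).1 hge
    unfold excess at this
    linarith
  have hev : ∀ᶠ x in 𝓝[>] (0 : ℝ), rate μ x < 1 :=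
    ((tendsto_rate_zero hSL).mono_right nhdsWithin_le_nhds).eventually_lt_const one_pos
  obtain ⟨x, hx, hx0, hxq⟩ := (hev.and (Ioo_mem_nhdsGT hq)).exists
  have h2 := genFun_mono μ (s := 1 - q) (s' := 1 - x) (by linarith) (by linarith) (by linarith)
  have h3 : 1 ≤ rate μ x := by
    rw [rate, le_div_iff₀ hx0, excess]; linarith
  linarith

theorem step_mem (hSL : SL μ ν α c d ℓ k) {q : ℝ} (hq : 0 < q) (h1 : q ≤ 1) :
    0 < step μ q ∧ step μ q < q := by
  rw [step_eq μ hq]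
  have h2 := rate_pos hSL hq h1
  have h3 := rate_lt_one hSL hq h1
  exact ⟨mul_pos hq (by linarith), by nlinarith⟩

/-- The increments of `1 / β` along one step converge. Convexity of the generating function
replaces the differentiability of the slowly varying factor. -/
theorem tendsto_inv_rate_step (hSL : SL μ ν α c d ℓ k) :
    Tendsto (fun q => 1 / rate μ (step μ q) - 1 / rate μ q) (𝓝[>] 0) (𝓝 α) := by
  have hβ := (tendsto_rate_zero hSL).mono_right nhdsWithin_le_nhds
  have h01 : ∀ᶠ q in 𝓝[>] (0 : ℝ), q ∈ Ioo (0 : ℝ) 1 := by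
    simpa using eventually_Ioo 1 one_pos
  have hder : Tendsto (fun ε : ℝ => ((1 + ε) ^ (1 + α) - 1) / ε) (𝓝[≠] 0) (𝓝 (1 + α)) := by
    have h1 := (Real.hasDerivAt_rpow_const (x := 1) (p := 1 + α)
      (Or.inl one_ne_zero)).tendsto_slope_zero
    simp only [Real.one_rpow, mul_one, smul_eq_mul] at h1
    refine h1.congr fun ε => ?_
    rw [inv_mul_eq_div]
  -- the slope of the excess between `step q` and `q`, relative to `φ(q) / q`
  set ρ : ℝ → ℝ := fun q => (excess μ q - excess μ (step μ q)) / (q - step μ q) * q / excess μ q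
    with hρ
  have hquot : ∀ ε : ℝ, -1 < ε → Tendsto (fun q => (excess μ ((1 + ε) * q) / excess μ q - 1) / ε)
      (𝓝[>] 0) (𝓝 (((1 + ε) ^ (1 + α) - 1) / ε)) := fun ε hε =>
    ((tendsto_excess_ratio hSL (by linarith)).sub_const 1).div_const ε
  have hρlim : Tendsto ρ (𝓝[>] 0) (𝓝 (1 + α)) := by
    rw [tendsto_order]
    constructor
    · intro b hb
      have hev := (hder.mono_left (nhdsWithin_mono (s := Iio 0) 0
        fun x hx => (mem_Iio.1 hx).ne)).eventually (lt_mem_nhds hb)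
      obtain ⟨ε, hε, hε1, hε0⟩ :=
        (hev.and (Ioo_mem_nhdsLT (show (-1 : ℝ) < 0 by norm_num))).exists
      filter_upwards [(hquot ε hε1).eventually (lt_mem_nhds hε), h01,
        hβ.eventually_lt_const (show 0 < -ε by linarith)] with q hq hq01 hqβ
      refine hq.trans_le ?_
      have hs := step_mem hSL hq01.1 hq01.2.le
      have hex : 0 < excess μ q := by
        have := mul_pos (rate_pos hSL hq01.1 hq01.2.le) hq01.1
        rwa [rate, div_mul_cancel₀ _ hq01.1.ne'] at this
      have hle : (1 + ε) * q ≤ step μ q := by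
        rw [step_eq μ hq01.1]
        nlinarith [hq01.1]
      have h2 := (convexOn_excess μ).secant_mono (a := q) (x := (1 + ε) * q) (y := step μ q)
        ⟨hq01.1.le, hq01.2.le⟩ ⟨by nlinarith [hq01.1], by nlinarith [hq01.1, hq01.2]⟩
        ⟨hs.1.le, by linarith [hq01.2]⟩ (by nlinarith [hq01.1]) hs.2.ne hle
      have h3 : (excess μ (step μ q) - excess μ q) / (step μ q - q) =
          (excess μ q - excess μ (step μ q)) / (q - step μ q) := by
        rw [← neg_div_neg_eq, neg_sub, neg_sub]
      rw [h3] at h2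
      have h4 : (excess μ ((1 + ε) * q) / excess μ q - 1) / ε =
          (excess μ ((1 + ε) * q) - excess μ q) / ((1 + ε) * q - q) * q / excess μ q := by
        have : (1 + ε) * q - q = ε * q := by ring
        rw [this]
        have := hq01.1.ne'
        field_simp
      rw [h4, hρ]
      exact div_le_div_of_nonneg_right (mul_le_mul_of_nonneg_right h2 hq01.1.le) hex.le
    · intro b hb
      have hev := (hder.mono_left (nhdsWithin_mono (s := Ioi 0) 0
        fun x hx => (mem_Ioi.1 hx).ne')).eventually (gt_mem_nhds hb)
      obtain ⟨ε, hε, hε0⟩ := (hev.and (self_mem_nhdsWithin (s := Ioi (0 : ℝ)))).exists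
      filter_upwards [(hquot ε (by linarith)).eventually (gt_mem_nhds hε), h01,
        eventually_Ioo (1 + ε) (by linarith)] with q hq hq01 hqε
      refine lt_of_le_of_lt ?_ hq
      have hs := step_mem hSL hq01.1 hq01.2.le
      have hex : 0 < excess μ q := by
        have := mul_pos (rate_pos hSL hq01.1 hq01.2.le) hq01.1
        rwa [rate, div_mul_cancel₀ _ hq01.1.ne'] at this
      have h2 := (convexOn_excess μ).secant_mono (a := q) (x := step μ q) (y := (1 + ε) * q)
        ⟨hq01.1.le, hq01.2.le⟩ ⟨hs.1.le, by linarith [hq01.2]⟩ ⟨hqε.1.le, hqε.2.le⟩ hs.2.ne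
        (by nlinarith [hq01.1]) (by nlinarith [hq01.1])
      have h3 : (excess μ (step μ q) - excess μ q) / (step μ q - q) =
          (excess μ q - excess μ (step μ q)) / (q - step μ q) := by
        rw [← neg_div_neg_eq, neg_sub, neg_sub]
      rw [h3] at h2
      have h4 : (excess μ ((1 + ε) * q) / excess μ q - 1) / ε =
          (excess μ ((1 + ε) * q) - excess μ q) / ((1 + ε) * q - q) * q / excess μ q := by
        have : (1 + ε) * q - q = ε * q := by ring
        rw [this]
        have := hq01.1.ne'
        field_simp
      rw [h4, hρ]
      exact div_le_div_of_nonneg_right (mul_le_mul_of_nonneg_right h2 hq01.1.le) hex.le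
  have hfin : Tendsto (fun q => (ρ q - 1) / (1 - ρ q * rate μ q)) (𝓝[>] 0) (𝓝 α) := by
    have h1 : Tendsto (fun q => (ρ q - 1) / (1 - ρ q * rate μ q)) (𝓝[>] 0)
        (𝓝 ((1 + α - 1) / (1 - (1 + α) * 0))) :=
      (hρlim.sub_const 1).div ((tendsto_const_nhds (x := (1 : ℝ))).sub (hρlim.mul hβ)) (by simp)
    simpa using h1
  refine hfin.congr' ?_
  filter_upwards [h01] with q hq
  have hs := step_mem hSL hq.1 hq.2.le
  have hr := rate_pos hSL hq.1 hq.2.le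
  have hr' := rate_pos hSL hs.1 (by linarith [hq.2])
  have hr1 := rate_lt_one hSL hq.1 hq.2.le
  -- `φ(step q) = φ(q) (1 - ρ β)`
  have e1 : excess μ (step μ q) = excess μ q * (1 - ρ q * rate μ q) := by
    have hne : q - step μ q ≠ 0 := by linarith [hs.2]
    have h1 : q - step μ q = q * rate μ q := by rw [step_eq μ hq.1]; ring
    have h2 : excess μ q = q * rate μ q := by
      rw [rate]; have := hq.1.ne'; field_simp
    have hq0 := hq.1.ne'
    have hr0 := hr.ne'
    rw [hρ]
    simp only [h1, h2]
    field_simp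
    ring
  have e2 : rate μ (step μ q) = rate μ q * (1 - ρ q * rate μ q) / (1 - rate μ q) := by
    have hq0 := hq.1.ne'
    have h3 : (1 - rate μ q) ≠ 0 := by linarith
    have h4 : excess μ q = q * rate μ q := by
      rw [rate]; field_simp
    rw [rate, e1, step_eq μ hq.1, h4]
    field_simp
  have e3 : 1 - ρ q * rate μ q ≠ 0 := by
    intro h
    rw [e2, h] at hr'
    simp at hr'
  have h3 : (1 - rate μ q) ≠ 0 := by linarith
  rw [e2]
  have hr0 := hr.ne'
  field_simp
  ring

end Rate

end BGWI

/-! ### Iterates of the generating function -/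

namespace BGWI

/-- A first-order expansion of the logarithm at one. -/
theorem tendsto_log_one_add_div {ι : Type*} {l : Filter ι} {x y : ι → ℝ} {L : ℝ}
    (hx : Tendsto x l (𝓝 0)) (hxy : Tendsto (fun i => x i / y i) l (𝓝 L)) :
    Tendsto (fun i => Real.log (1 + x i) / y i) l (𝓝 L) := by
  have hd : HasDerivAt (fun x : ℝ => Real.log (1 + x)) 1 0 := by
    have h1 : HasDerivAt (fun x : ℝ => 1 + x) 1 0 := (hasDerivAt_id 0).const_add 1
    simpa using h1.log (by norm_num)
  have hc : ContinuousAt (dslope (fun x : ℝ => Real.log (1 + x)) 0) 0 :=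
    continuousAt_dslope_same.2 hd.differentiableAt
  have h1 : Tendsto (fun i => dslope (fun x : ℝ => Real.log (1 + x)) 0 (x i)) l (𝓝 1) := by
    have h2 := hc.tendsto.comp hx
    rwa [dslope_same, hd.deriv] at h2
  have h3 := hxy.mul h1
  rw [mul_one] at h3
  refine h3.congr fun i => ?_
  have h4 := sub_smul_dslope (fun x : ℝ => Real.log (1 + x)) 0 (x i)
  simp only [sub_zero, smul_eq_mul, add_zero, Real.log_one] at h4
  rw [← h4]; ring

variable {μ ν : PMF ℕ} {α c d : ℝ} {ℓ k : ℝ → ℝ}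

/-- The generating function `h_m(1 - q) = ∏_{j < m} g(f_j(1 - q))` of the `m`-th generation,
in the variable `q`. -/
noncomputable def genProd (μ ν : PMF ℕ) (m : ℕ) (q : ℝ) : ℝ :=
  ∏ j ∈ Finset.range m, genFun ν (1 - (step μ)^[j] q)

theorem genProd_succ (m : ℕ) (q : ℝ) :
    genProd μ ν (m + 1) q = genProd μ ν m q * genFun ν (1 - (step μ)^[m] q) :=
  Finset.prod_range_succ _ _

theorem genProd_succ' (m : ℕ) (q : ℝ) :
    genProd μ ν (m + 1) q = genFun ν (1 - q) * genProd μ ν m (step μ q) := by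
  rw [genProd, Finset.prod_range_succ', mul_comm]
  rfl

theorem tendsto_one_sub_genFun_div (hSL : SL μ ν α c d ℓ k) :
    Tendsto (fun q => (1 - genFun ν (1 - q)) / rate μ q) (𝓝[>] 0) (𝓝 (d / c)) := by
  have h1 := (tendsto_const_nhds (x := d / c)).div hSL.ratio one_ne_zero
  rw [div_one] at h1
  refine h1.congr' ?_
  filter_upwards [eventually_Ioo 1 one_pos] with q hq
  rw [one_mul] at hq
  have h2 := hSL.immigration (1 - q) ⟨by linarith [hq.2], by linarith [hq.1]⟩
  rw [h2, rate_eq hSL hq, sub_sub_cancel]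
  have h3 := (hSL.slow_l.pos q hq).ne'
  have h4 := (hSL.slow_k.pos q hq).ne'
  have h5 := (Real.rpow_pos_of_pos hq.1 α).ne'
  have h6 := hSL.c_pos.ne'
  simp only [Pi.div_apply]
  field_simp
  ring_nf

theorem genFun_immigration_pos (hν : 0 < ν 0) {q : ℝ} (hq : 0 ≤ q) (h1 : q ≤ 1) :
    0 < genFun ν (1 - q) := by
  have h2 := genFun_mono ν (s := 0) (s' := 1 - q) le_rfl (by linarith) (by linarith)
  rw [genFun_zero] at h2
  exact (ENNReal.toReal_pos hν.ne' (ν.apply_ne_top 0)).trans_le h2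

theorem tendsto_log_defect (hSL : SL μ ν α c d ℓ k) :
    Tendsto (fun q => (Real.log (genFun ν (1 - q)) +
      d / (α * c) * Real.log (rate μ q / rate μ (step μ q))) / rate μ q) (𝓝[>] 0) (𝓝 0) := by
  have hβ := (tendsto_rate_zero hSL).mono_right nhdsWithin_le_nhds
  have h01 : ∀ᶠ q in 𝓝[>] (0 : ℝ), q ∈ Ioo (0 : ℝ) 1 := by
    simpa using eventually_Ioo 1 one_pos
  have hα := hSL.alpha_pos.ne'
  have hc := hSL.c_pos.ne'
  have h1 : Tendsto (fun q => -(1 - genFun ν (1 - q))) (𝓝[>] 0) (𝓝 0) := by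
    have := ((tendsto_one_sub_genFun_div hSL).mul hβ).neg
    rw [mul_zero, neg_zero] at this
    refine this.congr' ?_
    filter_upwards [h01] with q hq
    rw [div_mul_cancel₀ _ (rate_pos hSL hq.1 hq.2.le).ne']
  have h2 := tendsto_log_one_add_div (y := rate μ) (L := -(d / c)) h1
    ((tendsto_one_sub_genFun_div hSL).neg.congr fun q => (neg_div _ _).symm)
  have h3 := tendsto_inv_rate_step hSL
  have h4 := tendsto_log_one_add_div (y := rate μ) (L := α)
    (x := fun q => (1 / rate μ (step μ q) - 1 / rate μ q) * rate μ q)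
    (by simpa using h3.mul hβ) (h3.congr' (by
      filter_upwards [h01] with q hq
      rw [mul_div_cancel_right₀ _ (rate_pos hSL hq.1 hq.2.le).ne']))
  have h5 := h2.add (h4.const_mul (d / (α * c)))
  have h6 : -(d / c) + d / (α * c) * α = 0 := by field_simp; ring
  rw [h6] at h5
  refine h5.congr' ?_
  filter_upwards [h01] with q hq
  have hr := (rate_pos hSL hq.1 hq.2.le).ne'
  have e1 : 1 + -(1 - genFun ν (1 - q)) = genFun ν (1 - q) := by ring
  have e2 : 1 + (1 / rate μ (step μ q) - 1 / rate μ q) * rate μ q =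
      rate μ q / rate μ (step μ q) := by
    have hs := step_mem hSL hq.1 hq.2.le
    have hr' := (rate_pos hSL hs.1 (by linarith [hq.2])).ne'
    field_simp
    ring
  rw [e1, e2]
  ring

theorem orbit_mem (hSL : SL μ ν α c d ℓ k) {q : ℝ} (hq : 0 < q) (h1 : q ≤ 1) (j : ℕ) :
    0 < (step μ)^[j] q ∧ (step μ)^[j] q ≤ q := by
  induction j with
  | zero => exact ⟨hq, le_rfl⟩
  | succ j ih =>
    rw [Function.iterate_succ_apply']
    have := step_mem hSL ih.1 (ih.2.trans h1)
    exact ⟨this.1, this.2.le.trans ih.2⟩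

theorem genProd_pos (hSL : SL μ ν α c d ℓ k) (hν : 0 < ν 0) {q : ℝ} (hq : 0 < q) (h1 : q ≤ 1)
    (m : ℕ) : 0 < genProd μ ν m q :=
  Finset.prod_pos fun j _ => genFun_immigration_pos hν (orbit_mem hSL hq h1 j).1.le
    ((orbit_mem hSL hq h1 j).2.trans h1)

theorem tendsto_orbit (hSL : SL μ ν α c d ℓ k) :
    Tendsto (fun j => (step μ)^[j] 1) atTop (𝓝[>] 0) := by
  set q : ℕ → ℝ := fun j => (step μ)^[j] 1 with hq
  have hmem := fun j => orbit_mem hSL one_pos le_rfl j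
  have hsucc : ∀ j, q (j + 1) = q j * (1 - rate μ (q j)) := fun j => by
    rw [← step_eq μ (hmem j).1, hq]
    exact Function.iterate_succ_apply' _ _ _
  have hanti : Antitone q := antitone_nat_of_succ_le fun j => by
    rw [hsucc j]
    nlinarith [(hmem j).1, rate_pos hSL (hmem j).1 (hmem j).2]
  have hbdd : BddBelow (range q) := ⟨0, by rintro _ ⟨j, rfl⟩; exact (hmem j).1.le⟩
  have hlim := tendsto_atTop_ciInf hanti hbdd
  set L := ⨅ j, q j
  have hL0 : 0 ≤ L := le_ciInf fun j => (hmem j).1.le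
  have hLle : ∀ j, L ≤ q j := fun j => ciInf_le hbdd j
  have hL : L = 0 := by
    by_contra hne
    have hLpos : 0 < L := hL0.lt_of_ne (Ne.symm hne)
    have hL1 : L ≤ 1 := (hLle 0).trans (hmem 0).2
    have hr := rate_pos hSL hLpos hL1
    have h1 : Tendsto (fun j => q (j + 1)) atTop (𝓝 L) := hlim.comp (tendsto_add_atTop_nat 1)
    have h2 : Tendsto (fun j => q j * (1 - rate μ L)) atTop (𝓝 (L * (1 - rate μ L))) :=
      hlim.mul_const _
    have h3 := le_of_tendsto_of_tendsto' h1 h2 fun j => by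
      rw [hsucc j]
      have := rate_mono μ hLpos (hLle j) (hmem j).2
      exact mul_le_mul_of_nonneg_left (by linarith) (hmem j).1.le
    nlinarith
  rw [hL] at hlim
  exact tendsto_nhdsWithin_iff.2 ⟨hlim, Eventually.of_forall fun j => (hmem j).1⟩

/-- The ratio `u_{j+1} / u_j = g(f_j(0))` of the probabilities `u_j = P(Z₁(j) = 0)` is
`1 - (δ + o(1)) / j`. -/
theorem tendsto_mul_one_sub_genFun_orbit (hSL : SL μ ν α c d ℓ k) :
    Tendsto (fun j : ℕ => ((j : ℝ) + 1) * (1 - genFun ν (1 - (step μ)^[j] 1))) atTop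
      (𝓝 (d / (α * c))) := by
  have hmem := fun j => orbit_mem hSL one_pos le_rfl j
  have hβpos := fun j => rate_pos hSL (hmem j).1 (hmem j).2
  set w : ℕ → ℝ := fun j => 1 / rate μ ((step μ)^[j] 1) with hw
  have hD : Tendsto (fun j => w (j + 1) - w j) atTop (𝓝 α) := by
    refine ((tendsto_inv_rate_step hSL).comp (tendsto_orbit hSL)).congr fun j => ?_
    simp only [hw, Function.comp_apply, Function.iterate_succ_apply']
  have hces := hD.cesaro
  have hwn : Tendsto (fun n : ℕ => w n / n) atTop (𝓝 α) := by
    have h1 := hces.add (tendsto_inv_atTop_nhds_zero_nat.mul_const (w 0))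
    simp only [zero_mul, add_zero] at h1
    refine h1.congr fun n => ?_
    rw [Finset.sum_range_sub]
    ring
  have h2 := ((tendsto_one_sub_genFun_div hSL).comp (tendsto_orbit hSL)).div hwn
    hSL.alpha_pos.ne'
  have h3 : Tendsto (fun n : ℕ => ((n : ℝ) + 1) / n) atTop (𝓝 1) := by
    have h4 := (tendsto_const_nhds (x := (1 : ℝ))).add (tendsto_inv_atTop_nhds_zero_nat (𝕜 := ℝ))
    rw [add_zero] at h4
    refine h4.congr' ?_
    filter_upwards [eventually_gt_atTop 0] with n hn
    have : (n : ℝ) ≠ 0 := by positivity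
    field_simp
  have h5 := h3.mul h2
  rw [one_mul, div_div, mul_comm c α] at h5
  refine h5.congr' ?_
  filter_upwards [eventually_gt_atTop 0] with n hn
  have : (n : ℝ) ≠ 0 := by positivity
  have := (hβpos n).ne'
  simp only [Pi.div_apply, Function.comp_apply, hw]
  field_simp

/-- Uniform linear growth of `1 / β` along orbits that start near zero. -/
theorem exists_inv_rate_orbit (hSL : SL μ ν α c d ℓ k) {ε : ℝ} (hε : 0 < ε) :
    ∃ η ∈ Ioo (0 : ℝ) 1, ∀ q ∈ Ioo 0 η, ∀ j : ℕ,
      |1 / rate μ ((step μ)^[j] q) - 1 / rate μ q - α * j| ≤ ε * j := by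
  have h1 := (tendsto_inv_rate_step hSL).eventually (Metric.closedBall_mem_nhds α hε)
  obtain ⟨η, hη, h2⟩ := mem_nhdsGT_iff_exists_Ioo_subset.1 (h1.and (Ioo_mem_nhdsGT one_pos))
  rw [mem_Ioi] at hη
  refine ⟨min η (1 / 2), ⟨by positivity, by linarith [min_le_right η (1 / 2)]⟩, ?_⟩
  intro q hq j
  have hqη := hq.2.trans_le (min_le_left _ _)
  have hq1 := hq.2.trans_le (min_le_right _ _)
  induction j with
  | zero => simp
  | succ j ih =>
    have hm := orbit_mem hSL hq.1 (by linarith) j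
    have h3 := (h2 ⟨hm.1, hm.2.trans_lt hqη⟩).1
    rw [Real.dist_eq] at h3
    rw [Function.iterate_succ_apply']
    push_cast
    rw [abs_le] at h3 ih ⊢
    constructor <;> linarith [h3.1, h3.2, ih.1, ih.2]

/-- Uniform asymptotics of the generating functions `h_j` along orbits that start near zero. -/
theorem exists_log_genProd (hSL : SL μ ν α c d ℓ k) (hν : 0 < ν 0) {ε : ℝ} (hε : 0 < ε) :
    ∃ η ∈ Ioo (0 : ℝ) 1, ∀ q ∈ Ioo 0 η, ∀ j : ℕ,
      |Real.log (genProd μ ν j q) +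
        d / (α * c) * Real.log (rate μ q / rate μ ((step μ)^[j] q))| ≤ ε * (j * rate μ q) := by
  have h1 := (tendsto_log_defect hSL).eventually (Metric.closedBall_mem_nhds 0 hε)
  obtain ⟨η, hη, h2⟩ := mem_nhdsGT_iff_exists_Ioo_subset.1 (h1.and (Ioo_mem_nhdsGT one_pos))
  rw [mem_Ioi] at hη
  refine ⟨min η (1 / 2), ⟨by positivity, by linarith [min_le_right η (1 / 2)]⟩, ?_⟩
  intro q hq j
  have hqη := hq.2.trans_le (min_le_left _ _)
  have hq1 : q ≤ 1 := by linarith [hq.2.trans_le (min_le_right η (1 / 2))]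
  have hrq := rate_pos hSL hq.1 hq1
  induction j with
  | zero => simp [genProd, div_self hrq.ne']
  | succ j ih =>
    have hm := orbit_mem hSL hq.1 hq1 j
    have hm' := orbit_mem hSL hq.1 hq1 (j + 1)
    have h3 := (h2 ⟨hm.1, hm.2.trans_lt hqη⟩).1
    have hr := rate_pos hSL hm.1 (hm.2.trans hq1)
    have hr' := rate_pos hSL hm'.1 (hm'.2.trans hq1)
    rw [Real.dist_eq, sub_zero, abs_div, abs_of_pos hr,
      div_le_iff₀ hr, ← Function.iterate_succ_apply' (step μ) j q] at h3
    have h4 := rate_mono μ hm.1 hm.2 hq1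
    have e1 : Real.log (genProd μ ν (j + 1) q) = Real.log (genProd μ ν j q) +
        Real.log (genFun ν (1 - (step μ)^[j] q)) := by
      rw [genProd_succ, Real.log_mul (genProd_pos hSL hν hq.1 hq1 j).ne'
        (genFun_immigration_pos hν hm.1.le (hm.2.trans hq1)).ne']
    have e2 : Real.log (rate μ q / rate μ ((step μ)^[j + 1] q)) =
        Real.log (rate μ q / rate μ ((step μ)^[j] q)) +
        Real.log (rate μ ((step μ)^[j] q) / rate μ ((step μ)^[j + 1] q)) := by
      rw [Real.log_div hrq.ne' hr'.ne', Real.log_div hrq.ne' hr.ne', Real.log_div hr.ne' hr'.ne']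
      ring
    rw [e1, e2]
    push_cast
    have h5 := mul_le_mul_of_nonneg_left h4 hε.le
    have h6 := h3.trans h5
    rw [abs_le] at h6 ih ⊢
    constructor <;> nlinarith [h6.1, h6.2, ih.1, ih.2]

end BGWI

/-! ### Regular variation of the Laplace transform of a renewal sequence -/

namespace BGWI

section RegularVariation

variable {u : ℕ → ℝ} {δ : ℝ}

theorem hasDerivAt_seqLaplace_shift {a : ℕ → ℝ} {C : ℝ} (ha : ∀ k : ℕ, |((k : ℝ) + 1) * a k| ≤ C)
    {y : ℝ} (hy : 0 < y) :
    HasDerivAt (fun y => ∑' k : ℕ, a k * Real.exp (-(y * (k + 1))))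
      (-∑' k : ℕ, ((k : ℝ) + 1) * a k * Real.exp (-(y * (k + 1)))) y := by
  have hexp : Summable fun k : ℕ => C * Real.exp (-(y / 2 * (k + 1))) := by
    have h1 : Summable fun k : ℕ => Real.exp (-(y / 2)) ^ (k + 1) :=
      (summable_nat_add_iff 1).2 (summable_geometric_of_lt_one (Real.exp_pos _).le
        (Real.exp_lt_one_iff.2 (by linarith)))
    refine (h1.mul_left C).congr fun k => ?_
    rw [← Real.exp_nat_mul]
    push_cast
    ring_nf
  have hle : ∀ (k : ℕ) (x : ℝ), x ∈ Ioi (y / 2) →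
      Real.exp (-(x * (k + 1))) ≤ Real.exp (-(y / 2 * (k + 1))) := fun k x hx => by
    rw [Real.exp_le_exp, neg_le_neg_iff]
    exact mul_le_mul_of_nonneg_right (mem_Ioi.1 hx).le (by positivity)
  have hC : 0 ≤ C := (abs_nonneg _).trans (ha 0)
  have hsum : Summable fun k : ℕ => a k * Real.exp (-(y * (k + 1))) := by
    refine Summable.of_norm_bounded hexp fun k => ?_
    rw [norm_mul, Real.norm_eq_abs, Real.norm_eq_abs, Real.abs_exp]
    refine mul_le_mul ?_ (hle k y (mem_Ioi.2 (by linarith))) (Real.exp_pos _).le hC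
    refine le_trans ?_ (ha k)
    rw [abs_mul]
    refine le_mul_of_one_le_left (abs_nonneg _) ?_
    rw [abs_of_nonneg (by positivity)]
    have : (0 : ℝ) ≤ k := k.cast_nonneg
    linarith
  have h := hasDerivAt_tsum_of_isPreconnected
    (g := fun (k : ℕ) (y : ℝ) => a k * Real.exp (-(y * (k + 1))))
    (g' := fun (k : ℕ) (y : ℝ) => -(((k : ℝ) + 1) * a k * Real.exp (-(y * (k + 1)))))
    hexp (isOpen_Ioi (a := y / 2)) isPreconnected_Ioi (fun k x _ => by
      have h1 : HasDerivAt (fun y : ℝ => -(y * ((k : ℝ) + 1))) (-(1 * ((k : ℝ) + 1))) x :=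
        ((hasDerivAt_id x).mul_const _).neg
      convert! (h1.exp.const_mul (a k)) using 1
      ring)
    (fun k x hx => by
      rw [norm_neg, norm_mul, Real.norm_eq_abs, Real.norm_eq_abs, Real.abs_exp]
      exact mul_le_mul (ha k) (hle k x hx) (Real.exp_pos _).le hC)
    (mem_Ioi.2 (by linarith : y / 2 < y)) hsum (mem_Ioi.2 (by linarith : y / 2 < y))
  rwa [tsum_neg] at h

/-- Weighted means of a convergent sequence, when the total weight diverges. -/
theorem tendsto_seqLaplace_mul_div (h0 : ∀ k, 0 < u k) (hb : ∀ k, u k ≤ 1)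
    (hU : Tendsto (seqLaplace u) (𝓝[>] 0) atTop) {x : ℕ → ℝ} (hx : Tendsto x atTop (𝓝 δ)) :
    Tendsto (fun y => seqLaplace (fun k => x k * u k) y / seqLaplace u y) (𝓝[>] 0) (𝓝 δ) := by
  have hu : ∀ k, |u k| ≤ 1 := fun k => by rw [abs_of_pos (h0 k)]; exact hb k
  obtain ⟨C, hC⟩ : ∃ C, ∀ k, |x k| ≤ C := by
    obtain ⟨C, hC⟩ := hx.bddAbove_range
    obtain ⟨C', hC'⟩ := hx.bddBelow_range
    exact ⟨max C (-C'), fun k => abs_le.2 ⟨by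
      have := hC' ⟨k, rfl⟩; linarith [le_max_right C (-C')], (hC ⟨k, rfl⟩).trans (le_max_left _ _)⟩⟩
  have hC0 : 0 ≤ C := (abs_nonneg _).trans (hC 0)
  have hxu : ∀ k, |x k * u k| ≤ C := fun k => by
    rw [abs_mul]
    calc |x k| * |u k| ≤ C * 1 := mul_le_mul (hC k) (hu k) (abs_nonneg _) hC0
      _ = C := mul_one C
  rw [Metric.tendsto_nhds]
  intro ε hε
  obtain ⟨K, hK⟩ := Metric.tendsto_atTop.1 hx (ε / 2) (by positivity)
  filter_upwards [hU.eventually_gt_atTop ((C + |δ|) * K * (2 / ε)), hU.eventually_gt_atTop 0,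
    self_mem_nhdsWithin] with y hy hy0 hypos
  rw [mem_Ioi] at hypos
  have hs1 := summable_seqLaplace hxu hypos
  have hs2 := summable_seqLaplace hu hypos
  rw [Real.dist_eq, div_sub' hy0.ne', abs_div, abs_of_pos hy0, div_lt_iff₀ hy0]
  have e1 : seqLaplace (fun k => x k * u k) y - seqLaplace u y * δ =
      ∑' k : ℕ, (x k - δ) * (u k * Real.exp (-(y * k))) := by
    rw [seqLaplace, seqLaplace, ← tsum_mul_right, ← hs1.tsum_sub (hs2.mul_right δ)]
    exact tsum_congr fun k => by ring
  rw [e1]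
  -- the first `K` terms are bounded, the others are small compared with the total weight
  have hbound : ∀ k, |(x k - δ) * (u k * Real.exp (-(y * k)))| ≤
      (if k < K then C + |δ| else 0) + ε / 2 * (u k * Real.exp (-(y * k))) := by
    intro k
    have h1 : 0 ≤ u k * Real.exp (-(y * k)) := (mul_pos (h0 k) (Real.exp_pos _)).le
    rw [abs_mul, abs_of_nonneg h1]
    split_ifs with hk
    · have h2 : u k * Real.exp (-(y * k)) ≤ 1 := by
        have h3 : Real.exp (-(y * k)) ≤ 1 := Real.exp_le_one_iff.2 (by
          have := mul_nonneg hypos.le (Nat.cast_nonneg (α := ℝ) k); linarith)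
        calc u k * Real.exp (-(y * k)) ≤ 1 * 1 := mul_le_mul (hb k) h3 (Real.exp_pos _).le one_pos.le
          _ = 1 := one_mul 1
      have h4 : |x k - δ| ≤ C + |δ| := (abs_sub _ _).trans (add_le_add_left (hC k) _)
      have h5 : |x k - δ| * (u k * Real.exp (-(y * k))) ≤ (C + |δ|) * 1 :=
        mul_le_mul h4 h2 h1 (by positivity)
      have h6 : 0 ≤ ε / 2 * (u k * Real.exp (-(y * k))) := by positivity
      linarith
    · have h7 := hK k (not_lt.1 hk)
      rw [Real.dist_eq] at h7
      have := mul_le_mul_of_nonneg_right h7.le h1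
      linarith
  have hfin : HasSum (fun k => if k < K then C + |δ| else 0) ((C + |δ|) * K) := by
    have h1 : HasSum (fun k => if k < K then C + |δ| else 0)
        (∑ k ∈ Finset.range K, (if k < K then C + |δ| else 0)) :=
      hasSum_sum_of_ne_finset_zero (fun k hk => if_neg (by simpa using hk))
    have h2 : ∑ k ∈ Finset.range K, (if k < K then C + |δ| else 0) = (C + |δ|) * K := by
      rw [Finset.sum_congr rfl (fun k hk => if_pos (Finset.mem_range.1 hk))]
      rw [Finset.sum_const, Finset.card_range, nsmul_eq_mul, mul_comm]
    rwa [h2] at h1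
  have hsum := hfin.add (hs2.hasSum.mul_left (ε / 2))
  have h1 := tsum_of_norm_bounded (f := fun k : ℕ => (x k - δ) * (u k * Real.exp (-(y * k)))) hsum
    hbound
  rw [Real.norm_eq_abs] at h1
  refine h1.trans_lt ?_
  change _ + ε / 2 * seqLaplace u y < ε * seqLaplace u y
  have h2 : (C + |δ|) * K < ε / 2 * seqLaplace u y := by
    have := mul_lt_mul_of_pos_left hy (half_pos hε)
    calc (C + |δ|) * K = ε / 2 * ((C + |δ|) * K * (2 / ε)) := by field_simp
      _ < _ := this
  linarith

theorem tendsto_seqLaplace_atTop (h0 : ∀ k, 0 < u k) (hb : ∀ k, u k ≤ 1)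
    (hδ : δ < 1) (hx : Tendsto (fun k : ℕ => ((k : ℝ) + 1) * (1 - u (k + 1) / u k)) atTop (𝓝 δ)) :
    Tendsto (seqLaplace u) (𝓝[>] 0) atTop := by
  have hu : ∀ k, |u k| ≤ 1 := fun k => by rw [abs_of_pos (h0 k)]; exact hb k
  -- `k * u k` is eventually nondecreasing, so that `∑ u k` diverges like the harmonic series
  obtain ⟨K, hK⟩ := eventually_atTop.1 (hx.eventually_lt_const hδ)
  have hstep : ∀ k ≥ K, (k : ℝ) * u k ≤ ((k : ℝ) + 1) * u (k + 1) := by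
    intro k hk
    have h1 := hK k hk
    have h2 := h0 k
    have h3 : ((k : ℝ) + 1) * (1 - u (k + 1) / u k) * u k =
        ((k : ℝ) + 1) * u k - ((k : ℝ) + 1) * u (k + 1) := by field_simp
    nlinarith
  set K' := K + 1
  have hmono : ∀ k ≥ K', (K' : ℝ) * u K' ≤ k * u k := by
    intro k hk
    induction k, hk using Nat.le_induction with
    | base => exact le_rfl
    | succ k hk ih =>
      refine ih.trans ?_
      push_cast
      exact hstep k (by omega)
  have hns : ¬ Summable u := by
    intro hs
    have hc : 0 < (K' : ℝ) * u K' := mul_pos (by positivity) (h0 _)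
    have h1 : Summable fun k : ℕ => (1 : ℝ) / k := by
      have h2 : Summable fun k : ℕ => (K' * u K')⁻¹ * u k := hs.mul_left _
      refine Summable.of_norm_bounded_eventually_nat h2 ?_
      filter_upwards [eventually_ge_atTop K'] with k hk
      have hk0 : (0 : ℝ) < k := by
        have : 0 < k := by omega
        exact_mod_cast this
      rw [Real.norm_eq_abs, abs_of_pos (by positivity), div_le_iff₀ hk0, inv_mul_eq_div,
        div_mul_eq_mul_div, one_le_div hc]
      have := hmono k hk
      linarith
    exact Real.not_summable_one_div_natCast h1
  have hdiv := (not_summable_iff_tendsto_nat_atTop_of_nonneg (fun k => (h0 k).le)).1 hns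
  rw [tendsto_atTop]
  intro b
  obtain ⟨n, hn⟩ := (hdiv.eventually_gt_atTop b).exists
  have hcont : Tendsto (fun y : ℝ => ∑ k ∈ Finset.range n, u k * Real.exp (-(y * k))) (𝓝[>] 0)
      (𝓝 (∑ k ∈ Finset.range n, u k)) := by
    have h1 : Continuous fun y : ℝ => ∑ k ∈ Finset.range n, u k * Real.exp (-(y * k)) := by
      fun_prop
    have h2 := h1.tendsto 0
    simp only [zero_mul, neg_zero, Real.exp_zero, mul_one] at h2
    exact h2.mono_left nhdsWithin_le_nhds
  filter_upwards [hcont.eventually_const_lt hn, self_mem_nhdsWithin] with y hy hypos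
  exact hy.le.trans ((summable_seqLaplace hu (mem_Ioi.1 hypos)).sum_le_tsum _
    (fun k _ => (mul_pos (h0 k) (Real.exp_pos _)).le))

/-- If `u (k + 1) / u k = 1 - (δ + o(1)) / k` with `δ < 1`, then `(1 - e^{-y}) ∑ u k e^{-yk}` is
regularly varying of index `δ` at zero. -/
theorem tendsto_one_sub_exp_mul_seqLaplace (h0 : ∀ k, 0 < u k) (hb : ∀ k, u k ≤ 1) (hu0 : u 0 = 1)
    (hδ : δ < 1) (hx : Tendsto (fun k : ℕ => ((k : ℝ) + 1) * (1 - u (k + 1) / u k)) atTop (𝓝 δ))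
    {r : ℝ} (hr : 0 < r) :
    Tendsto (fun y => ((1 - Real.exp (-((1 + r) * y))) * seqLaplace u ((1 + r) * y)) /
      ((1 - Real.exp (-y)) * seqLaplace u y)) (𝓝[>] 0) (𝓝 ((1 + r) ^ δ)) := by
  have hu : ∀ k, |u k| ≤ 1 := fun k => by rw [abs_of_pos (h0 k)]; exact hb k
  have hU := tendsto_seqLaplace_atTop h0 hb hδ hx
  set x : ℕ → ℝ := fun k => ((k : ℝ) + 1) * (1 - u (k + 1) / u k) with hxdef
  set V : ℝ → ℝ := fun y => (1 - Real.exp (-y)) * seqLaplace u y with hV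
  have hxu : ∀ k : ℕ, ((k : ℝ) + 1) * (u k - u (k + 1)) = x k * u k := fun k => by
    have := (h0 k).ne'
    simp only [hxdef]
    field_simp
  obtain ⟨C, hC⟩ : ∃ C, ∀ k, |x k| ≤ C := by
    obtain ⟨C, hC⟩ := hx.bddAbove_range
    obtain ⟨C', hC'⟩ := hx.bddBelow_range
    exact ⟨max C (-C'), fun k => abs_le.2 ⟨by
      have := hC' ⟨k, rfl⟩; linarith [le_max_right C (-C')], (hC ⟨k, rfl⟩).trans (le_max_left _ _)⟩⟩
  have hC0 : 0 ≤ C := (abs_nonneg _).trans (hC 0)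
  have hbd : ∀ k : ℕ, |((k : ℝ) + 1) * (u k - u (k + 1))| ≤ C := fun k => by
    rw [hxu, abs_mul]
    calc |x k| * |u k| ≤ C * 1 := mul_le_mul (hC k) (hu k) (abs_nonneg _) hC0
      _ = C := mul_one C
  have hVpos : ∀ y, 0 < y → 0 < V y := fun y hy =>
    mul_pos (by have := Real.exp_lt_one_iff.2 (show -y < 0 by linarith); linarith)
      (seqLaplace_pos hu (fun k => (h0 k).le) (h0 0) hy)
  have hVeq : ∀ y, 0 < y →
      V y = 1 - ∑' k : ℕ, (u k - u (k + 1)) * Real.exp (-(y * (k + 1))) := by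
    intro y hy
    have hs := summable_seqLaplace hu hy
    have hs1 : Summable fun k : ℕ => u (k + 1) * Real.exp (-(y * (k + 1))) := by
      have := (summable_nat_add_iff 1).2 hs
      simpa using this
    have hs2 : Summable fun k : ℕ => u k * Real.exp (-(y * (k + 1))) := by
      refine (hs.mul_left (Real.exp (-y))).congr fun k => ?_
      have : Real.exp (-(y * (k + 1))) = Real.exp (-y) * Real.exp (-(y * k)) := by
        rw [← Real.exp_add]; ring_nf
      rw [this]; ring
    have e1 : seqLaplace u y = 1 + ∑' k : ℕ, u (k + 1) * Real.exp (-(y * (k + 1))) := by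
      rw [seqLaplace, hs.tsum_eq_zero_add]
      simp [hu0]
    have e2 : Real.exp (-y) * seqLaplace u y = ∑' k : ℕ, u k * Real.exp (-(y * (k + 1))) := by
      rw [seqLaplace, ← tsum_mul_left]
      refine tsum_congr fun k => ?_
      have : Real.exp (-(y * (k + 1))) = Real.exp (-y) * Real.exp (-(y * k)) := by
        rw [← Real.exp_add]; ring_nf
      rw [this]; ring
    have e3 : ∑' k : ℕ, (u k - u (k + 1)) * Real.exp (-(y * (k + 1))) =
        Real.exp (-y) * seqLaplace u y - (seqLaplace u y - 1) := by
      rw [e2, e1, add_sub_cancel_left, ← hs2.tsum_sub hs1]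
      exact tsum_congr fun k => by ring
    rw [e3, hV]; ring
  set V' : ℝ → ℝ := fun y => Real.exp (-y) * seqLaplace (fun k => x k * u k) y with hV'
  have hVd : ∀ y, 0 < y → HasDerivAt V (V' y) y := by
    intro y hy
    have h1 := (hasDerivAt_seqLaplace_shift hbd hy).const_sub 1
    rw [neg_neg] at h1
    have h2 : ∑' k : ℕ, ((k : ℝ) + 1) * (u k - u (k + 1)) * Real.exp (-(y * (k + 1))) = V' y := by
      simp only [hV']
      rw [seqLaplace, ← tsum_mul_left]
      refine tsum_congr fun k => ?_
      have : Real.exp (-(y * (k + 1))) = Real.exp (-y) * Real.exp (-(y * k)) := by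
        rw [← Real.exp_add]; ring_nf
      rw [this, hxu]; ring
    rw [h2] at h1
    refine h1.congr_of_eventuallyEq ?_
    filter_upwards [Ioi_mem_nhds hy] with z hz
    exact hVeq z hz
  -- the elasticity of `V` tends to `δ`
  have hel : Tendsto (fun y => y * (V' y / V y)) (𝓝[>] 0) (𝓝 δ) := by
    have h1 := tendsto_seqLaplace_mul_div h0 hb hU hx
    have h2 : Tendsto (fun y : ℝ => y * Real.exp (-y) / (1 - Real.exp (-y))) (𝓝[>] 0) (𝓝 1) := by
      have hd : HasDerivAt (fun y : ℝ => Real.exp y) 1 0 := by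
        simpa using Real.hasDerivAt_exp 0
      have h3 := hd.tendsto_slope_zero
      simp only [zero_add, Real.exp_zero, smul_eq_mul] at h3
      have h4 := (h3.inv₀ one_ne_zero).mono_left
        (nhdsWithin_mono (s := Ioi 0) 0 fun z hz => (mem_Ioi.1 hz).ne')
      rw [inv_one] at h4
      refine h4.congr' ?_
      filter_upwards [self_mem_nhdsWithin] with y hy
      rw [mem_Ioi] at hy
      have h5 : Real.exp y - 1 ≠ 0 := by
        have := Real.one_lt_exp_iff.2 hy; linarith
      have h6 : 1 - Real.exp (-y) = (Real.exp y - 1) * Real.exp (-y) := by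
        rw [sub_mul, ← Real.exp_add]; simp
      rw [h6, mul_inv, inv_inv, mul_div_mul_right _ _ (Real.exp_pos _).ne', div_eq_mul_inv]
    have h3 := h2.mul h1
    rw [one_mul] at h3
    refine h3.congr fun y => ?_
    rw [hV', hV, div_mul_div_comm, mul_div_assoc', mul_assoc]
  -- mean value theorem for `log V` against `log`
  have hlogr : 0 < Real.log (1 + r) := Real.log_pos (by linarith)
  have hlog : Tendsto (fun y => Real.log (V ((1 + r) * y)) - Real.log (V y)) (𝓝[>] 0)
      (𝓝 (δ * Real.log (1 + r))) := by
    rw [Metric.tendsto_nhds]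
    intro ε hε
    have h1 := (Metric.tendsto_nhds.1 hel) (ε / Real.log (1 + r)) (by positivity)
    obtain ⟨η, hη, h2⟩ := mem_nhdsGT_iff_exists_Ioo_subset.1 h1
    rw [mem_Ioi] at hη
    filter_upwards [Ioo_mem_nhdsGT (show 0 < η / (1 + r) by positivity)] with y hy
    have hy0 := hy.1
    have hyr : (1 + r) * y < η := by
      have := (lt_div_iff₀ (by linarith : 0 < 1 + r)).1 hy.2; linarith
    have hlt : y < (1 + r) * y := by nlinarith
    obtain ⟨ξ, hξ, hmv⟩ := exists_ratio_hasDerivAt_eq_ratio_slope' (fun z => Real.log (V z))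
      (fun z => V' z / V z) hlt (fun z => Real.log z) (fun z => z⁻¹)
      (lfa := Real.log (V y)) (lga := Real.log y) (lfb := Real.log (V ((1 + r) * y)))
      (lgb := Real.log ((1 + r) * y))
      (fun z hz => (hVd z (hy0.trans hz.1)).log (hVpos z (hy0.trans hz.1)).ne')
      (fun z hz => Real.hasDerivAt_log (hy0.trans hz.1).ne')
      (((hVd y hy0).log (hVpos y hy0).ne').continuousAt.tendsto.mono_left nhdsWithin_le_nhds)
      ((Real.hasDerivAt_log hy0.ne').continuousAt.tendsto.mono_left nhdsWithin_le_nhds)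
      (((hVd _ (hy0.trans hlt)).log (hVpos _ (hy0.trans hlt)).ne').continuousAt.tendsto.mono_left
        nhdsWithin_le_nhds)
      ((Real.hasDerivAt_log (hy0.trans hlt).ne').continuousAt.tendsto.mono_left nhdsWithin_le_nhds)
    have hξ0 : 0 < ξ := hy0.trans hξ.1
    have h3 : Real.log (V ((1 + r) * y)) - Real.log (V y) =
        Real.log (1 + r) * (ξ * (V' ξ / V ξ)) := by
      rw [Real.log_mul (by linarith) hy0.ne', add_sub_cancel_right] at hmv
      field_simp at hmv ⊢
      linarith
    have h4 : dist (ξ * (V' ξ / V ξ)) δ < ε / Real.log (1 + r) := h2 ⟨hξ0, hξ.2.trans hyr⟩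
    rw [Real.dist_eq] at h4 ⊢
    rw [h3, mul_comm δ, ← mul_sub, abs_mul, abs_of_pos hlogr]
    calc _ < Real.log (1 + r) * (ε / Real.log (1 + r)) := mul_lt_mul_of_pos_left h4 hlogr
      _ = ε := by field_simp
  have h5 := (Real.continuous_exp.tendsto _).comp hlog
  rw [mul_comm δ, ← Real.rpow_def_of_pos (by linarith)] at h5
  refine h5.congr' ?_
  filter_upwards [self_mem_nhdsWithin] with y hy
  rw [mem_Ioi] at hy
  have hy' : 0 < (1 + r) * y := mul_pos (by linarith) hy
  rw [Function.comp_apply, Real.exp_sub, Real.exp_log (hVpos _ hy'), Real.exp_log (hVpos _ hy)]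

/-- The tail sequence `F` of a renewal sequence `u`, that is, `∑_{k ≤ m} F k u (m - k) = 1` for
all `m`, has a regularly varying Laplace transform. -/
theorem tendsto_seqLaplace_tail {F : ℕ → ℝ} (h0 : ∀ k, 0 < u k) (hb : ∀ k, u k ≤ 1) (hu0 : u 0 = 1)
    (hδ : δ < 1) (hx : Tendsto (fun k : ℕ => ((k : ℝ) + 1) * (1 - u (k + 1) / u k)) atTop (𝓝 δ))
    (hF : ∀ k, |F k| ≤ 1)
    (hren : ∀ m, ∑ k ∈ Finset.range (m + 1), F k * u (m - k) = 1) {r : ℝ} (hr : 0 ≤ r) :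
    Tendsto (fun m : ℕ => seqLaplace F ((1 + r) * (1 / (m + 1 : ℕ))) /
      seqLaplace F (1 / (m + 1 : ℕ))) atTop (𝓝 ((1 + r) ^ (-δ))) := by
  have hu : ∀ k, |u k| ≤ 1 := fun k => by rw [abs_of_pos (h0 k)]; exact hb k
  have key : ∀ y, 0 < y → seqLaplace F y = ((1 - Real.exp (-y)) * seqLaplace u y)⁻¹ := by
    intro y hy
    have h1 := tsum_mul_tsum_eq_tsum_sum_range_of_summable_norm
      (summable_seqLaplace hF hy).norm (summable_seqLaplace hu hy).norm
    have hlt : Real.exp (-y) < 1 := Real.exp_lt_one_iff.2 (by linarith)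
    have h2 : ∀ n, ∑ k ∈ Finset.range (n + 1), F k * Real.exp (-(y * k)) *
        (u (n - k) * Real.exp (-(y * (n - k : ℕ)))) = Real.exp (-y) ^ n := by
      intro n
      rw [← one_mul (Real.exp (-y) ^ n), ← hren n, Finset.sum_mul]
      refine Finset.sum_congr rfl fun k hk => ?_
      have hk' : k ≤ n := Nat.lt_succ_iff.1 (Finset.mem_range.1 hk)
      have h3 : Real.exp (-y) ^ n = Real.exp (-(y * k)) * Real.exp (-(y * (n - k : ℕ))) := by
        rw [← Real.exp_nat_mul, ← Real.exp_add, Nat.cast_sub hk']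
        ring_nf
      rw [h3]; ring
    rw [tsum_congr h2, tsum_geometric_of_lt_one (Real.exp_pos _).le hlt] at h1
    have h4 := (seqLaplace_pos hu (fun k => (h0 k).le) (h0 0) hy).ne'
    change seqLaplace F y * seqLaplace u y = _ at h1
    rw [mul_inv, ← h1, mul_assoc, mul_inv_cancel₀ h4, mul_one]
  have hy : ∀ m : ℕ, (0 : ℝ) < 1 / (m + 1 : ℕ) := fun m => by positivity
  rcases hr.eq_or_lt with rfl | hr
  · simp only [add_zero, one_mul, Real.one_rpow]
    refine tendsto_const_nhds.congr fun m => (div_self ?_).symm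
    rw [key _ (hy m)]
    have hlt : Real.exp (-(1 / ((m + 1 : ℕ) : ℝ))) < 1 := Real.exp_lt_one_iff.2 (by
      linarith [hy m])
    have h4 := (seqLaplace_pos hu (fun k => (h0 k).le) (h0 0) (hy m))
    exact inv_ne_zero (mul_pos (by linarith) h4).ne'
  · have h1 := (tendsto_one_sub_exp_mul_seqLaplace h0 hb hu0 hδ hx hr).inv₀
      (Real.rpow_pos_of_pos (by linarith) _).ne'
    rw [← Real.rpow_neg (by linarith)] at h1
    have h2 : Tendsto (fun m : ℕ => 1 / ((m + 1 : ℕ) : ℝ)) atTop (𝓝[>] 0) := by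
      refine tendsto_nhdsWithin_iff.2 ⟨?_, Eventually.of_forall hy⟩
      exact_mod_cast tendsto_one_div_add_atTop_nhds_zero_nat (𝕜 := ℝ)
    refine (h1.comp h2).congr fun m => ?_
    rw [Function.comp_apply, key _ (hy m), key _ (mul_pos (by linarith) (hy m)), inv_div,
      inv_div_inv]

end RegularVariation

end BGWI

/-! ### The limit of the conditional Laplace transforms -/

namespace BGWI

/-- The integral by which the exponent `δ` disappears from the limit law: the integrand is
the derivative of an elementary function. -/
theorem integral_linnik_kernel {A δ : ℝ} (hA : 0 < A) (hδ : 0 < δ) :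
    ∫ x in (0 : ℝ)..1, δ * A * (1 + A * max (1 - x) 0) ^ (-(δ + 1)) * x ^ (δ - 1) =
      A / (1 + A) := by
  set G : ℝ → ℝ := fun x => A / (1 + A) * (x / (1 + A * (1 - x))) ^ δ with hG
  have hD : ∀ x ∈ Icc (0 : ℝ) 1, 0 < 1 + A * (1 - x) := fun x hx => by
    have := mul_nonneg hA.le (sub_nonneg.2 hx.2); linarith
  have h := intervalIntegral.integral_eq_sub_of_hasDerivAt_of_le (f := G)
    (f' := fun x => δ * A * (1 + A * max (1 - x) 0) ^ (-(δ + 1)) * x ^ (δ - 1))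
    zero_le_one ?_ ?_ ?_
  · rw [h, hG]
    simp [Real.zero_rpow hδ.ne']
  · refine ContinuousOn.mul continuousOn_const (ContinuousOn.rpow_const ?_ fun x _ => Or.inr hδ.le)
    exact continuousOn_id.div (by fun_prop) fun x hx => (hD x hx).ne'
  · intro x hx
    have hDx := hD x ⟨hx.1.le, hx.2.le⟩
    have h1 : HasDerivAt (fun x : ℝ => 1 + A * (1 - x)) (A * (-1)) x :=
      (((hasDerivAt_id x).const_sub 1).const_mul A).const_add 1
    have h2 := (hasDerivAt_id x).div h1 hDx.ne'
    have h3 := (h2.rpow_const (p := δ) (Or.inl (div_pos hx.1 hDx).ne')).const_mul (A / (1 + A))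
    convert! h3 using 1
    simp only [id_eq, Pi.div_apply]
    rw [max_eq_left (by linarith [hx.2]), Real.div_rpow hx.1.le hDx.le, Real.rpow_neg hDx.le,
      Real.rpow_add hDx, Real.rpow_sub hDx, Real.rpow_one]
    have h4 := (Real.rpow_pos_of_pos hDx δ).ne'
    have h5 := hDx.ne'
    have h6 : (1 + A) ≠ 0 := by positivity
    field_simp
    ring
  · refine (intervalIntegral.intervalIntegrable_rpow' (by linarith)).continuousOn_mul ?_
    refine Continuous.continuousOn (continuous_const.mul ?_)
    refine Continuous.rpow_const (by fun_prop) fun x => Or.inl ?_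
    have := mul_nonneg hA.le (le_max_right (1 - x) 0)
    positivity

theorem abs_rpow_neg_sub_le {p x y : ℝ} (hp : 0 ≤ p) (hx : 1 ≤ x) (hy : 1 ≤ y) :
    |x ^ (-p) - y ^ (-p)| ≤ p * |x - y| := by
  have h := Convex.norm_image_sub_le_of_norm_hasDerivWithin_le (s := Ici (1 : ℝ))
    (f := fun t => t ^ (-p)) (f' := fun t => -p * t ^ (-p - 1)) (C := p)
    (fun t ht => (Real.hasDerivAt_rpow_const
      (Or.inl (zero_lt_one.trans_le (mem_Ici.1 ht)).ne')).hasDerivWithinAt)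
    (fun t ht => by
      have ht1 := mem_Ici.1 ht
      rw [norm_mul, norm_neg, Real.norm_eq_abs, abs_of_nonneg hp, Real.norm_eq_abs,
        abs_of_pos (Real.rpow_pos_of_pos (by linarith) _)]
      exact mul_le_of_le_one_right hp (Real.rpow_le_one_of_one_le_of_nonpos ht1 (by linarith)))
    (convex_Ici 1) (mem_Ici.2 hy) (mem_Ici.2 hx)
  simpa [Real.norm_eq_abs] using h

variable {μ ν : PMF ℕ} {α c d : ℝ} {ℓ k : ℝ → ℝ}

theorem step_mem_Icc {q : ℝ} (h0 : 0 ≤ q) (h1 : q ≤ 1) : 0 ≤ step μ q ∧ step μ q ≤ 1 := by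
  have h2 := genFun_nonneg μ (s := 1 - q) (by linarith)
  have h3 := genFun_le_one μ (s := 1 - q) (by linarith) (by linarith)
  unfold step
  constructor <;> linarith

/-- Summation by parts of the first-return decomposition: the generating functions `v m` on the
event of no return to zero, in terms of their values `v m 0` at `q = 0` and of the
unrestricted generating functions. -/
theorem killed_eq {v : ℕ → ℝ → ℝ} (hv0 : ∀ q ∈ Icc (0 : ℝ) 1, v 0 q = 1)
    (hrec : ∀ m, ∀ q ∈ Icc (0 : ℝ) 1,
      v (m + 1) q = genFun ν (1 - q) * v m (step μ q) - (v m 0 - v (m + 1) 0)) (m : ℕ) :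
    ∀ q ∈ Icc (0 : ℝ) 1, v m q = v m 0 - ∑ j ∈ Finset.range m, v j 0 *
      (genProd μ ν (m - 1 - j) q - genProd μ ν (m - j) q) := by
  induction m with
  | zero => intro q hq; simp [hv0 q hq, hv0 0 ⟨le_rfl, zero_le_one⟩]
  | succ m ih =>
    intro q hq
    rw [hrec m q hq, ih _ (step_mem_Icc hq.1 hq.2), Finset.sum_range_succ]
    have h1 : ∑ j ∈ Finset.range m, v j 0 *
        (genProd μ ν (m + 1 - 1 - j) q - genProd μ ν (m + 1 - j) q) =
        genFun ν (1 - q) * ∑ j ∈ Finset.range m, v j 0 *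
          (genProd μ ν (m - 1 - j) (step μ q) - genProd μ ν (m - j) (step μ q)) := by
      rw [Finset.mul_sum]
      refine Finset.sum_congr rfl fun j hj => ?_
      have hj' := Finset.mem_range.1 hj
      have e1 : m + 1 - 1 - j = (m - 1 - j) + 1 := by omega
      have e2 : m + 1 - j = (m - j) + 1 := by omega
      rw [e1, e2, genProd_succ', genProd_succ']
      ring
    have e3 : m + 1 - 1 - m = 0 := by omega
    have e4 : m + 1 - m = 0 + 1 := by omega
    rw [h1, e3, e4, genProd_succ']
    simp only [genProd, Finset.range_zero, Finset.prod_empty]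
    ring

/-- The last-exit decomposition `∑_{k ≤ m} P(T > k) P(Z₁(m - k) = 0) = 1`. -/
theorem renewal_identity {v : ℕ → ℝ → ℝ} (hv0 : ∀ q ∈ Icc (0 : ℝ) 1, v 0 q = 1)
    (hrec : ∀ m, ∀ q ∈ Icc (0 : ℝ) 1,
      v (m + 1) q = genFun ν (1 - q) * v m (step μ q) - (v m 0 - v (m + 1) 0))
    (hv1 : ∀ m, v (m + 1) 1 = 0) (m : ℕ) :
    ∑ j ∈ Finset.range (m + 1), v j 0 * genProd μ ν (m - j) 1 = 1 := by
  induction m with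
  | zero => simp [genProd, hv0 0 ⟨le_rfl, zero_le_one⟩]
  | succ m ih =>
    have h := killed_eq hv0 hrec (m + 1) 1 ⟨zero_le_one, le_rfl⟩
    rw [hv1] at h
    have h1 : ∑ j ∈ Finset.range (m + 1), v j 0 *
        (genProd μ ν (m + 1 - 1 - j) 1 - genProd μ ν (m + 1 - j) 1) =
        ∑ j ∈ Finset.range (m + 1), v j 0 * genProd μ ν (m - j) 1 -
        ∑ j ∈ Finset.range (m + 1), v j 0 * genProd μ ν (m + 1 - j) 1 := by
      rw [← Finset.sum_sub_distrib]
      refine Finset.sum_congr rfl fun j _ => ?_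
      rw [Nat.add_sub_cancel, mul_sub]
    rw [h1, ih] at h
    rw [Finset.sum_range_succ, Nat.sub_self]
    simp only [genProd, Finset.range_zero, Finset.prod_empty, mul_one] at h ⊢
    linarith

/-- The asymptotics of `N (h_j - h_{j+1})` along the scaling `N β(q) → θ`. The index `j < N` may
depend arbitrarily on `n`, which makes the statement uniform in `j`. -/
theorem tendsto_genProd_mul (hSL : SL μ ν α c d ℓ k) (hν : 0 < ν 0)
    {q : ℕ → ℝ} (hq : Tendsto q atTop (𝓝[>] 0)) {N : ℕ → ℕ} {θ : ℝ}
    (hθ : Tendsto (fun n => N n * rate μ (q n)) atTop (𝓝 θ)) (hθ0 : 0 < θ)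
    {j : ℕ → ℕ} (hj : ∀ᶠ n in atTop, j n < N n) :
    Tendsto (fun n => N n * (genProd μ ν (j n) (q n) *
      (1 - genFun ν (1 - (step μ)^[j n] (q n)))) -
      d / (α * c) * (α * θ) * (1 + α * θ * (j n / N n)) ^ (-(d / (α * c) + 1))) atTop (𝓝 0) := by
  have hα := hSL.alpha_pos
  have hc := hSL.c_pos
  have hd := hSL.d_pos
  set δ := d / (α * c) with hδ
  have hδ0 : 0 < δ := by positivity
  have hq01 : ∀ᶠ n in atTop, q n ∈ Ioo (0 : ℝ) 1 := by
    have h1 := hq.eventually (eventually_Ioo 1 one_pos)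
    simpa using h1
  set o : ℕ → ℝ := fun n => (step μ)^[j n] (q n) with ho
  set z : ℕ → ℝ := fun n => rate μ (q n) / rate μ (o n) with hz
  have hN : ∀ᶠ n in atTop, (j n : ℝ) * rate μ (q n) ≤ θ + 1 := by
    filter_upwards [hj, hq01, hθ.eventually_le_const (show θ < θ + 1 by linarith)] with n h1 h2 h3
    refine le_trans (mul_le_mul_of_nonneg_right ?_ (rate_pos hSL h2.1 h2.2.le).le) h3
    exact_mod_cast h1.le
  have hoq : Tendsto o atTop (𝓝[>] 0) := by
    refine tendsto_nhdsWithin_iff.2 ⟨?_, ?_⟩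
    · refine tendsto_of_tendsto_of_tendsto_of_le_of_le' tendsto_const_nhds
        (hq.mono_right nhdsWithin_le_nhds) ?_ ?_
      · filter_upwards [hq01] with n h2 using (orbit_mem hSL h2.1 h2.2.le _).1.le
      · filter_upwards [hq01] with n h2 using (orbit_mem hSL h2.1 h2.2.le _).2
    · filter_upwards [hq01] with n h2 using (orbit_mem hSL h2.1 h2.2.le _).1
  have hsmall : ∀ η : ℝ, 0 < η → ∀ᶠ n in atTop, q n ∈ Ioo 0 η := fun η hη =>
    hq.eventually (Ioo_mem_nhdsGT hη)
  -- first order: `z = 1 + α j β(q) + o(1)`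
  have hz1 : Tendsto (fun n => z n - (1 + α * (j n * rate μ (q n)))) atTop (𝓝 0) := by
    rw [Metric.tendsto_nhds]
    intro ε hε
    obtain ⟨η, hη, h⟩ := exists_inv_rate_orbit hSL (ε := ε / (2 * (θ + 1))) (by positivity)
    filter_upwards [hsmall η hη.1, hN, hq01] with n h1 h2 h3
    have h4 := h (q n) h1 (j n)
    have hr := rate_pos hSL h3.1 h3.2.le
    have e : z n - (1 + α * (j n * rate μ (q n))) =
        (1 / rate μ (o n) - 1 / rate μ (q n) - α * j n) * rate μ (q n) := by
      have := hr.ne'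
      simp only [hz]
      field_simp
      ring
    rw [Real.dist_eq, sub_zero, e, abs_mul, abs_of_pos hr]
    calc _ ≤ ε / (2 * (θ + 1)) * j n * rate μ (q n) := mul_le_mul_of_nonneg_right h4 hr.le
      _ = ε / (2 * (θ + 1)) * (j n * rate μ (q n)) := by ring
      _ ≤ ε / (2 * (θ + 1)) * (θ + 1) := mul_le_mul_of_nonneg_left h2 (by positivity)
      _ = ε / 2 := by field_simp
      _ < ε := by linarith
  have hz2 : Tendsto (fun n => α * (j n * rate μ (q n)) - α * θ * (j n / N n)) atTop (𝓝 0) := by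
    have h1 : Tendsto (fun n => α * |N n * rate μ (q n) - θ|) atTop (𝓝 0) := by
      have := ((hθ.sub_const θ).abs).const_mul α
      simpa using this
    refine squeeze_zero_norm' ?_ h1
    filter_upwards [hj] with n h2
    have hN0 : (0 : ℝ) < N n := by
      have : 0 < N n := by omega
      exact_mod_cast this
    have e : α * (j n * rate μ (q n)) - α * θ * (j n / N n) =
        (j n / N n) * (α * (N n * rate μ (q n) - θ)) := by field_simp
    have h3 : (j n : ℝ) / N n ≤ 1 := by
      rw [div_le_one hN0]; exact_mod_cast h2.le
    rw [e, Real.norm_eq_abs, abs_mul, abs_mul, abs_of_pos hα, abs_of_nonneg (by positivity)]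
    exact mul_le_of_le_one_left (by positivity) h3
  have hz3 : Tendsto (fun n => z n - (1 + α * θ * (j n / N n))) atTop (𝓝 0) := by
    have := hz1.add hz2
    rw [add_zero] at this
    exact this.congr fun n => by ring
  have hz4 : ∀ᶠ n in atTop, 1 ≤ z n := by
    filter_upwards [hq01] with n h1
    have h2 := orbit_mem hSL h1.1 h1.2.le (j n)
    rw [hz]
    exact (one_le_div (rate_pos hSL h2.1 (h2.2.trans h1.2.le))).2 (rate_mono μ h2.1 h2.2 h1.2.le)
  have hpow : Tendsto (fun n => z n ^ (-(δ + 1)) - (1 + α * θ * (j n / N n)) ^ (-(δ + 1))) atTop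
      (𝓝 0) := by
    have h1 : Tendsto (fun n => (δ + 1) * |z n - (1 + α * θ * (j n / N n))|) atTop (𝓝 0) := by
      simpa using hz3.abs.const_mul (δ + 1)
    refine squeeze_zero_norm' ?_ h1
    filter_upwards [hz4] with n h2
    refine abs_rpow_neg_sub_le (by positivity) h2 ?_
    have : 0 ≤ α * θ * ((j n : ℝ) / N n) := by positivity
    linarith
  have hh : Tendsto (fun n => genProd μ ν (j n) (q n) * z n ^ δ) atTop (𝓝 1) := by
    have h0 : Tendsto (fun n => Real.log (genProd μ ν (j n) (q n)) + δ * Real.log (z n)) atTop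
        (𝓝 0) := by
      rw [Metric.tendsto_nhds]
      intro ε hε
      obtain ⟨η, hη, h⟩ := exists_log_genProd hSL hν (ε := ε / (2 * (θ + 1))) (by positivity)
      filter_upwards [hsmall η hη.1, hN] with n h1 h2
      rw [Real.dist_eq, sub_zero]
      calc _ ≤ ε / (2 * (θ + 1)) * (j n * rate μ (q n)) := h (q n) h1 (j n)
        _ ≤ ε / (2 * (θ + 1)) * (θ + 1) := mul_le_mul_of_nonneg_left h2 (by positivity)
        _ = ε / 2 := by field_simp
        _ < ε := by linarith
    have h1 := (Real.continuous_exp.tendsto 0).comp h0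
    rw [Real.exp_zero] at h1
    refine h1.congr' ?_
    filter_upwards [hq01, hz4] with n h2 h3
    have hz0 : 0 < z n := by linarith
    rw [Function.comp_apply, Real.exp_add, Real.exp_log (genProd_pos hSL hν h2.1 h2.2.le _),
      mul_comm δ, ← Real.rpow_def_of_pos hz0]
  have hγ : Tendsto (fun n => (1 - genFun ν (1 - o n)) / rate μ (o n)) atTop (𝓝 (d / c)) :=
    (tendsto_one_sub_genFun_div hSL).comp hoq
  have hX := (hh.mul hγ).mul hθ
  have e0 : 1 * (d / c) * θ = δ * (α * θ) := by rw [hδ]; field_simp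
  rw [e0] at hX
  -- split the difference into two terms that tend to zero
  have h1 : Tendsto (fun n => (genProd μ ν (j n) (q n) * z n ^ δ *
      ((1 - genFun ν (1 - o n)) / rate μ (o n)) * (N n * rate μ (q n)) - δ * (α * θ)) *
      z n ^ (-(δ + 1))) atTop (𝓝 0) := by
    have h2 := (hX.sub_const (δ * (α * θ))).abs
    rw [sub_self, abs_zero] at h2
    refine squeeze_zero_norm' ?_ h2
    filter_upwards [hz4] with n h3
    rw [norm_mul, Real.norm_eq_abs, Real.norm_eq_abs,
      abs_of_pos (Real.rpow_pos_of_pos (by linarith) _)]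
    exact mul_le_of_le_one_right (abs_nonneg _)
      (Real.rpow_le_one_of_one_le_of_nonpos h3 (by linarith))
  have h2 := h1.add (hpow.const_mul (δ * (α * θ)))
  rw [mul_zero, add_zero] at h2
  refine h2.congr' ?_
  filter_upwards [hq01, hz4] with n h3 h4
  have hz0 : 0 < z n := by linarith
  have h5 := orbit_mem hSL h3.1 h3.2.le (j n)
  have hr := (rate_pos hSL h3.1 h3.2.le).ne'
  have hr' := (rate_pos hSL h5.1 (h5.2.trans h3.2.le)).ne'
  have e1 : z n ^ δ * z n ^ (-(δ + 1)) * (rate μ (q n) / rate μ (o n)) = 1 := by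
    rw [← Real.rpow_add hz0]
    have : δ + -(δ + 1) = -1 := by ring
    rw [this, Real.rpow_neg_one]
    exact inv_mul_cancel₀ hz0.ne'
  have e2 : genProd μ ν (j n) (q n) * z n ^ δ *
      ((1 - genFun ν (1 - o n)) / rate μ (o n)) * (N n * rate μ (q n)) * z n ^ (-(δ + 1)) =
      N n * (genProd μ ν (j n) (q n) * (1 - genFun ν (1 - o n))) *
      (z n ^ δ * z n ^ (-(δ + 1)) * (rate μ (q n) / rate μ (o n))) := by
    field_simp
  rw [e1, mul_one] at e2
  rw [sub_mul, e2]
  ring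

/-- Uniformly small errors do not contribute to the weighted sums. -/
theorem tendsto_weighted_error {F : ℕ → ℝ} (h0 : ∀ k, 0 ≤ F k) {N : ℕ → ℕ}
    (hN : Tendsto N atTop atTop) {C : ℝ}
    (hC : Tendsto (fun m : ℕ => (∑ k ∈ Finset.range m, F k) / (m * F m)) atTop (𝓝 C))
    {e : ℕ → ℕ → ℝ}
    (he : ∀ j : ℕ → ℕ, (∀ᶠ n in atTop, j n < N n) → Tendsto (fun n => e n (j n)) atTop (𝓝 0)) :
    Tendsto (fun n => (∑ k ∈ Finset.range (N n), F k * e n k) / (N n * F (N n))) atTop (𝓝 0) := by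
  have hex : ∀ n, ∃ j, 0 < N n → j < N n ∧ ∀ k < N n, |e n k| ≤ |e n j| := by
    intro n
    by_cases hn : 0 < N n
    · obtain ⟨j, hj, hmax⟩ := Finset.exists_max_image (Finset.range (N n)) (fun k => |e n k|)
        ⟨0, Finset.mem_range.2 hn⟩
      exact ⟨j, fun _ => ⟨Finset.mem_range.1 hj, fun k hk => hmax k (Finset.mem_range.2 hk)⟩⟩
    · exact ⟨0, fun h => absurd h hn⟩
  choose j hj using hex
  have hpos : ∀ᶠ n in atTop, 0 < N n := hN.eventually_gt_atTop 0
  have h1 := he j (hpos.mono fun n hn => (hj n hn).1)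
  have h2 := h1.abs.mul (hC.comp hN)
  rw [abs_zero, zero_mul] at h2
  refine squeeze_zero_norm' ?_ h2
  filter_upwards [hpos] with n hn
  have h3 : 0 ≤ (N n : ℝ) * F (N n) := mul_nonneg (Nat.cast_nonneg _) (h0 _)
  rw [Function.comp_apply, Real.norm_eq_abs, abs_div, abs_of_nonneg h3, mul_div_assoc']
  refine div_le_div_of_nonneg_right ?_ h3
  refine (Finset.abs_sum_le_sum_abs _ _).trans ?_
  rw [Finset.mul_sum]
  refine Finset.sum_le_sum fun k hk => ?_
  rw [abs_mul, abs_of_nonneg (h0 k), mul_comm]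
  exact mul_le_mul_of_nonneg_right ((hj n hn).2 k (Finset.mem_range.1 hk)) (h0 k)

/-- The limit of the Laplace transforms conditioned on no return to zero, for any sequence of
functions `v m` that satisfies the branching recursion. -/
theorem tendsto_killed_ratio (hSL : SL μ ν α c d ℓ k) (hν : 0 < ν 0)
    (hδ : d / (α * c) ∈ Ioo (0 : ℝ) 1) {v : ℕ → ℝ → ℝ}
    (hv0 : ∀ q ∈ Icc (0 : ℝ) 1, v 0 q = 1)
    (hrec : ∀ m, ∀ q ∈ Icc (0 : ℝ) 1,
      v (m + 1) q = genFun ν (1 - q) * v m (step μ q) - (v m 0 - v (m + 1) 0))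
    (hv1 : ∀ m, v (m + 1) 1 = 0) (hanti : Antitone fun m => v m 0) (hnn : ∀ m, 0 ≤ v m 0) :
    (∀ᶠ m in atTop, 0 < v m 0) ∧
    ∀ (q : ℕ → ℝ) (N : ℕ → ℕ) (θ : ℝ), Tendsto q atTop (𝓝[>] 0) → Tendsto N atTop atTop →
      Tendsto (fun n => N n * rate μ (q n)) atTop (𝓝 θ) → 0 < θ →
      Tendsto (fun n => v (N n) (q n) / v (N n) 0) atTop (𝓝 (1 + α * θ)⁻¹) := by
  set δ := d / (α * c) with hδdef
  have hα := hSL.alpha_pos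
  have hF0 : v 0 0 = 1 := hv0 0 ⟨le_rfl, zero_le_one⟩
  set u : ℕ → ℝ := fun m => genProd μ ν m 1 with hu
  have hupos : ∀ m, 0 < u m := genProd_pos hSL hν one_pos le_rfl
  have hule : ∀ m, u m ≤ 1 := fun m => Finset.prod_le_one
    (fun j _ => (genFun_immigration_pos hν (orbit_mem hSL one_pos le_rfl j).1.le
      (orbit_mem hSL one_pos le_rfl j).2).le)
    (fun j _ => genFun_le_one ν (by linarith [(orbit_mem hSL one_pos le_rfl j).2])
      (by linarith [(orbit_mem hSL one_pos le_rfl j).1]))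
  have hu0 : u 0 = 1 := by simp [hu, genProd]
  have hux : Tendsto (fun j : ℕ => ((j : ℝ) + 1) * (1 - u (j + 1) / u j)) atTop (𝓝 δ) := by
    refine (tendsto_mul_one_sub_genFun_orbit hSL).congr fun j => ?_
    have : u (j + 1) = u j * genFun ν (1 - (step μ)^[j] 1) := genProd_succ j 1
    rw [this, mul_div_cancel_left₀ _ (hupos j).ne']
  have hFle : ∀ m, |v m 0| ≤ 1 := fun m => by
    rw [abs_of_nonneg (hnn m), ← hF0]; exact hanti (Nat.zero_le m)
  have hΦ := fun (r : ℝ) (hr : 0 ≤ r) => tendsto_seqLaplace_tail (F := fun m => v m 0) hupos hule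
    hu0 hδ.2 hux hFle (renewal_identity hv0 hrec hv1) hr
  obtain ⟨hFpos, hT⟩ := tendsto_sum_div_mul hanti hnn (by rw [hF0]; exact one_pos) hδ.1 hΦ
  refine ⟨hFpos, fun q N θ hq hN hθ hθ0 => ?_⟩
  set A := α * θ with hA
  have hA0 : 0 < A := mul_pos hα hθ0
  -- only `x ≤ 1` matters; the positive part makes `ψ` continuous on the whole line
  set ψ : ℝ → ℝ := fun x => δ * A * (1 + A * max (1 - x) 0) ^ (-(δ + 1)) with hψ
  have hψc : Continuous ψ := by
    refine continuous_const.mul (Continuous.rpow_const (by fun_prop) fun x => Or.inl ?_)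
    have := mul_nonneg hA0.le (le_max_right (1 - x) 0)
    positivity
  have hmain := (hT ψ hψc).comp hN
  rw [integral_linnik_kernel hA0 hδ.1] at hmain
  set e : ℕ → ℕ → ℝ := fun n i => N n * (genProd μ ν (N n - 1 - i) (q n) *
    (1 - genFun ν (1 - (step μ)^[N n - 1 - i] (q n)))) - ψ (i / N n) with he
  have herr := tendsto_weighted_error hnn hN
    (by simpa using hT (fun _ => 1) continuous_const) (e := e) (fun i hi => by
      have h1 := tendsto_genProd_mul hSL hν hq hθ hθ0 (j := fun n => N n - 1 - i n)
        (hi.mono fun n hn => by omega)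
      have h2 : Tendsto (fun n => δ * A * (1 + A * ((N n - 1 - i n : ℕ) / N n)) ^ (-(δ + 1)) -
          ψ (i n / N n)) atTop (𝓝 0) := by
        have h3 : Tendsto (fun n => δ * A * ((δ + 1) * (A * (1 / (N n : ℝ))))) atTop (𝓝 0) := by
          have := (((tendsto_one_div_atTop_nhds_zero_nat (𝕜 := ℝ)).comp hN).const_mul
            A).const_mul (δ + 1) |>.const_mul (δ * A)
          simpa using this
        refine squeeze_zero_norm' ?_ h3
        filter_upwards [hi] with n hn
        have hN0 : (0 : ℝ) < N n := by
          have : 0 < N n := by omega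
          exact_mod_cast this
        have h4 : ((N n - 1 - i n : ℕ) : ℝ) = N n - 1 - i n := by
          rw [Nat.cast_sub (by omega), Nat.cast_sub (by omega)]; simp
        have h5 : (0 : ℝ) ≤ ((N n - 1 - i n : ℕ) : ℝ) := Nat.cast_nonneg _
        have h6 : (0 : ℝ) ≤ 1 - i n / N n := by
          rw [sub_nonneg, div_le_one hN0]; exact_mod_cast hn.le
        rw [hψ]
        beta_reduce
        rw [← mul_sub, norm_mul, Real.norm_of_nonneg (mul_pos hδ.1 hA0).le, max_eq_left h6]
        refine mul_le_mul_of_nonneg_left ?_ (mul_pos hδ.1 hA0).le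
        rw [Real.norm_eq_abs]
        refine (abs_rpow_neg_sub_le (by linarith [hδ.1]) ?_ ?_).trans_eq ?_
        · have : 0 ≤ A * (((N n - 1 - i n : ℕ) : ℝ) / N n) := by positivity
          linarith
        · have := mul_nonneg hA0.le h6
          linarith
        · rw [h4]
          have h7 : 1 + A * (((N n : ℝ) - 1 - i n) / N n) - (1 + A * (1 - i n / N n)) =
              -(A * (1 / N n)) := by
            field_simp; ring
          rw [h7, abs_neg, abs_of_pos (by positivity)]
      have h8 := h1.add h2
      rw [add_zero] at h8
      refine h8.congr fun n => ?_
      rw [he]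
      beta_reduce
      ring)
  have hsum := (hmain.add herr).const_sub 1
  have e1 : 1 - (A / (1 + A) + 0) = (1 + A)⁻¹ := by
    have : 1 + A ≠ 0 := by positivity
    field_simp; ring
  rw [e1] at hsum
  refine hsum.congr' ?_
  filter_upwards [hN.eventually hFpos, hN.eventually_gt_atTop 0,
    hq.eventually (eventually_Ioo 1 one_pos)] with n h1 h2 h3
  rw [one_mul] at h3
  have hN0 : (0 : ℝ) < N n := by exact_mod_cast h2
  rw [killed_eq hv0 hrec (N n) (q n) ⟨h3.1.le, h3.2.le⟩, sub_div, div_self h1.ne',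
    Function.comp_apply, ← add_div, ← Finset.sum_add_distrib]
  congr 1
  rw [div_eq_div_iff (by positivity) h1.ne', Finset.sum_mul, Finset.sum_mul]
  refine Finset.sum_congr rfl fun i hi => ?_
  have hi' := Finset.mem_range.1 hi
  have e2 : N n - i = (N n - 1 - i) + 1 := by omega
  rw [e2, genProd_succ, he]
  beta_reduce
  ring

end BGWI

/-! ### The branching property -/

namespace BGWI

section Independence

variable (μ ν : PMF ℕ)

/-- The law of an i.i.d. sequence with marginal law `μ`. -/
noncomputable abbrev iidLaw : Measure (ℕ → ℕ) := Measure.infinitePi fun _ : ℕ => μ.toMeasure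

theorem integral_pow_eq_genFun {s : ℝ} (h0 : 0 ≤ s) (h1 : s ≤ 1) (a : ℕ) :
    ∫ χ, s ^ χ a ∂(iidLaw μ) = genFun μ s := by
  have hm : Measurable fun n : ℕ => s ^ n := measurable_of_countable _
  have h2 := Measure.infinitePi_map_eval (fun _ : ℕ => μ.toMeasure) a
  have h3 : ∫ χ, s ^ χ a ∂(iidLaw μ) = ∫ n, s ^ n ∂((iidLaw μ).map fun χ => χ a) := by
    rw [integral_map (measurable_pi_apply a).aemeasurable hm.aestronglyMeasurable]
  rw [h3, h2, PMF.integral_eq_tsum, genFun]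
  · refine tsum_congr fun n => ?_
    rw [smul_eq_mul, mul_comm]
  · refine Integrable.of_bound hm.aestronglyMeasurable 1 (ae_of_all _ fun n => ?_)
    rw [Real.norm_of_nonneg (by positivity)]
    exact pow_le_one₀ h0 h1

theorem integral_mul_pow_of_dependsOn {Φ : (ℕ → ℕ) → ℝ} {a : ℕ} (hΦ : DependsOn Φ (Iio a))
    {s : ℝ} (h0 : 0 ≤ s) (h1 : s ≤ 1) :
    ∫ χ, Φ χ * s ^ χ a ∂(iidLaw μ) = (∫ χ, Φ χ ∂(iidLaw μ)) * genFun μ s := by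
  have hind : iIndepFun (fun i (χ : ℕ → ℕ) => χ i) (iidLaw μ) :=
    iIndepFun_infinitePi (X := fun _ n => n) fun _ => measurable_id
  have h2 := hind.indepFun_finset (Finset.range a) {a} (by simp) fun i => measurable_pi_apply i
  -- `Φ` factors through the first `a` coordinates
  let Φ' : (Finset.range a → ℕ) → ℝ := fun y => Φ fun i => if h : i ∈ Finset.range a then y ⟨i, h⟩ else 0
  have hΦ' : ∀ χ, Φ' (fun i => χ i) = Φ χ := fun χ => hΦ fun i hi => by
    have hi' : i < a := hi
    simp [hi']
  have h3 := h2.comp (φ := Φ') (ψ := fun y : ({a} : Finset ℕ) → ℕ => s ^ y ⟨a, by simp⟩)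
    (measurable_of_countable _) (measurable_of_countable _)
  have h4 := h3.integral_fun_mul_eq_mul_integral
    (((measurable_of_countable Φ').comp (by fun_prop)).aestronglyMeasurable)
    (((measurable_of_countable (fun y : ({a} : Finset ℕ) → ℕ => s ^ y ⟨a, by simp⟩)).comp
      (by fun_prop)).aestronglyMeasurable)
  simp only [Function.comp_apply, hΦ'] at h4
  rw [h4, integral_pow_eq_genFun μ h0 h1]

/-- The offspring of `z` individuals is independent of an event that precedes their births. -/
theorem integral_mul_pow_sum_of_dependsOn {Φ : (ℕ → ℕ) → ℝ} {a : ℕ} (hΦ : DependsOn Φ (Iio a))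
    {s : ℝ} (h0 : 0 ≤ s) (h1 : s ≤ 1) (z : ℕ) :
    ∫ χ, Φ χ * s ^ (∑ i ∈ Finset.range z, χ (a + i)) ∂(iidLaw μ) =
      (∫ χ, Φ χ ∂(iidLaw μ)) * genFun μ s ^ z := by
  induction z with
  | zero => simp
  | succ z ih =>
    have h2 : DependsOn (fun χ : ℕ → ℕ => Φ χ * s ^ (∑ i ∈ Finset.range z, χ (a + i)))
        (Iio (a + z)) := by
      intro χ χ' h
      have e1 : Φ χ = Φ χ' := hΦ fun i hi => h i (by
        simp only [mem_Iio] at hi ⊢; omega)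
      have e2 : ∑ i ∈ Finset.range z, χ (a + i) = ∑ i ∈ Finset.range z, χ' (a + i) :=
        Finset.sum_congr rfl fun i hi => h _ (by
          have := Finset.mem_range.1 hi
          simp only [mem_Iio]; omega)
      simp only [e1, e2]
    have h3 := integral_mul_pow_of_dependsOn μ h2 h0 h1
    rw [ih, mul_assoc, ← pow_succ] at h3
    rw [← h3]
    refine integral_congr_ae (ae_of_all _ fun χ => ?_)
    beta_reduce
    rw [Finset.sum_range_succ, pow_add, mul_assoc]

/-- Independence of the future of both i.i.d. sequences from a past event. -/
theorem integral_prod_of_dependsOn {Φ : (ℕ → ℕ) × (ℕ → ℕ) → ℝ} {a m : ℕ} (hm : Measurable Φ)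
    (hb : ∀ p, |Φ p| ≤ 1) (h1 : ∀ η, DependsOn (fun χ => Φ (χ, η)) (Iio a))
    (h2 : ∀ χ, DependsOn (fun η => Φ (χ, η)) (Iio m)) {s : ℝ} (hs0 : 0 ≤ s) (hs1 : s ≤ 1) (z : ℕ) :
    ∫ p, Φ p * s ^ (∑ i ∈ Finset.range z, p.1 (a + i) + p.2 m) ∂((iidLaw μ).prod (iidLaw ν)) =
      genFun ν s * (genFun μ s ^ z * ∫ p, Φ p ∂((iidLaw μ).prod (iidLaw ν))) := by
  have hpow : Measurable fun n : ℕ => s ^ n := measurable_of_countable _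
  have hpow1 : ∀ n : ℕ, ‖s ^ n‖ ≤ 1 := fun n => by
    rw [Real.norm_of_nonneg (by positivity)]
    exact pow_le_one₀ hs0 hs1
  have hi1 : Integrable (fun p : (ℕ → ℕ) × (ℕ → ℕ) =>
      Φ p * s ^ (∑ i ∈ Finset.range z, p.1 (a + i) + p.2 m)) ((iidLaw μ).prod (iidLaw ν)) := by
    refine Integrable.of_bound (hm.mul (hpow.comp ?_)).aestronglyMeasurable 1
      (ae_of_all _ fun p => ?_)
    · fun_prop
    · rw [norm_mul]
      exact mul_le_one₀ (hb p) (norm_nonneg _) (hpow1 _)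
  have hi2 : Integrable Φ ((iidLaw μ).prod (iidLaw ν)) :=
    Integrable.of_bound hm.aestronglyMeasurable 1 (ae_of_all _ hb)
  rw [integral_prod _ hi1, integral_prod _ hi2]
  have h3 : ∀ χ : ℕ → ℕ, ∫ η, Φ (χ, η) * s ^ (∑ i ∈ Finset.range z, χ (a + i) + η m) ∂(iidLaw ν) =
      genFun ν s * ((∫ η, Φ (χ, η) ∂(iidLaw ν)) * s ^ (∑ i ∈ Finset.range z, χ (a + i))) := by
    intro χ
    have h4 := integral_mul_pow_of_dependsOn ν (h2 χ) hs0 hs1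
    have h5 : ∀ η : ℕ → ℕ, Φ (χ, η) * s ^ (∑ i ∈ Finset.range z, χ (a + i) + η m) =
        s ^ (∑ i ∈ Finset.range z, χ (a + i)) * (Φ (χ, η) * s ^ η m) := fun η => by
      rw [pow_add]; ring
    simp only [h5]
    rw [integral_const_mul, h4]
    ring
  simp only [h3]
  rw [integral_const_mul]
  congr 1
  have h6 : DependsOn (fun χ => ∫ η, Φ (χ, η) ∂(iidLaw ν)) (Iio a) := by
    intro χ χ' h
    exact integral_congr_ae (ae_of_all _ fun η => h1 η h)
  rw [integral_mul_pow_sum_of_dependsOn μ h6 hs0 hs1, mul_comm]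

end Independence

section Path

theorem cumPop_succ (χ η : ℕ → ℕ) (m : ℕ) :
    cumPop χ η (m + 1) = cumPop χ η m + path χ η m := rfl

theorem cumPop_mono (χ η : ℕ → ℕ) : Monotone (cumPop χ η) :=
  monotone_nat_of_le_succ fun m => by rw [cumPop_succ]; exact Nat.le_add_right _ _

theorem path_zero (χ η : ℕ → ℕ) : path χ η 0 = 0 := by
  simp [path, cumPop, offspringWalk, immigrationWalk]

/-- Every individual of generation `m` reproduces independently, and immigrants are added. -/
theorem path_succ (χ η : ℕ → ℕ) (m : ℕ) :
    path χ η (m + 1) =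
      ∑ i ∈ Finset.range (path χ η m), χ (cumPop χ η m + i) + η m := by
  have h1 := path_eq χ η m
  have h2 := path_eq χ η (m + 1)
  have h3 : offspringWalk χ (cumPop χ η m + path χ η m) = offspringWalk χ (cumPop χ η m) +
      (∑ i ∈ Finset.range (path χ η m), (χ (cumPop χ η m + i) : ℤ) - path χ η m) := by
    rw [offspringWalk, Finset.sum_range_add, offspringWalk,
      Finset.sum_sub_distrib (s := Finset.range (path χ η m))]
    simp
  have h4 : immigrationWalk η (m + 1) = immigrationWalk η m + η m := by
    rw [immigrationWalk, Finset.sum_range_succ]; rfl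
  rw [cumPop_succ, h3, h4] at h2
  zify
  linarith

/-- The path up to time `m` uses only the offspring numbers of the individuals born before. -/
theorem path_congr {χ χ' η η' : ℕ → ℕ} {m : ℕ} (hχ : ∀ i < cumPop χ η m, χ i = χ' i)
    (hη : ∀ i < m, η i = η' i) :
    ∀ j ≤ m, cumPop χ η j = cumPop χ' η' j ∧ path χ η j = path χ' η' j := by
  have key : ∀ j ≤ m, cumPop χ η j = cumPop χ' η' j → path χ η j = path χ' η' j := by
    intro j hj h
    have e1 : offspringWalk χ (cumPop χ η j) = offspringWalk χ' (cumPop χ η j) :=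
      Finset.sum_congr rfl fun i hi => by
        rw [hχ i ((Finset.mem_range.1 hi).trans_le (cumPop_mono χ η hj))]
    have e2 : immigrationWalk η j = immigrationWalk η' j :=
      Finset.sum_congr rfl fun i hi => by rw [hη i ((Finset.mem_range.1 hi).trans_le hj)]
    rw [path, path, e1, e2, h]
  intro j
  induction j with
  | zero => intro hj; exact ⟨rfl, key 0 hj rfl⟩
  | succ j ih =>
    intro hj
    obtain ⟨h1, h2⟩ := ih (by omega)
    have h3 : cumPop χ η (j + 1) = cumPop χ' η' (j + 1) := by
      rw [cumPop_succ, cumPop_succ, h1, h2]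
    exact ⟨h3, key _ hj h3⟩

/-- The paths that do not visit zero at the times `1, …, m`. -/
def noZero (m : ℕ) : Set (ℕ → ℕ) := {z | ∀ j, 1 ≤ j → j ≤ m → 0 < z j}

theorem measurableSet_noZero (m : ℕ) : MeasurableSet (noZero m) := by
  have : noZero m = ⋂ j, ⋂ (_ : 1 ≤ j), ⋂ (_ : j ≤ m), (fun z : ℕ → ℕ => z j) ⁻¹' (Ioi 0) := by
    ext z; simp [noZero]
  rw [this]
  exact MeasurableSet.iInter fun j => MeasurableSet.iInter fun _ => MeasurableSet.iInter fun _ =>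
    measurable_pi_apply j measurableSet_Ioi

theorem measurable_cumPop (m : ℕ) :
    Measurable fun p : (ℕ → ℕ) × (ℕ → ℕ) => cumPop p.1 p.2 m := by
  simp only [cumPop_eq]
  exact Finset.measurable_sum _ fun j _ => (measurable_pi_apply j).comp measurable_path

variable (μ ν : PMF ℕ)

instance : IsProbabilityMeasure (law μ ν) :=
  Measure.isProbabilityMeasure_map measurable_path.aemeasurable

/-- One branching step, on the event of no return to zero. -/
theorem integral_noZero_pow_succ (m : ℕ) {s : ℝ} (hs0 : 0 ≤ s) (hs1 : s ≤ 1) :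
    ∫ z, (noZero m).indicator (fun z => s ^ z (m + 1)) z ∂(law μ ν) =
      genFun ν s * ∫ z, (noZero m).indicator (fun z => genFun μ s ^ z m) z ∂(law μ ν) := by
  have hpow : ∀ t : ℝ, Measurable fun n : ℕ => t ^ n := fun t => measurable_of_countable _
  have hf0 := genFun_nonneg μ hs0
  have hf1 := genFun_le_one μ hs0 hs1
  have hmeas : ∀ (t : ℝ) (j : ℕ),
      Measurable fun z : ℕ → ℕ => (noZero m).indicator (fun z => t ^ z j) z := fun t j =>
    ((hpow t).comp (measurable_pi_apply j)).indicator (measurableSet_noZero m)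
  rw [law, integral_map measurable_path.aemeasurable (hmeas _ _).aestronglyMeasurable,
    integral_map measurable_path.aemeasurable (hmeas _ _).aestronglyMeasurable]
  set Q := (Measure.infinitePi fun _ : ℕ => μ.toMeasure).prod
    (Measure.infinitePi fun _ : ℕ => ν.toMeasure)
  have hint : ∀ (t : ℝ) (j : ℕ), 0 ≤ t → t ≤ 1 → Integrable (fun p : (ℕ → ℕ) × (ℕ → ℕ) =>
      (noZero m).indicator (fun z => t ^ z j) (path p.1 p.2)) Q := by
    intro t j ht0 ht1
    refine Integrable.of_bound ((hmeas t j).comp measurable_path).aestronglyMeasurable 1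
      (ae_of_all _ fun p => ?_)
    refine (norm_indicator_le_norm_self _ _).trans ?_
    rw [Real.norm_of_nonneg (by positivity)]
    exact pow_le_one₀ ht0 ht1
  -- split according to the values of the cumulative population and of the current generation
  let A : ℕ × ℕ → Set ((ℕ → ℕ) × (ℕ → ℕ)) := fun w =>
    {p | cumPop p.1 p.2 m = w.1 ∧ path p.1 p.2 m = w.2}
  have hA : ∀ w, MeasurableSet (A w) := fun w =>
    (measurable_cumPop m (measurableSet_singleton w.1)).inter
      (((measurable_pi_apply m).comp measurable_path) (measurableSet_singleton w.2))
  have hdisj : Pairwise (Function.onFun Disjoint A) := by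
    intro w w' hw
    refine Set.disjoint_left.2 fun p hp hp' => hw ?_
    exact Prod.ext (hp.1.symm.trans hp'.1) (hp.2.symm.trans hp'.2)
  have huniv : ⋃ w, A w = univ := by
    ext p
    simp only [mem_iUnion, mem_univ, iff_true]
    exact ⟨(cumPop p.1 p.2 m, path p.1 p.2 m), rfl, rfl⟩
  rw [← setIntegral_univ, ← huniv, integral_iUnion hA hdisj (hint _ _ hs0 hs1).integrableOn,
    ← setIntegral_univ (f := fun p : (ℕ → ℕ) × (ℕ → ℕ) =>
      (noZero m).indicator (fun z => genFun μ s ^ z m) (path p.1 p.2)), ← huniv,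
    integral_iUnion hA hdisj (hint _ _ hf0 hf1).integrableOn, ← tsum_mul_left]
  refine tsum_congr fun w => ?_
  obtain ⟨a, z⟩ := w
  let E : Set ((ℕ → ℕ) × (ℕ → ℕ)) := A (a, z) ∩ (fun p => path p.1 p.2) ⁻¹' noZero m
  have hE : MeasurableSet E := (hA _).inter (measurable_path (measurableSet_noZero m))
  have hEcongr : ∀ χ χ' η η' : ℕ → ℕ, (∀ i < a, χ i = χ' i) → (∀ i < m, η i = η' i) →
      (χ, η) ∈ E → (χ', η') ∈ E := by
    rintro χ χ' η η' hχ hη ⟨⟨h1, h2⟩, h3⟩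
    have h1' : cumPop χ η m = a := h1
    have h4 := path_congr (χ' := χ') (η' := η') (m := m) (by rw [h1']; exact hχ) hη
    refine ⟨⟨(h4 m le_rfl).1.symm.trans h1, (h4 m le_rfl).2.symm.trans h2⟩, fun j hj hjm => ?_⟩
    have h5 := h3 j hj hjm
    beta_reduce at h5 ⊢
    rwa [← (h4 j hjm).2]
  have hEind : ∀ χ χ' η η' : ℕ → ℕ, (∀ i < a, χ i = χ' i) → (∀ i < m, η i = η' i) →
      E.indicator (fun _ => (1 : ℝ)) (χ, η) = E.indicator (fun _ => (1 : ℝ)) (χ', η') := by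
    intro χ χ' η η' hχ hη
    by_cases h : (χ, η) ∈ E
    · rw [indicator_of_mem h, indicator_of_mem (hEcongr _ _ _ _ hχ hη h)]
    · rw [indicator_of_notMem h, indicator_of_notMem fun h' => h
        (hEcongr _ _ _ _ (fun i hi => (hχ i hi).symm) (fun i hi => (hη i hi).symm) h')]
  have hmain := integral_prod_of_dependsOn μ ν (Φ := E.indicator fun _ => (1 : ℝ)) (a := a) (m := m)
    (measurable_const.indicator hE)
    (fun p => (norm_indicator_le_norm_self (fun _ => (1 : ℝ)) p).trans_eq norm_one)
    (fun η χ χ' h => hEind χ χ' η η h fun _ _ => rfl)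
    (fun χ η η' h => hEind χ χ η η' (fun _ _ => rfl) h) hs0 hs1 z
  have e1 : ∫ p in A (a, z), (noZero m).indicator (fun z => s ^ z (m + 1)) (path p.1 p.2) ∂Q =
      ∫ p, E.indicator (fun _ => (1 : ℝ)) p *
        s ^ (∑ i ∈ Finset.range z, p.1 (a + i) + p.2 m) ∂Q := by
    rw [← integral_indicator (hA _)]
    refine integral_congr_ae (ae_of_all _ fun p => ?_)
    beta_reduce
    by_cases h1 : p ∈ A (a, z)
    · rw [indicator_of_mem h1]
      by_cases h2 : path p.1 p.2 ∈ noZero m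
      · rw [indicator_of_mem h2, indicator_of_mem (show p ∈ E from ⟨h1, h2⟩), one_mul, path_succ,
          h1.1, h1.2]
      · rw [indicator_of_notMem h2, indicator_of_notMem (fun h : p ∈ E => h2 h.2), zero_mul]
    · rw [indicator_of_notMem h1, indicator_of_notMem (fun h : p ∈ E => h1 h.1), zero_mul]
  have e2 : ∫ p in A (a, z), (noZero m).indicator (fun z => genFun μ s ^ z m) (path p.1 p.2) ∂Q =
      genFun μ s ^ z * ∫ p, E.indicator (fun _ => (1 : ℝ)) p ∂Q := by
    rw [← integral_indicator (hA _), ← integral_const_mul]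
    refine integral_congr_ae (ae_of_all _ fun p => ?_)
    beta_reduce
    by_cases h1 : p ∈ A (a, z)
    · rw [indicator_of_mem h1]
      by_cases h2 : path p.1 p.2 ∈ noZero m
      · rw [indicator_of_mem h2, indicator_of_mem (show p ∈ E from ⟨h1, h2⟩), mul_one, h1.2]
      · rw [indicator_of_notMem h2, indicator_of_notMem (fun h : p ∈ E => h2 h.2), mul_zero]
    · rw [indicator_of_notMem h1, indicator_of_notMem (fun h : p ∈ E => h1 h.1), mul_zero]
  rw [e1, e2]
  exact hmain

/-- The generating function `E[(1 - q)^{Z₁(m)}; T > m]` of generation `m` on the event of no return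
to zero up to time `m`, in the variable `q = 1 - s`. -/
noncomputable def killed (m : ℕ) (q : ℝ) : ℝ :=
  ∫ z, (noZero m).indicator (fun z => (1 - q) ^ z m) z ∂(law μ ν)

theorem ae_law_zero : ∀ᵐ z ∂(law μ ν), z 0 = 0 := by
  have hs : MeasurableSet {z : ℕ → ℕ | z 0 = 0} := measurable_pi_apply 0 (measurableSet_singleton 0)
  rw [law, ae_map_iff measurable_path.aemeasurable hs]
  exact ae_of_all _ fun p => path_zero p.1 p.2

theorem killed_zero_left {q : ℝ} : killed μ ν 0 q = 1 := by
  have h : ∀ᵐ z ∂(law μ ν), (noZero 0).indicator (fun z : ℕ → ℕ => (1 - q) ^ z 0) z = 1 := by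
    filter_upwards [ae_law_zero μ ν] with z hz
    rw [indicator_of_mem (show z ∈ noZero 0 from fun j h1 h2 => by omega), hz, pow_zero]
  rw [killed, integral_congr_ae h]
  simp

theorem killed_zero_right (m : ℕ) : killed μ ν m 0 = (law μ ν).real (noZero m) := by
  rw [killed]
  simp only [sub_zero, one_pow]
  rw [integral_indicator_const _ (measurableSet_noZero m), smul_eq_mul, mul_one]

theorem noZero_succ_subset (m : ℕ) : noZero (m + 1) ⊆ noZero m :=
  fun _ hz j h1 h2 => hz j h1 (by omega)

/-- At `q = 1` the generating function is `P(Z₁(m) = 0; T > m)`, which vanishes for `m ≥ 1`. -/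
theorem killed_one_right (m : ℕ) : killed μ ν (m + 1) 1 = 0 := by
  rw [killed]
  refine integral_eq_zero_of_ae (ae_of_all _ fun z => ?_)
  by_cases h : z ∈ noZero (m + 1)
  · rw [indicator_of_mem h, sub_self, zero_pow (h (m + 1) (by omega) le_rfl).ne']
    rfl
  · rw [indicator_of_notMem h]; rfl

/-- The branching recursion. The last term is the probability that the first return to zero takes
place at time `m + 1`. -/
theorem killed_succ (m : ℕ) {q : ℝ} (hq0 : 0 ≤ q) (hq1 : q ≤ 1) :
    killed μ ν (m + 1) q = genFun ν (1 - q) * killed μ ν m (step μ q) -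
      (killed μ ν m 0 - killed μ ν (m + 1) 0) := by
  have h1 := integral_noZero_pow_succ μ ν m (s := 1 - q) (by linarith) (by linarith)
  have h2 : 1 - step μ q = genFun μ (1 - q) := by rw [step]; ring
  have hmeas : ∀ i j, Measurable ((noZero i).indicator fun z : ℕ → ℕ => (1 - q) ^ z j) :=
    fun i j => ((measurable_of_countable (fun n : ℕ => (1 - q) ^ n)).comp
      (measurable_pi_apply j)).indicator (measurableSet_noZero i)
  have hint : ∀ i j, Integrable ((noZero i).indicator fun z : ℕ → ℕ => (1 - q) ^ z j)
      (law μ ν) := by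
    intro i j
    refine Integrable.of_bound (hmeas i j).aestronglyMeasurable 1 (ae_of_all _ fun p => ?_)
    refine (norm_indicator_le_norm_self _ _).trans ?_
    rw [Real.norm_of_nonneg (pow_nonneg (by linarith) _)]
    exact pow_le_one₀ (by linarith) (by linarith)
  have hint1 : ∀ i, Integrable ((noZero i).indicator fun _ : ℕ → ℕ => (1 : ℝ)) (law μ ν) :=
    fun i => (integrable_const 1).indicator (measurableSet_noZero i)
  have h3 : killed μ ν m (step μ q) =
      ∫ z, (noZero m).indicator (fun z => genFun μ (1 - q) ^ z m) z ∂(law μ ν) := by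
    rw [killed, h2]
  rw [h3, ← h1]
  have h4 : ∀ i, killed μ ν i 0 = ∫ z, (noZero i).indicator (fun _ : ℕ → ℕ => (1 : ℝ)) z ∂(law μ ν) :=
    fun i => by simp only [killed, sub_zero, one_pow]
  rw [h4, h4, killed, ← integral_sub (hint1 _) (hint1 _)]
  refine Eq.trans ?_ (integral_sub (hint m (m + 1)) ((hint1 m).sub (hint1 (m + 1))))
  refine integral_congr_ae (ae_of_all _ fun z => ?_)
  beta_reduce
  by_cases hz : z ∈ noZero m
  · by_cases hz' : z ∈ noZero (m + 1)
    · simp only [indicator_of_mem hz, indicator_of_mem hz']; ring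
    · -- on this event the process visits zero exactly at time `m + 1`
      have h5 : z (m + 1) = 0 := by
        by_contra h
        refine hz' fun j hj hjm => ?_
        rcases Nat.lt_or_eq_of_le hjm with h6 | h6
        · exact hz j hj (by omega)
        · rw [h6]; omega
      simp only [indicator_of_mem hz, indicator_of_notMem hz', h5]; simp
  · have hz' : z ∉ noZero (m + 1) := fun h => hz (noZero_succ_subset m h)
    simp only [indicator_of_notMem hz, indicator_of_notMem hz']; simp

end Path

end BGWI

/-! ### Conditioning the scaled process -/

namespace BGWI

section Scaled

variable {Ω : Type*} [MeasurableSpace Ω] {μ ν : PMF ℕ} {n : ℕ} {b : ℝ} {Z : ℝ≥0 → Ω → ℝ}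
  {P : Measure Ω}

theorem measurable_scaledPath (n : ℕ) (b : ℝ) :
    Measurable fun (z : ℕ → ℕ) (s : ℝ≥0) => (z ⌊(n : ℝ≥0) * s⌋₊ : ℝ) / b :=
  measurable_pi_lambda _ fun _ =>
    ((measurable_of_countable (fun k : ℕ => (k : ℝ))).comp (measurable_pi_apply _)).div_const b

theorem floor_mul_div (hn : 0 < n) (j : ℕ) : ⌊(n : ℝ≥0) * (j / n)⌋₊ = j := by
  have : (n : ℝ≥0) ≠ 0 := by positivity
  rw [mul_div_cancel₀ _ this, Nat.floor_natCast]

/-- Almost surely, the whole path is the step function through its values at the multiples of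
`1 / n`: the identity holds almost surely at each rational time, and passes to all times by right
continuity. -/
theorem ae_eq_step (hZ : IsScaledBGWI μ ν n b Z P) (hn : 0 < n) :
    ∀ᵐ ω ∂P, ∀ s, Z s ω = Z (⌊(n : ℝ≥0) * s⌋₊ / n) ω := by
  have hn0 : (0 : ℝ≥0) < n := by positivity
  have hm : Measurable fun (ω : Ω) (s : ℝ≥0) => Z s ω := measurable_pi_lambda _ hZ.measurable
  have h1 : ∀ s, ∀ᵐ ω ∂P, Z s ω = Z (⌊(n : ℝ≥0) * s⌋₊ / n) ω := by
    intro s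
    have hs : MeasurableSet {w : ℝ≥0 → ℝ | w s = w (⌊(n : ℝ≥0) * s⌋₊ / n)} :=
      measurableSet_eq_fun (measurable_pi_apply _) (measurable_pi_apply _)
    have h2 : ∀ᵐ w ∂(P.map fun ω s => Z s ω), w s = w (⌊(n : ℝ≥0) * s⌋₊ / n) := by
      rw [hZ.law_eq, ae_map_iff (measurable_scaledPath n b).aemeasurable hs]
      refine ae_of_all _ fun z => ?_
      beta_reduce
      rw [floor_mul_div hn]
    exact (ae_map_iff hm.aemeasurable hs).1 h2
  have h2 : ∀ᵐ ω ∂P, ∀ x : ℚ, Z (Real.toNNReal x) ω =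
      Z (⌊(n : ℝ≥0) * Real.toNNReal x⌋₊ / n) ω := ae_all_iff.2 fun x => h1 _
  filter_upwards [h2] with ω hω s
  have hc : Tendsto (fun u => Z u ω) (𝓝[>] s) (𝓝 (Z s ω)) :=
    ((hZ.cadlag ω s).1).tendsto.mono_left (nhdsWithin_mono s Ioi_subset_Ici_self)
  set j := ⌊(n : ℝ≥0) * s⌋₊ with hj
  have hlt : s < (j + 1 : ℕ) / n := by
    rw [lt_div_iff₀ hn0, mul_comm]
    push_cast
    exact Nat.lt_floor_add_one _
  -- rational times just after `s` have the same integer part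
  have hfreq : ∃ᶠ u in 𝓝[>] s, Z u ω = Z (j / n) ω := by
    have hI : ∀ v > s, ∃ u ∈ Ioo s v, Z u ω = Z (j / n) ω := by
      intro v hv
      obtain ⟨x, hx1, hx2⟩ := exists_rat_btwn
        (NNReal.coe_lt_coe.2 (lt_min hv hlt))
      have hx0 : (0 : ℝ) ≤ x := s.coe_nonneg.trans hx1.le
      have hsx : s < Real.toNNReal x := Real.lt_toNNReal_iff_coe_lt.2 hx1
      have hxm : Real.toNNReal x < min v ((j + 1 : ℕ) / n) :=
        (Real.toNNReal_lt_iff_lt_coe hx0).2 hx2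
      refine ⟨Real.toNNReal x, ⟨hsx, hxm.trans_le (min_le_left _ _)⟩, ?_⟩
      have hfl : ⌊(n : ℝ≥0) * Real.toNNReal x⌋₊ = j := by
        rw [Nat.floor_eq_iff (by positivity)]
        constructor
        · exact (Nat.floor_le (by positivity)).trans (mul_le_mul_of_nonneg_left hsx.le hn0.le)
        · have := hxm.trans_le (min_le_right _ _)
          rw [lt_div_iff₀ hn0, mul_comm] at this
          exact_mod_cast this
      rw [hω x, hfl]
    rw [Filter.frequently_iff]
    intro U hU
    obtain ⟨v, hv, hvU⟩ := mem_nhdsGT_iff_exists_Ioo_subset.1 hU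
    obtain ⟨u, hu, hu'⟩ := hI v hv
    exact ⟨u, hvU hu, hu'⟩
  by_contra hne
  have hev : ∀ᶠ u in 𝓝[>] s, Z u ω ≠ Z (j / n) ω := hc.eventually_ne hne
  obtain ⟨u, hu1, hu2⟩ := (hfreq.and_eventually hev).exists
  exact hu2 hu1

/-- The law of the values of the scaled process at the multiples of `1 / n`. -/
theorem map_skeleton (hZ : IsScaledBGWI μ ν n b Z P) (hn : 0 < n) :
    P.map (fun ω (j : ℕ) => Z (j / n) ω) = (law μ ν).map fun z (j : ℕ) => (z j : ℝ) / b := by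
  have hm : Measurable fun (ω : Ω) (s : ℝ≥0) => Z s ω := measurable_pi_lambda _ hZ.measurable
  have hr : Measurable fun (w : ℝ≥0 → ℝ) (j : ℕ) => w (j / n) :=
    measurable_pi_lambda _ fun j => measurable_pi_apply _
  have h1 := congrArg (Measure.map fun (w : ℝ≥0 → ℝ) (j : ℕ) => w (j / n)) hZ.law_eq
  rw [Measure.map_map hr hm, Measure.map_map hr (measurable_scaledPath n b)] at h1
  have e : (fun (w : ℝ≥0 → ℝ) (j : ℕ) => w (j / n)) ∘
      (fun (z : ℕ → ℕ) (s : ℝ≥0) => (z ⌊(n : ℝ≥0) * s⌋₊ : ℝ) / b) =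
      fun z (j : ℕ) => (z j : ℝ) / b := by
    funext z j
    simp only [Function.comp_apply, floor_mul_div hn]
  rw [e] at h1
  exact h1

/-- The event that the values at `1 / n, …, m / n` are positive. -/
def posSkeleton (Z : ℝ≥0 → Ω → ℝ) (n m : ℕ) : Set Ω :=
  {ω | ∀ j : ℕ, 1 ≤ j → j ≤ m → 0 < Z (j / n) ω}

theorem integral_posSkeleton (hZ : IsScaledBGWI μ ν n b Z P) (hn : 0 < n) (hb : 0 < b) (m : ℕ)
    {φ : ℝ → ℝ} (hφ : Measurable φ) :
    ∫ ω in posSkeleton Z n m, φ (Z (m / n) ω) ∂P =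
      ∫ z in noZero m, φ ((z m : ℝ) / b) ∂(law μ ν) := by
  have hm : Measurable fun (ω : Ω) (j : ℕ) => Z (j / n) ω :=
    measurable_pi_lambda _ fun j => hZ.measurable _
  have hm2 : Measurable fun (z : ℕ → ℕ) (j : ℕ) => (z j : ℝ) / b :=
    measurable_pi_lambda _ fun j =>
      ((measurable_of_countable (fun k : ℕ => (k : ℝ))).comp (measurable_pi_apply _)).div_const b
  let B : Set (ℕ → ℝ) := {w | ∀ j : ℕ, 1 ≤ j → j ≤ m → 0 < w j}
  have hB : MeasurableSet B := by
    have : B = ⋂ j : ℕ, ⋂ (_ : 1 ≤ j), ⋂ (_ : j ≤ m), (fun w : ℕ → ℝ => w j) ⁻¹' Ioi 0 := by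
      ext ω; simp [B]
    rw [this]
    exact MeasurableSet.iInter fun j => MeasurableSet.iInter fun _ => MeasurableSet.iInter fun _ =>
      measurable_pi_apply j measurableSet_Ioi
  have h1 : ∫ ω in posSkeleton Z n m, φ (Z (m / n) ω) ∂P =
      ∫ w in B, φ (w m) ∂(P.map fun ω (j : ℕ) => Z (j / n) ω) := by
    rw [setIntegral_map (f := fun w : ℕ → ℝ => φ (w m)) hB
      (hφ.comp (measurable_pi_apply m)).aestronglyMeasurable hm.aemeasurable]
    rfl
  have hpre : (fun (z : ℕ → ℕ) (j : ℕ) => (z j : ℝ) / b) ⁻¹' B = noZero m := by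
    ext z
    simp only [B, noZero, mem_preimage, mem_ofPred_eq]
    refine forall_congr' fun j => forall_congr' fun _ => forall_congr' fun _ => ?_
    rw [div_pos_iff_of_pos_right hb, Nat.cast_pos]
  rw [h1, map_skeleton hZ hn, setIntegral_map (f := fun w : ℕ → ℝ => φ (w m)) hB
    (hφ.comp (measurable_pi_apply m)).aestronglyMeasurable hm2.aemeasurable, hpre]

theorem ae_skeleton_nonneg (hZ : IsScaledBGWI μ ν n b Z P) (hn : 0 < n) (hb : 0 < b) :
    ∀ᵐ ω ∂P, ∀ j : ℕ, 0 ≤ Z (j / n) ω := by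
  refine ae_all_iff.2 fun j => ?_
  have hm : Measurable fun (ω : Ω) (j : ℕ) => Z (j / n) ω :=
    measurable_pi_lambda _ fun j => hZ.measurable _
  have hm2 : Measurable fun (z : ℕ → ℕ) (j : ℕ) => (z j : ℝ) / b :=
    measurable_pi_lambda _ fun j =>
      ((measurable_of_countable (fun k : ℕ => (k : ℝ))).comp (measurable_pi_apply _)).div_const b
  have hs : MeasurableSet {w : ℕ → ℝ | 0 ≤ w j} := measurable_pi_apply j measurableSet_Ici
  have h2 : ∀ᵐ w ∂(P.map fun ω (j : ℕ) => Z (j / n) ω), 0 ≤ w j := by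
    rw [map_skeleton hZ hn, ae_map_iff hm2.aemeasurable hs]
    exact ae_of_all _ fun z => by positivity
  exact (ae_map_iff hm.aemeasurable hs).1 h2

theorem posOn_ae_eq (hZ : IsScaledBGWI μ ν n b Z P) (hn : 0 < n) (τ : ℝ≥0) :
    {ω | ∀ s ∈ Icc (1 / (n : ℝ≥0)) τ, 0 < Z s ω} =ᵐ[P] posSkeleton Z n ⌊(n : ℝ≥0) * τ⌋₊ := by
  have hn0 : (0 : ℝ≥0) < n := by positivity
  filter_upwards [ae_eq_step hZ hn] with ω hω
  refine propext ⟨fun h j hj1 hj2 => ?_, fun h s hs => ?_⟩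
  · refine h _ ⟨?_, ?_⟩
    · gcongr
      exact_mod_cast hj1
    · rw [div_le_iff₀ hn0, mul_comm]
      exact (Nat.cast_le.2 hj2).trans (Nat.floor_le (by positivity))
  · rw [hω s]
    refine h _ ?_ (Nat.floor_le_floor (mul_le_mul_of_nonneg_left hs.2 hn0.le))
    rw [Nat.one_le_floor_iff]
    have := hs.1
    rwa [div_le_iff₀ hn0, mul_comm] at this

theorem hitZeroAfter_ae_eq (hZ : IsScaledBGWI μ ν n b Z P) (hn : 0 < n) (hb : 0 < b) {τ : ℝ≥0} :
    {ω | (τ : ℝ≥0∞) < hitZeroAfter (1 / (n : ℝ≥0)) fun s => Z s ω} =ᵐ[P]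
      posSkeleton Z n ⌊(n : ℝ≥0) * τ⌋₊ := by
  have hn0 : (0 : ℝ≥0) < n := by positivity
  filter_upwards [ae_eq_step hZ hn, ae_skeleton_nonneg hZ hn hb] with ω hω hnn
  refine propext ⟨fun h j hj1 hj2 => ?_, fun h => ?_⟩
  · refine (hnn j).lt_of_ne fun h0 => ?_
    have h' : (τ : ℝ≥0∞) < hitZeroAfter (1 / (n : ℝ≥0)) fun s => Z s ω := h
    -- the process vanishes on the whole interval `[j / n, (j + 1) / n)`
    have hle : hitZeroAfter (1 / (n : ℝ≥0)) (fun s => Z s ω) ≤ ((j / n : ℝ≥0) : ℝ≥0∞) := by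
      refine le_of_forall_gt_imp_ge_of_dense fun x hx => ?_
      obtain ⟨s, hs1, hs2⟩ := ENNReal.lt_iff_exists_nnreal_btwn.1
        (lt_min hx (ENNReal.coe_lt_coe.2 (show (j / n : ℝ≥0) < (j + 1 : ℕ) / n by
          gcongr; exact Nat.lt_succ_self j)))
      have hs1' : (j / n : ℝ≥0) < s := ENNReal.coe_lt_coe.1 hs1
      have hs2' : s < (j + 1 : ℕ) / n := ENNReal.coe_lt_coe.1 (hs2.trans_le (min_le_right _ _))
      refine le_trans (iInf₂_le s ⟨?_, ?_⟩) (hs2.le.trans (min_le_left _ _))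
      · refine lt_of_le_of_lt ?_ hs1'
        gcongr
        exact_mod_cast hj1
      · have hfl : ⌊(n : ℝ≥0) * s⌋₊ = j := by
          rw [Nat.floor_eq_iff (by positivity)]
          rw [div_lt_iff₀ hn0, mul_comm] at hs1'
          rw [lt_div_iff₀ hn0, mul_comm] at hs2'
          exact ⟨hs1'.le, by exact_mod_cast hs2'⟩
        beta_reduce
        rw [hω s, hfl, ← h0]
    refine (h'.trans_le hle).not_ge (ENNReal.coe_le_coe.2 ?_)
    rw [div_le_iff₀ hn0, mul_comm]
    exact (Nat.cast_le.2 hj2).trans (Nat.floor_le (by positivity))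
  · have hle : (((⌊(n : ℝ≥0) * τ⌋₊ + 1 : ℕ) / n : ℝ≥0) : ℝ≥0∞) ≤
        hitZeroAfter (1 / (n : ℝ≥0)) fun s => Z s ω := by
      refine le_iInf₂ fun s hs => ENNReal.coe_le_coe.2 ?_
      obtain ⟨hs1, hs2⟩ := hs
      have h1 : 1 ≤ ⌊(n : ℝ≥0) * s⌋₊ := by
        rw [Nat.one_le_floor_iff]
        rw [div_lt_iff₀ hn0, mul_comm] at hs1
        exact hs1.le
      have h2 : ⌊(n : ℝ≥0) * τ⌋₊ + 1 ≤ ⌊(n : ℝ≥0) * s⌋₊ := by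
        by_contra hlt
        have h3 := h _ h1 (by omega)
        rw [← hω s] at h3
        exact h3.ne' hs2
      rw [div_le_iff₀ hn0, mul_comm s]
      exact (Nat.cast_le.2 h2).trans (Nat.floor_le (by positivity))
    refine lt_of_lt_of_le (ENNReal.coe_lt_coe.2 ?_) hle
    rw [lt_div_iff₀ hn0, mul_comm τ]
    push_cast
    exact Nat.lt_floor_add_one _

/-- Conditional expectations of the scaled process in terms of the law of the BGWI process. -/
theorem integral_cond_eq [IsProbabilityMeasure P] (hZ : IsScaledBGWI μ ν n b Z P) (hn : 0 < n)
    (hb : 0 < b) {τ : ℝ≥0} {A : Set Ω} (hA : A =ᵐ[P] posSkeleton Z n ⌊(n : ℝ≥0) * τ⌋₊)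
    {φ : ℝ → ℝ} (hφ : Measurable φ) :
    ∫ ω, φ (Z τ ω) ∂(P[|A]) = (∫ z in noZero ⌊(n : ℝ≥0) * τ⌋₊,
      φ ((z ⌊(n : ℝ≥0) * τ⌋₊ : ℝ) / b) ∂(law μ ν)) /
        (law μ ν).real (noZero ⌊(n : ℝ≥0) * τ⌋₊) := by
  have h1 : (P A).toReal = (law μ ν).real (noZero ⌊(n : ℝ≥0) * τ⌋₊) := by
    have h2 := integral_posSkeleton hZ hn hb ⌊(n : ℝ≥0) * τ⌋₊ (φ := fun _ => 1) measurable_const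
    simp only [integral_const, smul_eq_mul, mul_one, measureReal_restrict_apply_univ] at h2
    rw [measure_congr hA, ← h2]
    rfl
  rw [ProbabilityTheory.cond, Measure.restrict_congr_set hA, integral_smul_measure,
    ENNReal.toReal_inv, h1, smul_eq_mul, inv_mul_eq_div, ← integral_posSkeleton hZ hn hb _ hφ]
  congr 1
  refine integral_congr_ae (ae_restrict_of_ae ?_)
  filter_upwards [ae_eq_step hZ hn] with ω hω
  rw [hω τ]

theorem isProbabilityMeasure_cond_of_pos [IsProbabilityMeasure P] (hZ : IsScaledBGWI μ ν n b Z P)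
    (hn : 0 < n) (hb : 0 < b) {m : ℕ} {A : Set Ω} (hA : A =ᵐ[P] posSkeleton Z n m)
    (hpos : 0 < (law μ ν).real (noZero m)) : IsProbabilityMeasure (P[|A]) := by
  refine cond_isProbabilityMeasure ?_
  intro h0
  have h2 := integral_posSkeleton hZ hn hb m (φ := fun _ => 1) measurable_const
  simp only [integral_const, smul_eq_mul, mul_one, measureReal_restrict_apply_univ] at h2
  rw [← h2, measureReal_def, ← measure_congr hA, h0] at hpos
  simp at hpos

theorem integral_exp_cond_eq [IsProbabilityMeasure P] (hZ : IsScaledBGWI μ ν n b Z P) (hn : 0 < n)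
    (hb : 0 < b) {τ : ℝ≥0} {A : Set Ω} (hA : A =ᵐ[P] posSkeleton Z n ⌊(n : ℝ≥0) * τ⌋₊) (r : ℝ) :
    ∫ ω, Real.exp (-r * Z τ ω) ∂(P[|A]) =
      killed μ ν ⌊(n : ℝ≥0) * τ⌋₊ (1 - Real.exp (-(r / b))) /
        killed μ ν ⌊(n : ℝ≥0) * τ⌋₊ 0 := by
  rw [integral_cond_eq hZ hn hb hA (φ := fun x => Real.exp (-r * x)) (by fun_prop),
    killed_zero_right, killed, integral_indicator (measurableSet_noZero _)]
  congr 1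
  refine integral_congr_ae (ae_of_all _ fun z => ?_)
  beta_reduce
  rw [sub_sub_cancel, ← Real.exp_nat_mul]
  congr 1
  ring

end Scaled

section Scaling

variable {μ ν : PMF ℕ} {α c d : ℝ} {ℓ k : ℝ → ℝ}

/-- Regular variation of `β`, uniformly in the ratio of the arguments; uniformity is a consequence
of the monotonicity of `β`. -/
theorem tendsto_rate_div_rate (hSL : SL μ ν α c d ℓ k) {x y : ℕ → ℝ}
    (hx : Tendsto x atTop (𝓝[>] 0)) {r : ℝ} (hr : 0 < r)
    (hxy : Tendsto (fun n => y n / x n) atTop (𝓝 r)) :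
    Tendsto (fun n => rate μ (y n) / rate μ (x n)) atTop (𝓝 (r ^ α)) := by
  have hcont : ContinuousAt (fun a : ℝ => a ^ α) r := Real.continuousAt_rpow_const _ _ (Or.inl hr.ne')
  have hr1 : ∀ a : ℝ, 0 < a →
      Tendsto (fun n => rate μ (a * x n) / rate μ (x n)) atTop (𝓝 (a ^ α)) := fun a ha =>
    (tendsto_rate_ratio hSL ha).comp hx
  rw [tendsto_order]
  constructor
  · intro B hB
    have h1 := hcont.tendsto.mono_left (nhdsWithin_le_nhds (s := Iio r))
    obtain ⟨a, ha, ha0, har⟩ := ((h1.eventually (lt_mem_nhds hB)).and (Ioo_mem_nhdsLT hr)).exists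
    filter_upwards [(hr1 a ha0).eventually (lt_mem_nhds ha), hxy.eventually (lt_mem_nhds har),
      hxy.eventually (gt_mem_nhds (show r < r + 1 by linarith)),
      hx.eventually (eventually_Ioo (r + 1) (by linarith)),
      hx.eventually (eventually_Ioo 1 one_pos)] with n h2 h3 h4 h5 h6
    rw [one_mul] at h6
    refine h2.trans_le (div_le_div_of_nonneg_right ?_ (rate_pos hSL h6.1 h6.2.le).le)
    rw [lt_div_iff₀ h6.1] at h3
    rw [div_lt_iff₀ h6.1] at h4
    exact rate_mono μ (mul_pos ha0 h6.1) h3.le (h4.le.trans h5.2.le)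
  · intro B hB
    have h1 := hcont.tendsto.mono_left (nhdsWithin_le_nhds (s := Ioi r))
    obtain ⟨a, ha, har⟩ := ((h1.eventually (gt_mem_nhds hB)).and
      (self_mem_nhdsWithin (s := Ioi r))).exists
    filter_upwards [(hr1 a (hr.trans har)).eventually (gt_mem_nhds ha),
      hxy.eventually (gt_mem_nhds har), hxy.eventually (lt_mem_nhds hr),
      hx.eventually (eventually_Ioo a (hr.trans har)),
      hx.eventually (eventually_Ioo 1 one_pos)] with n h2 h3 h4 h5 h6
    rw [one_mul] at h6
    refine lt_of_le_of_lt (div_le_div_of_nonneg_right ?_ (rate_pos hSL h6.1 h6.2.le).le) h2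
    rw [div_lt_iff₀ h6.1] at h3
    rw [lt_div_iff₀ h6.1, zero_mul] at h4
    exact rate_mono μ h4 h3.le h5.2.le

theorem tendsto_one_div_scaling {b : ℕ → ℝ} (hb : IsScalingSequence α ℓ b) :
    Tendsto (fun n => 1 / b n) atTop (𝓝[>] 0) := by
  simpa only [one_div, Function.comp_def] using tendsto_inv_atTop_nhdsGT_zero.comp hb.tendsto_atTop

theorem tendsto_mul_rate_scaling (hSL : SL μ ν α c d ℓ k) {b : ℕ → ℝ}
    (hb : IsScalingSequence α ℓ b) :
    Tendsto (fun n : ℕ => n * rate μ (1 / b n)) atTop (𝓝 c) := by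
  have h1 := (hb.equiv.inv₀ one_ne_zero).const_mul c
  rw [inv_one, mul_one] at h1
  refine h1.congr' ?_
  filter_upwards [(tendsto_one_div_scaling hb).eventually (eventually_Ioo 1 one_pos),
    hb.tendsto_atTop.eventually_gt_atTop 0] with n h2 h3
  rw [one_mul] at h2
  rw [rate_eq hSL h2, inv_div, Real.div_rpow zero_le_one h3.le, Real.one_rpow]
  ring

theorem tendsto_floor_div {t : ℝ≥0} {τ : ℕ → ℝ≥0} (hτ : Tendsto τ atTop (𝓝 t)) :
    Tendsto (fun n : ℕ => (⌊(n : ℝ≥0) * τ n⌋₊ : ℝ) / n) atTop (𝓝 t) := by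
  have hτ' : Tendsto (fun n => (τ n : ℝ)) atTop (𝓝 t) := NNReal.tendsto_coe.2 hτ
  have h0 : Tendsto (fun n : ℕ => (τ n : ℝ) - 1 / n) atTop (𝓝 t) := by
    simpa using hτ'.sub (tendsto_one_div_atTop_nhds_zero_nat (𝕜 := ℝ))
  refine tendsto_of_tendsto_of_tendsto_of_le_of_le' h0 hτ' ?_ ?_
  · filter_upwards [eventually_gt_atTop 0] with n hn
    have hn0 : (0 : ℝ) < n := by exact_mod_cast hn
    have h1 : ((n : ℝ≥0) * τ n : ℝ≥0) < ⌊(n : ℝ≥0) * τ n⌋₊ + 1 := Nat.lt_floor_add_one _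
    have h2 : (n : ℝ) * τ n < ⌊(n : ℝ≥0) * τ n⌋₊ + 1 := by exact_mod_cast h1
    rw [le_div_iff₀ hn0, sub_mul, one_div_mul_cancel hn0.ne']
    linarith
  · filter_upwards [eventually_gt_atTop 0] with n hn
    have hn0 : (0 : ℝ) < n := by exact_mod_cast hn
    have h1 : (⌊(n : ℝ≥0) * τ n⌋₊ : ℝ≥0) ≤ (n : ℝ≥0) * τ n := Nat.floor_le (by positivity)
    have h2 : (⌊(n : ℝ≥0) * τ n⌋₊ : ℝ) ≤ n * τ n := by exact_mod_cast h1
    rw [div_le_iff₀ hn0]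
    linarith

theorem tendsto_floor_atTop {t : ℝ≥0} (ht : 0 < t) {τ : ℕ → ℝ≥0} (hτ : Tendsto τ atTop (𝓝 t)) :
    Tendsto (fun n : ℕ => ⌊(n : ℝ≥0) * τ n⌋₊) atTop atTop := by
  refine (tendsto_natCast_atTop_iff (R := ℝ)).1 ?_
  have h1 := (tendsto_natCast_atTop_atTop (R := ℝ)).atTop_mul_pos
    (NNReal.coe_pos.2 ht) (tendsto_floor_div hτ)
  refine h1.congr' ?_
  filter_upwards [eventually_gt_atTop 0] with n hn
  have hn0 : (n : ℝ) ≠ 0 := by positivity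
  field_simp

/-- The limit of the conditional Laplace transforms of the discrete process, in the scaling of the
theorem. -/
theorem tendsto_killed_scaling (hν : 0 < ν 0) (hSL : SL μ ν α c d ℓ k)
    (hδ : d / (α * c) ∈ Ioo (0 : ℝ) 1) {b : ℕ → ℝ} (hb : IsScalingSequence α ℓ b) {t : ℝ≥0}
    (ht : 0 < t) {τ : ℕ → ℝ≥0} (hτ : Tendsto τ atTop (𝓝 t)) :
    (∀ᶠ m in atTop, 0 < killed μ ν m 0) ∧ ∀ r : ℝ, 0 ≤ r →
      Tendsto (fun n : ℕ => killed μ ν ⌊(n : ℝ≥0) * τ n⌋₊ (1 - Real.exp (-(r / b n))) /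
        killed μ ν ⌊(n : ℝ≥0) * τ n⌋₊ 0) atTop (𝓝 (1 + α * c * t * r ^ α)⁻¹) := by
  obtain ⟨hpos, hlim⟩ := tendsto_killed_ratio hSL hν hδ (v := killed μ ν)
    (fun q _ => killed_zero_left μ ν) (fun m q hq => killed_succ μ ν m hq.1 hq.2)
    (fun m => killed_one_right μ ν m)
    (antitone_nat_of_succ_le fun m => by
      rw [killed_zero_right, killed_zero_right]
      exact measureReal_mono (noZero_succ_subset m))
    (fun m => by rw [killed_zero_right]; exact measureReal_nonneg)
  refine ⟨hpos, fun r hr => ?_⟩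
  have hN := tendsto_floor_atTop ht hτ
  rcases hr.eq_or_lt with rfl | hr
  · rw [Real.zero_rpow hSL.alpha_pos.ne', mul_zero, add_zero, inv_one]
    refine tendsto_const_nhds.congr' ?_
    filter_upwards [hN.eventually hpos] with n h
    rw [zero_div, neg_zero, Real.exp_zero, sub_self, div_self h.ne']
  · have hx := tendsto_one_div_scaling hb
    have hrb : Tendsto (fun n => -(r / b n)) atTop (𝓝[≠] 0) := by
      refine tendsto_nhdsWithin_iff.2 ⟨?_, ?_⟩
      · have := ((hx.mono_right nhdsWithin_le_nhds).const_mul r).neg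
        rw [mul_zero, neg_zero] at this
        exact this.congr fun n => by ring
      · filter_upwards [hb.tendsto_atTop.eventually_gt_atTop 0] with n h
        exact neg_ne_zero.2 (div_pos hr h).ne'
    have hq : Tendsto (fun n => (1 - Real.exp (-(r / b n))) / (1 / b n)) atTop (𝓝 r) := by
      have hd : HasDerivAt (fun y : ℝ => Real.exp y) 1 0 := by
        simpa using Real.hasDerivAt_exp 0
      have h3 := hd.tendsto_slope_zero
      simp only [zero_add, Real.exp_zero, smul_eq_mul] at h3
      have h4 := (h3.comp hrb).const_mul r
      rw [mul_one] at h4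
      refine h4.congr' ?_
      filter_upwards [hb.tendsto_atTop.eventually_gt_atTop 0] with n h
      have := h.ne'
      have := hr.ne'
      rw [Function.comp_apply]
      field_simp
      ring
    have hq0 : Tendsto (fun n => 1 - Real.exp (-(r / b n))) atTop (𝓝[>] 0) := by
      refine tendsto_nhdsWithin_iff.2 ⟨?_, ?_⟩
      · have := (Real.continuous_exp.tendsto 0).comp (hrb.mono_right nhdsWithin_le_nhds)
        rw [Real.exp_zero] at this
        simpa using this.const_sub 1
      · filter_upwards [hb.tendsto_atTop.eventually_gt_atTop 0] with n h
        rw [mem_Ioi, sub_pos, Real.exp_lt_one_iff, neg_lt_zero]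
        exact div_pos hr h
    have hθ : Tendsto (fun n : ℕ => (⌊(n : ℝ≥0) * τ n⌋₊ : ℝ) *
        rate μ (1 - Real.exp (-(r / b n)))) atTop (𝓝 (t * c * r ^ α)) := by
      have h1 := ((tendsto_floor_div hτ).mul (tendsto_mul_rate_scaling hSL hb)).mul
        (tendsto_rate_div_rate hSL hx hr hq)
      refine h1.congr' ?_
      filter_upwards [eventually_gt_atTop 0, hx.eventually (eventually_Ioo 1 one_pos)] with n hn h2
      rw [one_mul] at h2
      have hn0 : (n : ℝ) ≠ 0 := by positivity
      have := (rate_pos hSL h2.1 h2.2.le).ne'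
      field_simp
    have h2 := hlim _ _ _ hq0 hN hθ (by
      have := hSL.c_pos
      have := Real.rpow_pos_of_pos hr α
      have : (0 : ℝ) < t := ht
      positivity)
    have e : α * (t * c * r ^ α) = α * c * t * r ^ α := by ring
    rwa [e] at h2

end Scaling

end BGWI

theorem theorem3
    (μ ν : PMF ℕ) (hμ : μ 1 < 1) (hν : 0 < ν 0)
    (α c d : ℝ) (ℓ k : ℝ → ℝ) (hSL : BGWI.SL μ ν α c d ℓ k)
    (hδ : d / (α * c) ∈ Set.Ioo (0 : ℝ) 1)
    (b : ℕ → ℝ) (hb : BGWI.IsScalingSequence α ℓ b)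
    (Ω : ℕ → Type*) [∀ n, MeasurableSpace (Ω n)]
    (P : ∀ n, Measure (Ω n)) [∀ n, IsProbabilityMeasure (P n)]
    (Z : ∀ n, ℝ≥0 → Ω n → ℝ) (hZ : ∀ n, BGWI.IsScaledBGWI μ ν n (b n) (Z n) (P n))
    (t : ℝ≥0) (ht : 0 < t) (τ : ℕ → ℝ≥0) (hτ : Tendsto τ atTop (𝓝 t)) :
    (∃! L : Measure ℝ, BGWI.IsLinnikLaw α (α * c * t) L) ∧
    (∀ L : Measure ℝ, BGWI.IsLinnikLaw α (α * c * t) L →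
      BGWI.ConvergesWeakly
        (fun n => ((P n)[|{ω | ∀ s ∈ Set.Icc (1 / (n : ℝ≥0)) (τ n), 0 < Z n s ω}]).map
          (Z n (τ n))) L) ∧
    (∀ r : ℝ, 0 ≤ r →
      Tendsto
        (fun n : ℕ => ∫ ω, Real.exp (-r * Z n (τ n) ω)
          ∂((P n)[|{ω | (τ n : ℝ≥0∞) < BGWI.hitZeroAfter (1 / (n : ℝ≥0)) fun s => Z n s ω}]))
        atTop (𝓝 (1 + α * c * t * r ^ α)⁻¹)) := by
  obtain ⟨hpos, hlim⟩ := BGWI.tendsto_killed_scaling hν hSL hδ hb ht hτ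
  have hgood : ∀ᶠ n : ℕ in atTop, 0 < n ∧ 0 < b n ∧
      0 < (BGWI.law μ ν).real (BGWI.noZero ⌊(n : ℝ≥0) * τ n⌋₊) := by
    filter_upwards [eventually_gt_atTop 0, hb.tendsto_atTop.eventually_gt_atTop 0,
      (BGWI.tendsto_floor_atTop ht hτ).eventually hpos] with n h1 h2 h3
    rw [BGWI.killed_zero_right] at h3
    exact ⟨h1, h2, h3⟩
  obtain ⟨n0, hn0⟩ := eventually_atTop.1 hgood
  -- the conditional laws, from the first index on at which the conditioning is nondegenerate
  set ρ : ℕ → Measure ℝ := fun n =>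
    ((P n)[|{ω | ∀ s ∈ Set.Icc (1 / (n : ℝ≥0)) (τ n), 0 < Z n s ω}]).map (Z n (τ n)) with hρ
  have hcond : ∀ n, n0 ≤ n →
      IsProbabilityMeasure ((P n)[|{ω | ∀ s ∈ Set.Icc (1 / (n : ℝ≥0)) (τ n), 0 < Z n s ω}]) :=
    fun n hn => BGWI.isProbabilityMeasure_cond_of_pos (hZ n) (hn0 n hn).1 (hn0 n hn).2.1
      (BGWI.posOn_ae_eq (hZ n) (hn0 n hn).1 (τ n)) (hn0 n hn).2.2
  have hprob : ∀ n, IsProbabilityMeasure (ρ (n + n0)) := fun n => by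
    have := hcond (n + n0) (Nat.le_add_left _ _)
    exact Measure.isProbabilityMeasure_map ((hZ _).measurable _).aemeasurable
  have hnn : ∀ n, ∀ᵐ x ∂ρ (n + n0), 0 ≤ x := fun n => by
    obtain ⟨h1, h2, -⟩ := hn0 (n + n0) (Nat.le_add_left _ _)
    rw [hρ]
    refine (ae_map_iff ((hZ _).measurable _).aemeasurable measurableSet_Ici).2 ?_
    refine cond_absolutelyContinuous.ae_le ?_
    filter_upwards [BGWI.ae_eq_step (hZ (n + n0)) h1, BGWI.ae_skeleton_nonneg (hZ (n + n0)) h1 h2]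
      with ω hω hω'
    rw [hω]
    exact hω' _
  have hlap : ∀ r : ℝ, 0 ≤ r → Tendsto (fun n => ∫ x, Real.exp (-r * x) ∂ρ (n + n0)) atTop
      (𝓝 (1 + α * c * t * r ^ α)⁻¹) := by
    intro r hr
    refine ((tendsto_add_atTop_iff_nat n0).2 (hlim r hr)).congr fun n => ?_
    obtain ⟨h1, h2, -⟩ := hn0 (n + n0) (Nat.le_add_left _ _)
    rw [hρ]
    beta_reduce
    rw [integral_map ((hZ _).measurable _).aemeasurable (by fun_prop)]
    exact (BGWI.integral_exp_cond_eq (hZ _) h1 h2 (BGWI.posOn_ae_eq (hZ _) h1 _) r).symm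
  have hG : Tendsto (fun r : ℝ => (1 + α * c * t * r ^ α)⁻¹) (𝓝[>] 0) (𝓝 1) := by
    have hc : ContinuousAt (fun r : ℝ => (1 + α * c * t * r ^ α)⁻¹) 0 := by
      have h1 : ContinuousAt (fun r : ℝ => r ^ α) 0 :=
        Real.continuousAt_rpow_const _ _ (Or.inr hSL.alpha_pos.le)
      refine ContinuousAt.inv₀ (by fun_prop) ?_
      simp [Real.zero_rpow hSL.alpha_pos.ne']
    have h2 := hc.tendsto
    simp only [Real.zero_rpow hSL.alpha_pos.ne', mul_zero, add_zero, inv_one] at h2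
    exact h2.mono_left nhdsWithin_le_nhds
  refine ⟨?_, ?_, ?_⟩
  · obtain ⟨L, hL1, hL2, hL3⟩ := BGWI.exists_law_of_tendsto_laplace hnn hlap hG
    refine ⟨L, ⟨hL1, hL2, hL3⟩, fun L' hL' => ?_⟩
    have := hL'.isProbabilityMeasure
    exact BGWI.eq_of_laplace_eq hL'.nonneg hL2 fun r hr => by rw [hL'.laplace r hr, hL3 r hr]
  · intro L hL φ
    have := hL.isProbabilityMeasure
    exact (tendsto_add_atTop_iff_nat n0).1 (BGWI.tendsto_integral_of_tendsto_laplace hnn hL.nonneg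
      (fun r hr => by rw [hL.laplace r hr]; exact hlap r hr) φ)
  · intro r hr
    refine (hlim r hr).congr' ?_
    filter_upwards [eventually_ge_atTop n0] with n hn
    obtain ⟨h1, h2, -⟩ := hn0 n hn
    exact (BGWI.integral_exp_cond_eq (hZ n) h1 h2 (BGWI.hitZeroAfter_ae_eq (hZ n) h1 h2) r).symm
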